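/- An \emph{out-tree} of a finite digraph $D$ is a subdigraph $T$ of $D$ that is an oriented tree with exactly one vertex $r$ of in-degree zero in $T$, called its \emph{root}; its \emph{leaves} are the vertices of out-degree zero in $T$ (so a single vertex is an out-tree with one leaf). An \emph{out-branching} of $D$ is a spanning out-tree. The problem $k$-Leaf Out-Branching (resp. $k$-Leaf Out-Tree) asks, given $(D,k)$, whether $D$ has an out-branching (resp. out-tree) with at least $k$ leaves. The rooted version of either problem asks, given $(D,r,k)$ with $r\in V(D)$, whether $D$ has one with at least $k$ leaves and root $r$. For each of the two problems $\Pi\in\{k\text{-Leaf Out-Branching},\ k\text{-Leaf Out-Tree}\}$ there are a constant $c$ and a polynomial-time algorithm (polynomial in the size of the adjacency matrix of $D$ plus the number of binary digits of $k$) which, given a digraph $D$ on $n$ vertices and an integer $k\ge 1$, outputs exactly $n$ instances $(D_v,r_v,k)$, one for each vertex $v\in V(D)$, of the rooted version of $\Pi$, with the same parameter $k$, such that 1. $|V(D_v)|\le c\,k^3$ for every $v\in V(D)$; 2. for every $v\in V(D)$, $(D_v,r_v,k)$ is a yes-instance of the rooted version of $\Pi$ if and only if $(D,v,k)$ is; 3.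 $(D,k)$ is a yes-instance of $\Pi$ if and only if, for at least one $v\in V(D)$, $(D_v,r_v,k)$ is a yes-instance of the rooted version of $\Pi$. For $k$-Leaf Out-Branching the instances can moreover be chosen so that $D$ has an out-branching with at least $k$ leaves if and only if, for at least one $v\in V(D)$, the digraph $D_v$ has an out-branching (with any root) with at least $k$ leaves. -/

import Mathlib

namespace LeafKernel

/-! ### Out-trees, out-branchings, leaves -/

/-- A subdigraph of a digraph: a set of vertices together with a set of arcs between them. -/
structure Subdigraph {V : Type} (D : Digraph V) where
  verts : Set V
  Adj : V → V → Prop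
  adj_sub : ∀ {u v : V}, Adj u v → D.Adj u v
  tail_mem : ∀ {u v : V}, Adj u v → u ∈ verts
  head_mem : ∀ {u v : V}, Adj u v → v ∈ verts

namespace Subdigraph

variable {V : Type} {D : Digraph V}

/-- The subdigraph as a digraph on its own vertex set. -/
def coe (T : Subdigraph D) : Digraph T.verts where
  Adj u v := T.Adj u v

/-- An oriented tree: there are no loops and no pairs of opposite arcs, and the underlying
undirected graph is a tree (connected, hence nonempty, and acyclic). -/
def IsOrientedTree (T : Subdigraph D) : Prop :=
  (∀ u v : V, T.Adj u v → ¬ T.Adj v u) ∧ T.coe.toSimpleGraphInclusive.IsTree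

/-- `T` is an out-tree with root `r`: an oriented tree whose only vertex of in-degree zero
is `r`. -/
def IsOutTree (T : Subdigraph D) (r : V) : Prop :=
  T.IsOrientedTree ∧ ∀ v : V, (v ∈ T.verts ∧ ∀ u : V, ¬ T.Adj u v) ↔ v = r

/-- `T` is an out-branching with root `r`: a spanning out-tree with root `r`. -/
def IsOutBranching (T : Subdigraph D) (r : V) : Prop :=
  T.IsOutTree r ∧ T.verts = Set.univ

/-- The leaves of `T`: its vertices of out-degree zero. -/
def leaves (T : Subdigraph D) : Set V :=
  {v | v ∈ T.verts ∧ ∀ w : V, ¬ T.Adj v w}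

end Subdigraph

/-! ### The four problems -/

/-- An instance `(D, k)` of the unrooted problems, with vertex set `{0, …, n - 1}`. -/
structure Instance where
  n : ℕ
  graph : Digraph (Fin n)
  k : ℕ

/-- An instance `(D, r, k)` of the rooted problems. -/
structure RootedInstance extends Instance where
  root : Fin n

/-- The instance `(D, v, k)` of the rooted problems obtained from `(D, k)` and a vertex `v`. -/
def Instance.rootAt (I : Instance) (v : Fin I.n) : RootedInstance where
  toInstance := I
  root := v

/-- `(D, r, k)` is a yes-instance of Rooted `k`-Leaf Out-Branching. -/
def RootedInstance.OutBranching (J : RootedInstance) : Prop :=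
  ∃ T : Subdigraph J.graph, T.IsOutBranching J.root ∧ J.k ≤ T.leaves.ncard

/-- `(D, r, k)` is a yes-instance of Rooted `k`-Leaf Out-Tree. -/
def RootedInstance.OutTree (J : RootedInstance) : Prop :=
  ∃ T : Subdigraph J.graph, T.IsOutTree J.root ∧ J.k ≤ T.leaves.ncard

/-- `(D, k)` is a yes-instance of `k`-Leaf Out-Branching. -/
def Instance.OutBranching (I : Instance) : Prop :=
  ∃ (T : Subdigraph I.graph) (r : Fin I.n), T.IsOutBranching r ∧ I.k ≤ T.leaves.ncard

/-- `(D, k)` is a yes-instance of `k`-Leaf Out-Tree. -/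
def Instance.OutTree (I : Instance) : Prop :=
  ∃ (T : Subdigraph I.graph) (r : Fin I.n), T.IsOutTree r ∧ I.k ≤ T.leaves.ncard

/-! ### Polynomial time

The model of computation is the language of while-programs over binary trees (the data type of
pure LISP): the only operations are building the empty tree, pairing, projecting, testing for
the empty tree, sequencing, branching and unbounded loops.  Every executed instruction costs one
plus the size of the tree that it is applied to, so a Turing machine (with trees written as
strings) simulates a run with polynomial overhead; conversely one Turing machine step is
simulated in time polynomial in the length of the tape.  Hence polynomial time in this model is
polynomial time in the usual sense. -/

/-- Binary trees, the data that programs work on. -/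
inductive Data where
  | nil : Data
  | cons : Data → Data → Data

namespace Data

/-- The number of nodes of a tree. -/
def size : Data → ℕ
  | nil => 1
  | cons a b => a.size + b.size + 1

/-- The left subtree (`nil` for the empty tree). -/
def left : Data → Data
  | nil => nil
  | cons a _ => a

/-- The right subtree (`nil` for the empty tree). -/
def right : Data → Data
  | nil => nil
  | cons _ b => b

end Data

/-- Programs. -/
inductive Prog where
  | skip : Prog
  | empty : Prog
  | left : Prog
  | right : Prog
  | pair : Prog → Prog → Prog
  | seq : Prog → Prog → Prog
  | ifte : Prog → Prog → Prog → Prog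
  | loop : Prog → Prog → Prog

/-- `Run p x y t`: the program `p`, started on input `x`, halts with output `y` after time `t`.
`pair p q` runs `p` and `q` on the same input and pairs their outputs; `seq p q` runs `p` and then
`q`; `ifte c p q` runs `p` if the test `c` yields a nonempty tree, and `q` otherwise; `loop c p`
repeats `p` as long as the test `c` yields a nonempty tree. -/
inductive Run : Prog → Data → Data → ℕ → Prop where
  | skip (x : Data) : Run .skip x x (1 + x.size)
  | empty (x : Data) : Run .empty x .nil (1 + x.size)
  | left (x : Data) : Run .left x x.left (1 + x.size)
  | right (x : Data) : Run .right x x.right (1 + x.size)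
  | pair {p q : Prog} {x y z : Data} {s t : ℕ} (hp : Run p x y s) (hq : Run q x z t) :
      Run (.pair p q) x (.cons y z) (1 + x.size + s + t)
  | seq {p q : Prog} {x y z : Data} {s t : ℕ} (hp : Run p x y s) (hq : Run q y z t) :
      Run (.seq p q) x z (1 + x.size + s + t)
  | ifte_true {c p q : Prog} {x a b y : Data} {s t : ℕ} (hc : Run c x (.cons a b) s)
      (hp : Run p x y t) : Run (.ifte c p q) x y (1 + x.size + s + t)
  | ifte_false {c p q : Prog} {x y : Data} {s t : ℕ} (hc : Run c x .nil s)
      (hq : Run q x y t) : Run (.ifte c p q) x y (1 + x.size + s + t)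
  | loop_stop {c p : Prog} {x : Data} {s : ℕ} (hc : Run c x .nil s) :
      Run (.loop c p) x x (1 + x.size + s)
  | loop_step {c p : Prog} {x a b y z : Data} {s t u : ℕ} (hc : Run c x (.cons a b) s)
      (hp : Run p x y t) (hl : Run (.loop c p) y z u) :
      Run (.loop c p) x z (1 + x.size + s + t + u)

/-- `f` is computable in polynomial time with respect to the given encodings of its arguments and
values: some program computes `f` in time bounded by a polynomial in the size of the input. -/
def PolyTime {α β : Type} (encA : α → Data) (encB : β → Data) (f : α → β) : Prop :=
  ∃ (p : Prog) (P : Polynomial ℕ), ∀ a : α, ∃ t : ℕ,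
    t ≤ P.eval (encA a).size ∧ Run p (encA a) (encB (f a)) t

/-! ### Encodings -/

/-- A list is encoded as the right comb of the codes of its entries. -/
def encodeList {α : Type} (enc : α → Data) (l : List α) : Data :=
  l.foldr (fun a d => .cons (enc a) d) .nil

/-- The code of a truth value. -/
def encodeBool : Bool → Data
  | false => .nil
  | true => .cons .nil .nil

/-- The binary code of a natural number, least significant bit first. -/
def encodeNat (m : ℕ) : Data :=
  encodeList encodeBool m.bits

open Classical in
/-- A digraph on `{0, …, n - 1}` is encoded by its adjacency matrix, a list of `n` rows. -/
noncomputable def encodeGraph {n : ℕ} (D : Digraph (Fin n)) : Data :=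
  encodeList (fun u : Fin n =>
    encodeList (fun v : Fin n => encodeBool (decide (D.Adj u v))) (List.finRange n))
    (List.finRange n)

/-- The code of `(D, k)`: the adjacency matrix of `D` and the binary code of `k`. -/
noncomputable def Instance.encode (I : Instance) : Data :=
  .cons (encodeGraph I.graph) (encodeNat I.k)

/-- The code of `(D, r, k)`. -/
noncomputable def RootedInstance.encode (J : RootedInstance) : Data :=
  .cons (encodeNat J.root) J.toInstance.encode

end LeafKernel

namespace LeafKernel

/-! ### A library of polynomial-time functions -/

/-! An out-tree with root `r` and at least `k` leaves exists exactly if at least `k` vertices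
reachable from `r` can be kept out of the interior of walks without losing any reachable vertex
(`HasLeaves`, `RootedInstance.outTree_iff`). For branchings one only adds that everything is
reachable (`RootedInstance.outBranching_iff`).

Three rules preserve `HasLeaves`: bypassing a cut vertex (`hasLeaves_bypass_cutVertex_iff`),
deleting an arc `(y, x)` whose tail is reached only through other in-neighbours of `x`
(`hasLeaves_delArc_iff`), and bypassing the middle one of three inner vertices of a bidirected path
(`IsBipath.hasLeaves_bypass_iff`). They are applied exhaustively.

The core is that a reduced digraph without `k` leaves has `O(k³)` vertices (`card_le_of_reduced`).
As there are no cut vertices, the vertices can be numbered so that each one is an out-neighbour of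
the root or has a lower in-neighbour `f v` and a higher one `b v` (`exists_numbering`). These give a
forward and a backward spanning tree, and mixing them gives many more. Each has fewer than `k`
leaves, so its parent map is nearly injective. Hence all but `13 * k` non-root vertices have just
the in-neighbours `f v` and `b v` and are their only child in the respective tree
(`Layout.card_bad_le`), and `f` and `b` invert each other except at `O(k²)` of them
(`Layout.card_unmatched_le`). What remains splits into `O(k²)` chains, each with at most `4 * k`
vertices that send arcs elsewhere (`Matched.card_exits_le`); here the arc rule enters. Away from
those vertices and the chain ends, the path rule leaves only boundedly many vertices in a row.

So a reduced digraph with more than `2000 * k ^ 3` vertices is a yes-instance and is replaced by a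
star; a smaller one is the kernel itself. Its root has in-degree zero, hence is the root of all its
out-branchings. -/

theorem eval_mono (P : Polynomial ℕ) {m n : ℕ} (h : m ≤ n) : P.eval m ≤ P.eval n := by
  simp only [Polynomial.eval_eq_sum, Polynomial.sum]
  exact Finset.sum_le_sum fun i _ => Nat.mul_le_mul_left _ (Nat.pow_le_pow_left h i)

/-- Every instruction pays for the tree it reads. Composition stays polynomial for this reason: the
second program meets an input of polynomial size. -/
theorem Run.size_le {p : Prog} {x y : Data} {t : ℕ} (h : Run p x y t) : y.size ≤ t := by
  induction h with
  | skip x => omega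
  | empty x => simp only [Data.size]; omega
  | left x => cases x <;> simp only [Data.left, Data.size] <;> omega
  | right x => cases x <;> simp only [Data.right, Data.size] <;> omega
  | pair _ _ h1 h2 => simp only [Data.size]; omega
  | _ => omega

/-- Types whose elements are coded as binary trees. -/
class Enc (α : Type) where
  enc : α → Data

open Enc

instance : Enc Data := ⟨id⟩
instance : Enc Unit := ⟨fun _ => .nil⟩
instance : Enc Bool := ⟨encodeBool⟩
instance {α β : Type} [Enc α] [Enc β] : Enc (α × β) := ⟨fun p => .cons (enc p.1) (enc p.2)⟩
instance {α : Type} [Enc α] : Enc (List α) := ⟨encodeList enc⟩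
/-- Natural numbers are coded in unary. -/
instance : Enc ℕ := ⟨fun n => encodeList (fun _ : Unit => .nil) (List.replicate n ())⟩
instance {α : Type} [Enc α] (p : α → Prop) : Enc {a // p a} := ⟨fun a => enc a.1⟩

/-- The size of the code of an element. -/
def sz {α : Type} [Enc α] (a : α) : ℕ := (enc a).size

/-- Functions computable in polynomial time. -/
def PT {α β : Type} [Enc α] [Enc β] (f : α → β) : Prop := PolyTime enc enc f

variable {α β γ δ : Type} [Enc α] [Enc β] [Enc γ] [Enc δ]

theorem sz_pair (a : α) (b : β) : sz (a, b) = sz a + sz b + 1 := rfl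

theorem sz_cons (a : α) (l : List α) : sz (a :: l) = sz a + sz l + 1 := rfl

theorem sz_nil : sz ([] : List α) = 1 := rfl

theorem sz_le_of_mem {a : α} {l : List α} (h : a ∈ l) : sz a ≤ sz l := by
  induction l with
  | nil => simp at h
  | cons b l ih =>
    rw [sz_cons]
    rcases List.mem_cons.1 h with rfl | h
    · omega
    · have := ih h; omega

theorem length_le_sz (l : List α) : l.length ≤ sz l := by
  induction l with
  | nil => simp
  | cons b l ih => rw [sz_cons, List.length_cons]; omega

theorem sz_le_of_sublist {l l' : List α} (h : List.Sublist l l') : sz l ≤ sz l' := by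
  induction h with
  | slnil => rfl
  | cons a _ ih => rw [sz_cons]; omega
  | cons_cons a _ ih => rw [sz_cons, sz_cons]; omega

theorem sz_append (l l' : List α) : sz (l ++ l') + 1 = sz l + sz l' := by
  induction l with
  | nil => simp [sz_nil]; omega
  | cons a l ih => rw [List.cons_append, sz_cons, sz_cons]; omega

theorem PT.sz_le {f : α → β} (hf : PT f) :
    ∃ P : Polynomial ℕ, ∀ a, sz (f a) ≤ P.eval (sz a) := by
  obtain ⟨p, P, h⟩ := hf
  refine ⟨P, fun a => ?_⟩
  obtain ⟨t, ht, hr⟩ := h a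
  exact hr.size_le.trans ht

/-- Programs only see codes, so functions between different types with the same codes share a
program. This makes consing a pairing, and a unary number a list of units. -/
theorem PT.of_enc {α' β' : Type} [Enc α'] [Enc β'] {f : α → β} (hf : PT f) (f' : α' → β')
    (g : α' → α) (hg : ∀ a, enc a = enc (g a)) (h : ∀ a, enc (f' a) = enc (f (g a))) : PT f' := by
  obtain ⟨p, P, hp⟩ := hf
  refine ⟨p, P, fun a => ?_⟩
  rw [hg, h]
  exact hp (g a)

theorem PT.congr {f g : α → β} (hf : PT f) (h : ∀ a, g a = f a) : PT g :=
  (funext h : g = f) ▸ hf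

theorem PT.id : PT (fun a : α => a) :=
  ⟨.skip, 1 + .X, fun a => ⟨_, by simp, .skip _⟩⟩

theorem PT.comp {f : β → γ} {g : α → β} (hf : PT f) (hg : PT g) : PT (fun a => f (g a)) := by
  obtain ⟨p, P, hp⟩ := hf
  obtain ⟨q, Q, hq⟩ := hg
  refine ⟨.seq q p, 1 + .X + Q + P.comp Q, fun a => ?_⟩
  obtain ⟨t, ht, hr⟩ := hq a
  obtain ⟨s, hs, hr'⟩ := hp (g a)
  refine ⟨_, ?_, .seq hr hr'⟩
  have := eval_mono P (hr.size_le.trans ht)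
  simp only [Polynomial.eval_add, Polynomial.eval_one, Polynomial.eval_X, Polynomial.eval_comp]
  omega

theorem PT.pair {f : α → β} {g : α → γ} (hf : PT f) (hg : PT g) : PT (fun a => (f a, g a)) := by
  obtain ⟨p, P, hp⟩ := hf
  obtain ⟨q, Q, hq⟩ := hg
  refine ⟨.pair p q, 1 + .X + P + Q, fun a => ?_⟩
  obtain ⟨t, ht, hr⟩ := hp a
  obtain ⟨s, hs, hr'⟩ := hq a
  refine ⟨_, ?_, .pair hr hr'⟩
  simp only [Polynomial.eval_add, Polynomial.eval_one, Polynomial.eval_X]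
  omega

theorem PT.fst {f : α → β × γ} (hf : PT f) : PT (fun a => (f a).1) :=
  PT.comp (f := Prod.fst) ⟨.left, 1 + .X, fun a => ⟨_, by simp, .left _⟩⟩ hf

theorem PT.snd {f : α → β × γ} (hf : PT f) : PT (fun a => (f a).2) :=
  PT.comp (f := Prod.snd) ⟨.right, 1 + .X, fun a => ⟨_, by simp, .right _⟩⟩ hf

theorem PT.const (b : β) : PT (fun _ : α => b) := by
  have key : ∀ d : Data, ∃ (p : Prog) (P : Polynomial ℕ), ∀ x : Data, ∃ t,
      t ≤ P.eval x.size ∧ Run p x d t := by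
    intro d
    induction d with
    | nil => exact ⟨.empty, 1 + .X, fun x => ⟨_, by simp, .empty _⟩⟩
    | cons a b iha ihb =>
      obtain ⟨p, P, hp⟩ := iha
      obtain ⟨q, Q, hq⟩ := ihb
      refine ⟨.pair p q, 1 + .X + P + Q, fun x => ?_⟩
      obtain ⟨t, ht, hr⟩ := hp x
      obtain ⟨s, hs, hr'⟩ := hq x
      refine ⟨_, ?_, .pair hr hr'⟩
      simp only [Polynomial.eval_add, Polynomial.eval_one, Polynomial.eval_X]
      omega
  obtain ⟨p, P, h⟩ := key (enc b)
  exact ⟨p, P, fun a => h _⟩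

theorem PT.ite_of_enc {c : α → β} {b : α → Bool} (hb : ∀ a, b a = true ↔ enc (c a) ≠ .nil)
    {f g : α → γ} (hc : PT c) (hf : PT f) (hg : PT g) :
    PT (fun a => if b a = true then f a else g a) := by
  obtain ⟨r, R, hr⟩ := hc
  obtain ⟨p, P, hp⟩ := hf
  obtain ⟨q, Q, hq⟩ := hg
  refine ⟨.ifte r p q, 1 + .X + R + P + Q, fun a => ?_⟩
  obtain ⟨u, hu, hu'⟩ := hr a
  obtain ⟨t, ht, ht'⟩ := hp a
  obtain ⟨s, hs, hs'⟩ := hq a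
  have e := hb a
  beta_reduce
  cases hca : enc (c a) with
  | nil =>
    rw [hca] at hu'
    rw [if_neg (by rw [e, hca]; simp)]
    refine ⟨_, ?_, .ifte_false hu' hs'⟩
    simp only [Polynomial.eval_add, Polynomial.eval_one, Polynomial.eval_X]
    omega
  | cons x y =>
    rw [hca] at hu'
    rw [if_pos (by rw [e, hca]; simp)]
    refine ⟨_, ?_, .ifte_true hu' ht'⟩
    simp only [Polynomial.eval_add, Polynomial.eval_one, Polynomial.eval_X]
    omega

theorem PT.ite {c : α → Bool} {f g : α → γ} (hc : PT c) (hf : PT f) (hg : PT g) :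
    PT (fun a => if c a = true then f a else g a) :=
  PT.ite_of_enc (fun a => by cases c a <;> simp [enc, encodeBool]) hc hf hg

theorem PT.not {c : α → Bool} (hc : PT c) : PT (fun a => !c a) :=
  (PT.ite hc (PT.const false) (PT.const true)).congr fun a => by cases c a <;> rfl

theorem PT.and {c d : α → Bool} (hc : PT c) (hd : PT d) : PT (fun a => c a && d a) :=
  (PT.ite hc hd (PT.const false)).congr fun a => by cases c a <;> simp

theorem PT.or {c d : α → Bool} (hc : PT c) (hd : PT d) : PT (fun a => c a || d a) :=
  (PT.ite hc (PT.const true) hd).congr fun a => by cases c a <;> simp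

theorem PT.beqBool {c d : α → Bool} (hc : PT c) (hd : PT d) : PT (fun a => c a == d a) :=
  (PT.ite hc hd hd.not).congr fun a => by cases c a <;> simp

theorem PT.cons {f : α → β} {g : α → List β} (hf : PT f) (hg : PT g) :
    PT (fun a => f a :: g a) :=
  (hf.pair hg).of_enc _ (fun a => a) (fun _ => rfl) fun _ => rfl

theorem PT.tail {f : α → List β} (hf : PT f) : PT (fun a => (f a).tail) :=
  PT.comp (f := List.tail) ⟨.right, 1 + .X, fun a => ⟨1 + (enc a).size, by simp, by
    cases a <;> exact .right _⟩⟩ hf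

theorem PT.isEmpty {f : α → List β} (hf : PT f) : PT (fun a => (f a).isEmpty) :=
  (PT.ite_of_enc (b := fun a => !(f a).isEmpty)
    (fun a => by cases f a <;> simp [enc, encodeList]) hf (PT.const false)
    (PT.const true)).congr fun a => by cases f a <;> rfl

theorem PT.head {P : α → Prop} {f : {a // P a} → List β} (hf : PT f) (h : ∀ a, f a ≠ []) :
    PT (fun a => (f a).head (h a)) := by
  refine (PT.comp (f := Data.left) (g := fun a => enc (f a))
    ⟨.left, 1 + .X, fun a => ⟨_, by simp, .left _⟩⟩ ?_).of_enc _ (fun a => a) (fun _ => rfl) ?_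
  · exact hf.of_enc _ (fun a => a) (fun _ => rfl) fun _ => rfl
  · intro a
    have key : ∀ (l : List β) (hl : l ≠ []), enc (l.head hl) = (enc l).left := by
      intro l hl
      cases l with
      | nil => exact absurd rfl hl
      | cons b l => rfl
    exact key _ _

theorem PT.headD {f : α → List β} {d : α → β} (hf : PT f) (hd : PT d) :
    PT (fun a => (f a).headD (d a)) := by
  have h1 : PT (fun a => Data.left (enc (f a))) :=
    PT.comp (f := Data.left) (g := fun a => enc (f a))
      ⟨.left, 1 + .X, fun a => ⟨_, by simp, .left _⟩⟩
      (hf.of_enc _ (fun a => a) (fun _ => rfl) fun _ => rfl)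
  have h2 : PT (fun a => enc (d a)) := hd.of_enc _ (fun a => a) (fun _ => rfl) fun _ => rfl
  refine (PT.ite hf.isEmpty h2 h1).of_enc _ (fun a => a) (fun _ => rfl) fun a => ?_
  cases f a <;> rfl

/-! #### Folds -/

/-- The left component of the state is the remaining list, whose code is `nil` exactly when it is
empty; hence the test `.left`. A round costs at most `2 + 2 * B + P.eval B`. In `hB` the list is not
shortened, which only overestimates the states. -/
theorem Run.loop_foldl {s : α → γ → β → γ} {p : Prog} {P : Polynomial ℕ}
    (hp : ∀ (b : β) (l : List β) (a : α) (c : γ), ∃ t, t ≤ P.eval (sz (b :: l, a, c)) ∧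
      Run p (enc (b :: l, a, c)) (enc (l, a, s a c b)) t) (a : α) (B : ℕ) (l : List β) (c : γ)
    (hB : ∀ l', l' <+: l → sz (l, a, l'.foldl (s a) c) ≤ B) :
    ∃ t, t ≤ (l.length + 1) * (2 + 2 * B + P.eval B) ∧
      Run (.loop .left p) (enc (l, a, c)) (enc (([] : List β), a, l.foldl (s a) c)) t := by
  induction l generalizing c with
  | nil =>
    refine ⟨_, ?_, Run.loop_stop (.left _)⟩
    have := hB [] List.prefix_rfl
    simp only [List.foldl_nil, sz] at this
    simp only [List.length_nil]
    omega
  | cons b l ih =>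
    obtain ⟨t, ht, hr⟩ := hp b l a c
    obtain ⟨u, hu, hru⟩ := ih (s a c b) fun l' hl' => by
      have h1 := hB (b :: l') (by simpa using hl')
      simp only [sz_pair, List.foldl_cons, sz_cons] at h1 ⊢
      omega
    refine ⟨_, ?_, .loop_step (.left _) hr hru⟩
    have h0 := hB [] (List.nil_prefix)
    rw [List.foldl_nil] at h0
    have h2 := eval_mono P h0
    unfold sz at h0
    rw [List.length_cons, Nat.add_mul (l.length + 1) 1]
    omega

/-- A polynomial-time step may double its accumulator and so reach exponential size when iterated;
hence the separate bound `hb` on the accumulators after all prefixes. -/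
theorem PT.foldl {l : α → List β} {i : α → γ} {s : α → γ → β → γ} (hl : PT l) (hi : PT i)
    (hs : PT (fun p : α × γ × β => s p.1 p.2.1 p.2.2))
    (hb : ∃ Q : Polynomial ℕ, ∀ a l', l' <+: l a →
      sz (l'.foldl (s a) (i a)) ≤ Q.eval (sz a)) :
    PT (fun a => (l a).foldl (s a) (i a)) := by
  -- The loop runs its body only while the list is nonempty, so the body is specified on that
  -- subtype and `head` needs no default.
  have hbody : PT (fun p : {p : List β × α × γ // p.1 ≠ []} =>
      (p.1.1.tail, p.1.2.1, s p.1.2.1 p.1.2.2 (p.1.1.head p.2))) := by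
    have hv : PT (fun p : {p : List β × α × γ // p.1 ≠ []} => p.1) :=
      PT.id.of_enc _ (fun p => p.1) (fun _ => rfl) fun _ => rfl
    refine hv.fst.tail.pair (hv.snd.fst.pair ?_)
    exact hs.comp (hv.snd.fst.pair (hv.snd.snd.pair (PT.head hv.fst fun p => p.2)))
  obtain ⟨p, P, hp⟩ := hbody
  obtain ⟨Q, hQ⟩ := hb
  obtain ⟨L, hL⟩ := hl.sz_le
  have hloop : PT (fun a : α => (([] : List β), a, (l a).foldl (s a) (i a))) := by
    have hini : PT (fun a => (l a, a, i a)) := hl.pair (PT.id.pair hi)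
    obtain ⟨q, R, hq⟩ := hini
    refine ⟨.seq q (.loop .left p), 1 + .X + R + (L + 1) * (2 + 2 * (L + .X + Q + 2) +
      P.comp (L + .X + Q + 2)), fun a => ?_⟩
    obtain ⟨t, ht, hr⟩ := hq a
    obtain ⟨u, hu, hru⟩ := Run.loop_foldl (s := s) (p := p) (P := P)
      (fun b l a c => hp ⟨(b :: l, a, c), by simp⟩) a
      ((L + .X + Q + 2).eval (sz a)) (l a) (i a) (fun l' hl' => by
        have h1 := hQ a l' hl'
        have h2 := hL a
        simp only [sz_pair, Polynomial.eval_add, Polynomial.eval_X, Polynomial.eval_ofNat]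
        omega)
    refine ⟨_, ?_, .seq hr hru⟩
    have h3 : (l a).length ≤ L.eval (sz a) := (length_le_sz _).trans (hL a)
    have h4 := Nat.mul_le_mul_right (2 + 2 * (L + .X + Q + 2).eval (sz a) +
      P.eval ((L + .X + Q + 2).eval (sz a))) (Nat.add_le_add_right h3 1)
    simp only [Polynomial.eval_add, Polynomial.eval_one, Polynomial.eval_X, Polynomial.eval_comp,
      Polynomial.eval_mul, Polynomial.eval_ofNat] at h4 hu ⊢
    unfold sz at *
    omega
  exact hloop.snd.snd

/-- Growth by a bounded summand per step, instead of by a factor, is harmless: in total it is at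
most the length of the list times the bound. -/
theorem PT.foldl_of_add {l : α → List β} {i : α → γ} {s : α → γ → β → γ} (hl : PT l) (hi : PT i)
    (hs : PT (fun p : α × γ × β => s p.1 p.2.1 p.2.2))
    (hb : ∃ Q : Polynomial ℕ, ∀ a c, ∀ b ∈ l a, sz (s a c b) ≤ sz c + Q.eval (sz a)) :
    PT (fun a => (l a).foldl (s a) (i a)) := by
  obtain ⟨Q, hQ⟩ := hb
  obtain ⟨L, hL⟩ := hl.sz_le
  obtain ⟨I, hI⟩ := hi.sz_le
  refine PT.foldl hl hi hs ⟨I + L * Q, fun a l' hl' => ?_⟩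
  have h1 : ∀ (l' : List β) (c : γ), (∀ b ∈ l', b ∈ l a) →
      sz (l'.foldl (s a) c) ≤ sz c + l'.length * Q.eval (sz a) := by
    intro l'
    induction l' with
    | nil => intro c _; simp
    | cons b l' ih =>
      intro c h
      have h2 := ih (s a c b) fun b' hb' => h b' (List.mem_cons_of_mem _ hb')
      have h3 := hQ a c b (h b List.mem_cons_self)
      rw [List.foldl_cons, List.length_cons, Nat.succ_mul]
      omega
  refine (h1 l' (i a) fun b hb => hl'.subset hb).trans ?_
  have h4 : l'.length ≤ L.eval (sz a) :=
    hl'.length_le.trans ((length_le_sz _).trans (hL a))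
  have h5 := Nat.mul_le_mul_right (Q.eval (sz a)) h4
  have h6 := hI a
  simp only [Polynomial.eval_add, Polynomial.eval_mul]
  omega

theorem PT.exists_bound {l : α → List β} (hl : PT l) {f : α → β → γ}
    (hf : PT (fun p : α × β => f p.1 p.2)) :
    ∃ Q : Polynomial ℕ, ∀ a, ∀ b ∈ l a, sz (f a b) ≤ Q.eval (sz a) := by
  obtain ⟨L, hL⟩ := hl.sz_le
  obtain ⟨F, hF⟩ := hf.sz_le
  refine ⟨F.comp (.X + L + 1), fun a b hb => (hF (a, b)).trans ?_⟩
  rw [Polynomial.eval_comp]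
  refine eval_mono F ?_
  have h1 := (sz_le_of_mem hb).trans (hL a)
  simp only [sz_pair, Polynomial.eval_add, Polynomial.eval_X, Polynomial.eval_one]
  omega

theorem PT.reverse {l : α → List β} (hl : PT l) : PT (fun a => (l a).reverse) := by
  refine (PT.foldl_of_add (s := fun _ c b => b :: c) hl (PT.const []) ?_ ?_).congr
    (g := fun a => (l a).reverse) fun a => ?_
  · exact PT.cons PT.id.snd.snd PT.id.snd.fst
  · obtain ⟨Q, hQ⟩ := hl.exists_bound (f := fun _ b => b) PT.id.snd
    refine ⟨Q + 1, fun a c b hb => ?_⟩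
    have := hQ a b hb
    simp only [sz_cons, Polynomial.eval_add, Polynomial.eval_one]
    omega
  · simp

theorem PT.append {l l' : α → List β} (hl : PT l) (hl' : PT l') :
    PT (fun a => l a ++ l' a) := by
  refine (PT.foldl_of_add (s := fun _ c b => b :: c) hl.reverse hl' ?_ ?_).congr
    (g := fun a => l a ++ l' a) fun a => ?_
  · exact PT.cons PT.id.snd.snd PT.id.snd.fst
  · obtain ⟨Q, hQ⟩ := hl.reverse.exists_bound (f := fun _ b => b) PT.id.snd
    refine ⟨Q + 1, fun a c b hb => ?_⟩
    have := hQ a b hb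
    simp only [sz_cons, Polynomial.eval_add, Polynomial.eval_one]
    omega
  · simp

theorem PT.flatMap {l : α → List β} {f : α → β → List γ} (hl : PT l)
    (hf : PT (fun p : α × β => f p.1 p.2)) : PT (fun a => (l a).flatMap (f a)) := by
  refine (PT.foldl_of_add (s := fun a c b => c ++ f a b) hl (PT.const []) ?_ ?_).congr
    (g := fun a => (l a).flatMap (f a)) fun a => ?_
  · exact PT.append PT.id.snd.fst (hf.comp (PT.id.fst.pair PT.id.snd.snd))
  · obtain ⟨Q, hQ⟩ := hl.exists_bound hf
    refine ⟨Q, fun a c b hb => ?_⟩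
    have := hQ a b hb
    have := sz_append c (f a b)
    omega
  · have : ∀ (l : List β) (c : List γ),
        l.foldl (fun c b => c ++ f a b) c = c ++ l.flatMap (f a) := by
      intro l
      induction l with
      | nil => simp
      | cons b l ih => intro c; simp [ih]
    simp [this]

theorem PT.map {l : α → List β} {f : α → β → γ} (hl : PT l)
    (hf : PT (fun p : α × β => f p.1 p.2)) : PT (fun a => (l a).map (f a)) :=
  (PT.flatMap (f := fun a b => [f a b]) hl (PT.cons hf (PT.const []))).congr fun a => by
    induction l a with
    | nil => rfl
    | cons b l ih => simp [List.flatMap_cons, ← ih]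

theorem PT.filter {l : α → List β} {f : α → β → Bool} (hl : PT l)
    (hf : PT (fun p : α × β => f p.1 p.2)) : PT (fun a => (l a).filter (f a)) :=
  (PT.flatMap (f := fun a b => if f a b = true then [b] else []) hl
    (PT.ite hf (PT.cons PT.id.snd (PT.const [])) (PT.const []))).congr fun a => by
    induction l a with
    | nil => rfl
    | cons b l ih => cases h : f a b <;> simp [List.flatMap_cons, ih, h]

theorem PT.any {l : α → List β} {f : α → β → Bool} (hl : PT l)
    (hf : PT (fun p : α × β => f p.1 p.2)) : PT (fun a => (l a).any (f a)) :=
  (hl.filter hf).isEmpty.not.congr fun a => by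
    induction l a with
    | nil => rfl
    | cons b l ih => cases h : f a b <;> simp_all

theorem PT.all {l : α → List β} {f : α → β → Bool} (hl : PT l)
    (hf : PT (fun p : α × β => f p.1 p.2)) : PT (fun a => (l a).all (f a)) :=
  (hl.any (f := fun a b => !f a b) hf.not).not.congr fun a => by
    induction l a with
    | nil => rfl
    | cons b l ih => cases h : f a b <;> simp_all

theorem PT.product {l : α → List β} {l' : α → List γ} (hl : PT l) (hl' : PT l') :
    PT (fun a => l a ×ˢ l' a) :=
  (PT.flatMap (f := fun a b => (l' a).map (fun c => (b, c))) hl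
    (PT.map (f := fun (p : α × β) c => (p.2, c)) (hl'.comp PT.id.fst)
      (PT.id.fst.snd.pair PT.id.snd))).congr fun _ => rfl

/-! #### Unary arithmetic -/

theorem sz_nat (n : ℕ) : sz n = 2 * n + 1 := by
  induction n with
  | zero => rfl
  | succ n ih =>
    change 1 + sz n + 1 = _
    omega

theorem PT.succ {n : α → ℕ} (hn : PT n) : PT (fun a => n a + 1) :=
  ((PT.const ()).pair hn).of_enc _ (fun a => a) (fun _ => rfl) fun _ => rfl

theorem PT.pred {n : α → ℕ} (hn : PT n) : PT (fun a => n a - 1) :=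
  PT.comp (f := fun n => n - 1) ⟨.right, 1 + .X, fun a => ⟨1 + (enc a).size, by simp, by
    cases a <;> exact .right _⟩⟩ hn

theorem PT.length {l : α → List β} (hl : PT l) : PT (fun a => (l a).length) := by
  refine (PT.map (f := fun _ _ => ()) hl (PT.const ())).of_enc _ (fun a => a) (fun _ => rfl) ?_
  intro a
  change encodeList _ _ = encodeList _ _
  rw [List.map_const']
  rfl

theorem PT.replicate {n : α → ℕ} (hn : PT n) : PT (fun a => List.replicate (n a) ()) :=
  hn.of_enc _ (fun a => a) (fun _ => rfl) fun _ => rfl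

theorem PT.iterate {n : α → ℕ} {i : α → γ} {s : α → γ → γ} (hn : PT n) (hi : PT i)
    (hs : PT (fun p : α × γ => s p.1 p.2))
    (hb : ∃ Q : Polynomial ℕ, ∀ a m, m ≤ n a → sz ((s a)^[m] (i a)) ≤ Q.eval (sz a)) :
    PT (fun a => (s a)^[n a] (i a)) := by
  have key : ∀ (a : α) (m : ℕ) (c : γ),
      (List.replicate m ()).foldl (fun c _ => s a c) c = (s a)^[m] c := by
    intro a m
    induction m with
    | zero => intro c; rfl
    | succ m ih =>
      intro c
      rw [List.replicate_succ, List.foldl_cons, ih, Function.iterate_succ_apply]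
  refine (PT.foldl (s := fun a c (_ : Unit) => s a c) hn.replicate hi ?_ ?_).congr fun a =>
    (key a _ _).symm
  · exact hs.comp (PT.id.fst.pair PT.id.snd.fst)
  · obtain ⟨Q, hQ⟩ := hb
    refine ⟨Q, fun a l' hl' => ?_⟩
    obtain ⟨h1, h2⟩ := List.prefix_replicate_iff.1 hl'
    rw [h2, key]
    exact hQ a _ h1

theorem PT.add {m n : α → ℕ} (hm : PT m) (hn : PT n) : PT (fun a => m a + n a) := by
  have h3 : ∀ j c : ℕ, (fun c => c + 1)^[j] c = c + j := by
    intro j c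
    induction j with
    | zero => rfl
    | succ j ih => rw [Function.iterate_succ_apply', ih]; rfl
  refine (PT.iterate (s := fun _ c => c + 1) hn hm PT.id.snd.succ ?_).congr fun a =>
    (h3 _ _).symm
  obtain ⟨M, hM⟩ := hm.sz_le
  obtain ⟨N, hN⟩ := hn.sz_le
  refine ⟨M + N, fun a j hj => ?_⟩
  have h1 := hM a
  have h2 := hN a
  simp only [h3, sz_nat, Polynomial.eval_add] at *
  omega

theorem PT.sub {m n : α → ℕ} (hm : PT m) (hn : PT n) : PT (fun a => m a - n a) := by
  have h3 : ∀ j c : ℕ, (fun c => c - 1)^[j] c = c - j := by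
    intro j c
    induction j with
    | zero => rfl
    | succ j ih => rw [Function.iterate_succ_apply', ih]; rfl
  refine (PT.iterate (s := fun _ c => c - 1) hn hm PT.id.snd.pred ?_).congr fun a => by
    rw [h3]
  obtain ⟨M, hM⟩ := hm.sz_le
  refine ⟨M, fun a j hj => ?_⟩
  have h1 := hM a
  simp only [h3, sz_nat] at *
  omega

theorem PT.mul {m n : α → ℕ} (hm : PT m) (hn : PT n) : PT (fun a => m a * n a) := by
  have := (hm.replicate.product hn.replicate).length
  refine this.congr fun a => ?_
  simp [List.length_product]

theorem PT.ble {m n : α → ℕ} (hm : PT m) (hn : PT n) : PT (fun a => decide (m a ≤ n a)) := by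
  refine (PT.ite_of_enc (b := fun a => !decide (m a ≤ n a)) (fun a => ?_) (hm.sub hn)
    (PT.const false) (PT.const true)).congr fun a => ?_
  · rcases h : m a - n a with _ | j
    · simp [enc, encodeList]; omega
    · simp [enc, encodeList, List.replicate_succ]; omega
  · by_cases h : m a ≤ n a <;> simp [h]

theorem PT.beq {m n : α → ℕ} (hm : PT m) (hn : PT n) : PT (fun a => m a == n a) :=
  ((hm.ble hn).and (hn.ble hm)).congr fun a => by
    rw [Bool.eq_iff_iff]; simp; omega

theorem PT.min {m n : α → ℕ} (hm : PT m) (hn : PT n) : PT (fun a => Min.min (m a) (n a)) :=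
  (hm.sub (hm.sub hn)).congr fun a => by omega

theorem PT.range {n : α → ℕ} (hn : PT n) : PT (fun a => List.range (n a)) := by
  have h3 : ∀ j : ℕ, (fun l : List ℕ => l ++ [l.length])^[j] [] = List.range j := by
    intro j
    induction j with
    | zero => rfl
    | succ j ih => rw [Function.iterate_succ_apply', ih, List.range_succ]; simp
  refine (PT.iterate (s := fun _ l => l ++ [l.length]) hn (PT.const [])
    (PT.append PT.id.snd (PT.cons PT.id.snd.length (PT.const []))) ?_).congr fun a => by
    rw [h3]
  obtain ⟨N, hN⟩ := hn.sz_le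
  -- The entries are unary, so the list has quadratic size.
  have h4 : ∀ j, sz (List.range j) ≤ (2 * j + 1) * (2 * j + 1) := by
    intro j
    induction j with
    | zero => simp [sz_nil]
    | succ j ih =>
      have := sz_append (List.range j) [j]
      rw [sz_cons, sz_nil, sz_nat] at this
      rw [List.range_succ]
      nlinarith
  refine ⟨N * N, fun a j hj => ?_⟩
  have h1 := hN a
  rw [sz_nat] at h1
  rw [h3, Polynomial.eval_mul]
  exact (h4 j).trans (Nat.mul_le_mul (by omega) (by omega))

theorem PT.drop {n : α → ℕ} {l : α → List β} (hn : PT n) (hl : PT l) :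
    PT (fun a => (l a).drop (n a)) := by
  have h3 : ∀ (j : ℕ) (l : List β), List.tail^[j] l = l.drop j := by
    intro j l
    induction j with
    | zero => rfl
    | succ j ih => rw [Function.iterate_succ_apply', ih, List.tail_drop]
  refine (PT.iterate (s := fun _ l => l.tail) hn hl PT.id.snd.tail ?_).congr fun a =>
    (h3 _ _).symm
  obtain ⟨M, hM⟩ := hl.sz_le
  refine ⟨M, fun a j hj => ?_⟩
  exact le_trans (by rw [h3]; exact sz_le_of_sublist (List.drop_sublist _ _)) (hM a)

end LeafKernel

namespace LeafKernel

/-! ### Leaf sets and reduction rules -/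

section Reach

variable {V : Type} {A A' : V → V → Prop} {L L' : Set V} {r v : V}

/-- `v` can be reached from `r` along a walk none of whose vertices, except possibly the last one,
lies in `L`. -/
def Reach (A : V → V → Prop) (L : Set V) (r v : V) : Prop :=
  Relation.ReflTransGen (fun a b => a ∉ L ∧ A a b) r v

theorem Reach.refl : Reach A L r r := Relation.ReflTransGen.refl

theorem Reach.tail {u : V} (h : Reach A L r u) (hu : u ∉ L) (huv : A u v) : Reach A L r v :=
  Relation.ReflTransGen.tail h ⟨hu, huv⟩

/-- A property that holds at the root and propagates along the walks holds at all reached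
vertices. -/
theorem Reach.induct (P : V → Prop) (h : Reach A L r v) (h0 : P r)
    (hs : ∀ a b, Reach A L r a → P a → a ∉ L → A a b → P b) : P v := by
  induction h with
  | refl => exact h0
  | tail h1 h2 ih => exact hs _ _ h1 ih h2.1 h2.2

theorem Reach.mono (h : Reach A L r v) (hL : L' ⊆ L) (hA : ∀ a b, A a b → A' a b) :
    Reach A' L' r v :=
  h.induct (Reach A' L' r) .refl fun _ _ _ ha haL hab =>
    ha.tail (fun h' => haL (hL h')) (hA _ _ hab)

/-- There is an out-tree with root `r` and at least `k` leaves: a set `L` of reachable vertices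
can be avoided in reaching all reachable vertices. -/
def HasLeaves (A : V → V → Prop) (r : V) (k : ℕ) : Prop :=
  ∃ L : Finset V, k ≤ L.card ∧ (∀ v ∈ L, Reach A ∅ r v) ∧ ∀ v, Reach A ∅ r v → Reach A ↑L r v

/-- Delete the arc `(y, x)`. -/
def delArc (A : V → V → Prop) (y x u w : V) : Prop := A u w ∧ ¬(u = y ∧ w = x)

/-- An `L`-avoiding walk through the arc visits `y` first. By `h` it has met another in-neighbour of
`x` before, from which `x` can be entered directly; so the arc is dispensable for every `L` at once.
-/
theorem reach_delArc_iff {y x : V} (h : ¬ Reach A {z | A z x ∧ z ≠ y} r y) :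
    Reach (delArc A y x) L r v ↔ Reach A L r v := by
  refine ⟨fun h' => h'.mono subset_rfl fun _ _ h => h.1, fun h' => ?_⟩
  refine h'.induct (Reach (delArc A y x) L r) .refl fun a b _ ha haL hab => ?_
  by_cases hyx : a = y ∧ b = x
  · obtain ⟨rfl, rfl⟩ := hyx
    by_contra hb
    refine h (ha.induct (Reach A {z | A z b ∧ z ≠ a} r) .refl fun c d hc hc' hcL hcd => ?_)
    refine hc'.tail (fun hz => hb ?_) hcd.1
    exact hc.tail hcL ⟨hz.1, fun h => hz.2 h.1⟩
  · exact ha.tail haL ⟨hab, hyx⟩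

theorem hasLeaves_delArc_iff {y x : V} {k : ℕ} (h : ¬ Reach A {z | A z x ∧ z ≠ y} r y) :
    HasLeaves (delArc A y x) r k ↔ HasLeaves A r k := by
  simp only [HasLeaves, reach_delArc_iff h]

/-- Delete the vertex `x` and join its in-neighbours to its out-neighbours. -/
def bypass (A : V → V → Prop) (x u w : V) : Prop :=
  u ≠ x ∧ w ≠ x ∧ u ≠ w ∧ (A u w ∨ A u x ∧ A x w)

/-- Passages through `x` are short-circuited. The induction therefore remembers, once `x` is
reached, a predecessor outside `L` from which it was entered. -/
theorem Reach.bypass {x : V} (h : Reach A L r v) (hr : r ≠ x) (hv : v ≠ x) :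
    Reach (bypass A x) L r v := by
  refine (h.induct (fun v => (v ≠ x → Reach (LeafKernel.bypass A x) L r v) ∧
    (v = x → ∃ u, u ≠ x ∧ u ∉ L ∧ A u x ∧ Reach (LeafKernel.bypass A x) L r u))
    ⟨fun _ => .refl, fun h => absurd h hr⟩ fun a b _ ha haL hab => ?_).1 hv
  by_cases hax : a = x
  · obtain ⟨u, hux, huL, hA, hu⟩ := ha.2 hax
    refine ⟨fun hb => ?_, fun _ => ⟨u, hux, huL, hA, hu⟩⟩
    by_cases hub : u = b
    · exact hub ▸ hu
    · exact hu.tail huL ⟨hux, hb, hub, .inr ⟨hA, hax ▸ hab⟩⟩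
  · refine ⟨fun hb => ?_, fun hb => ⟨a, hax, haL, hb ▸ hab, ha.1 hax⟩⟩
    by_cases hub : a = b
    · exact hub ▸ ha.1 hax
    · exact (ha.1 hax).tail haL ⟨hax, hb, hub, .inl hab⟩

theorem Reach.of_bypass {x : V} (h : Reach (LeafKernel.bypass A x) L r v) (hx : x ∉ L) :
    Reach A L r v := by
  refine h.induct (Reach A L r) .refl fun a b _ ha haL hab => ?_
  rcases hab.2.2.2 with h | h
  · exact ha.tail haL h
  · exact (ha.tail haL h.1).tail hx h.2

theorem Reach.ne_of_bypass {x : V} (h : Reach (LeafKernel.bypass A x) L r v) (hr : r ≠ x) :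
    v ≠ x :=
  h.induct (· ≠ x) hr fun _ _ _ _ _ hab => hab.2.1

theorem reach_bypass_empty_iff {x : V} (hr : r ≠ x) :
    Reach (LeafKernel.bypass A x) ∅ r v ↔ Reach A ∅ r v ∧ v ≠ x :=
  ⟨fun h => ⟨h.of_bypass (by simp), h.ne_of_bypass hr⟩, fun h => h.1.bypass hr h.2⟩

/-- Since `v₀` is reached only through `x`, a cut vertex is interior to every spanning tree and lies
in no leaf set. The same `L` works on both sides. -/
theorem hasLeaves_bypass_cutVertex_iff {x v₀ : V} {k : ℕ} (hr : r ≠ x) (hv₀ : v₀ ≠ x)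
    (hreach : Reach A ∅ r v₀) (hcut : ¬ Reach A {x} r v₀) :
    HasLeaves (LeafKernel.bypass A x) r k ↔ HasLeaves A r k := by
  constructor
  · rintro ⟨L, hk, hL, hgood⟩
    have hx : x ∉ L := fun h => (hL x h).ne_of_bypass hr rfl
    have h1 : ∀ v, Reach A ∅ r v → v ≠ x → Reach A ↑L r v := fun v hv hvx =>
      (hgood v ((reach_bypass_empty_iff hr).2 ⟨hv, hvx⟩)).of_bypass (by simpa using hx)
    refine ⟨L, hk, fun v hv => (hL v hv).of_bypass (by simp), fun v hv => ?_⟩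
    by_cases hvx : v = x
    · subst hvx
      by_contra hnot
      refine hcut ((h1 v₀ hreach hv₀).induct (Reach A {v} r) .refl fun a b ha ha' _ hab => ?_)
      exact ha'.tail (fun h => hnot (by rw [Set.mem_singleton_iff.1 h] at ha; exact ha)) hab
    · exact h1 v hv hvx
  · rintro ⟨L, hk, hL, hgood⟩
    have hx : x ∉ L := fun h => hcut ((hgood v₀ hreach).mono (by simpa using h) fun _ _ h => h)
    refine ⟨L, hk, fun v hv => (hL v hv).bypass hr fun h => hx (h ▸ hv), fun v hv => ?_⟩
    rw [reach_bypass_empty_iff hr] at hv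
    exact (hgood v hv.1).bypass hr hv.2

/-- Three consecutive vertices `x₁`, `x₂`, `x₃` of a bidirected path `a x₁ x₂ x₃ b` that have no
other neighbours. -/
structure IsBipath (A : V → V → Prop) (a x₁ x₂ x₃ b : V) : Prop where
  in₁ : ∀ w, A w x₁ ↔ w = a ∨ w = x₂
  out₁ : ∀ w, A x₁ w ↔ w = a ∨ w = x₂
  in₂ : ∀ w, A w x₂ ↔ w = x₁ ∨ w = x₃
  out₂ : ∀ w, A x₂ w ↔ w = x₁ ∨ w = x₃
  in₃ : ∀ w, A w x₃ ↔ w = b ∨ w = x₂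
  out₃ : ∀ w, A x₃ w ↔ w = b ∨ w = x₂
  ne₁₂ : x₁ ≠ x₂
  ne₁₃ : x₁ ≠ x₃
  ne₂₃ : x₂ ≠ x₃
  a₁ : a ≠ x₁
  a₂ : a ≠ x₂
  b₂ : b ≠ x₂
  b₃ : b ≠ x₃

theorem IsBipath.symm {a x₁ x₂ x₃ b : V} (h : IsBipath A a x₁ x₂ x₃ b) :
    IsBipath A b x₃ x₂ x₁ a :=
  ⟨h.in₃, h.out₃, fun w => (h.in₂ w).trans or_comm, fun w => (h.out₂ w).trans or_comm, h.in₁,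
    h.out₁, h.ne₂₃.symm, h.ne₁₃.symm, h.ne₁₂.symm, h.b₃, h.b₂, h.a₂, h.a₁⟩

/-- The leaf `x₂` is traded for `x₁`. Making `x₁` a leaf loses nothing: its only continuation
besides `x₂` is `a`, and as `x₂` is a leaf, `x₁` was entered from `a`, which is thus reached
already. -/
theorem IsBipath.hasLeaves_bypass [DecidableEq V] {a x₁ x₂ x₃ b : V}
    (h : IsBipath A a x₁ x₂ x₃ b) (hr : ∀ w, ¬ A w r) {k : ℕ} (L : Finset V) (hk : k ≤ L.card)
    (hL : ∀ v ∈ L, Reach A ∅ r v) (hgood : ∀ v, Reach A ∅ r v → Reach A ↑L r v) (h2 : x₂ ∈ L)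
    (h1 : x₁ ∉ L) : HasLeaves (LeafKernel.bypass A x₂) r k := by
  have hr1 : r ≠ x₁ := fun e => hr a (e ▸ (h.in₁ a).2 (.inl rfl))
  have hr2 : r ≠ x₂ := fun e => hr x₁ (e ▸ (h.in₂ x₁).2 (.inl rfl))
  refine ⟨insert x₁ (L.erase x₂), ?_, fun v hv => ?_, fun v hv => ?_⟩
  · rw [Finset.card_insert_of_notMem (by simp [h1]), Finset.card_erase_add_one h2]
    exact hk
  · rw [reach_bypass_empty_iff hr2]
    rcases Finset.mem_insert.1 hv with rfl | hv
    · exact ⟨(hL x₂ h2).tail (by simp) ((h.out₂ _).2 (.inl rfl)), h.ne₁₂⟩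
    · exact ⟨hL v (Finset.mem_of_mem_erase hv), Finset.ne_of_mem_erase hv⟩
  · rw [reach_bypass_empty_iff hr2] at hv
    set L' : Set V := ↑(insert x₁ (L.erase x₂)) with hL'
    refine ((hgood v hv.1).induct (fun v => (v ≠ x₂ → Reach (LeafKernel.bypass A x₂) L' r v) ∧
      (v = x₁ → Reach (LeafKernel.bypass A x₂) L' r a))
      ⟨fun _ => .refl, fun e => absurd e hr1⟩ fun p q _ hp hpL hpq => ?_).1 hv.2
    have hp2 : p ≠ x₂ := fun e => hpL (e ▸ h2)
    by_cases hp1 : p = x₁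
    · have hq := (h.out₁ q).1 (hp1 ▸ hpq)
      refine ⟨fun hq2 => ?_, fun hq1 => ?_⟩
      · rw [hq.resolve_right hq2]
        exact hp.2 hp1
      · rcases hq with e | e
        · exact absurd (e.symm.trans hq1) h.a₁
        · exact absurd (hq1.symm.trans e) h.ne₁₂
    · refine ⟨fun hq2 => ?_, fun hq1 => ?_⟩
      · by_cases hpq' : p = q
        · exact hpq' ▸ hp.1 hp2
        · refine (hp.1 hp2).tail ?_ ⟨hp2, hq2, hpq', .inl hpq⟩
          simp only [hL', Finset.coe_insert, Finset.coe_erase, Set.mem_insert_iff, hp1,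
            Set.mem_sdiff, false_or, not_and]
          exact fun h => absurd h hpL
      · have := ((h.in₁ p).1 (hq1 ▸ hpq)).resolve_right hp2
        exact this ▸ hp.1 hp2

theorem IsBipath.hasLeaves_bypass_iff {a x₁ x₂ x₃ b : V} (h : IsBipath A a x₁ x₂ x₃ b)
    (hr : ∀ w, ¬ A w r) {k : ℕ} : HasLeaves (LeafKernel.bypass A x₂) r k ↔ HasLeaves A r k := by
  classical
  have hr2 : r ≠ x₂ := fun e => hr x₁ (e ▸ (h.in₂ x₁).2 (.inl rfl))
  constructor
  · rintro ⟨L, hk, hL, hgood⟩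
    have hx2 : x₂ ∉ L := fun h => (hL _ h).ne_of_bypass hr2 rfl
    -- If both are leaves, the new arcs between them are never used and `x₁` is traded for `x₂`.
    -- Otherwise the one that is not a leaf still leads to `x₂`, and `L` is kept.
    by_cases hboth : x₁ ∈ L ∧ x₃ ∈ L
    · have key : ∀ v, Reach (LeafKernel.bypass A x₂) ↑L r v →
          Reach A ↑(insert x₂ (L.erase x₁)) r v := by
        refine fun v hv => hv.induct (Reach A _ r) .refl fun p q _ hp hpL hpq => ?_
        refine hp.tail ?_ (hpq.2.2.2.resolve_right fun hh => ?_)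
        · have := hpq.1
          simp only [Finset.coe_insert, Finset.coe_erase, Set.mem_insert_iff, this,
            Set.mem_sdiff, false_or, not_and]
          exact fun h => absurd h hpL
        · rcases (h.in₂ p).1 hh.1 with rfl | rfl
          · exact hpL hboth.1
          · exact hpL hboth.2
      have hx1 := (hL x₁ hboth.1)
      refine ⟨insert x₂ (L.erase x₁), ?_, fun v hv => ?_, fun v hv => ?_⟩
      · rw [Finset.card_insert_of_notMem (by simp [hx2]), Finset.card_erase_add_one hboth.1]
        exact hk
      · rcases Finset.mem_insert.1 hv with rfl | hv
        · exact (hx1.of_bypass (by simp)).tail (by simp) ((h.out₁ _).2 (.inr rfl))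
        · exact (hL v (Finset.mem_of_mem_erase hv)).of_bypass (by simp)
      · by_cases hv2 : v = x₂
        · rw [hv2]
          refine (key x₁ (hgood x₁ hx1)).tail ?_ ((h.out₁ _).2 (.inr rfl))
          simp [h.ne₁₂]
        · exact key v (hgood v ((reach_bypass_empty_iff hr2).2 ⟨hv, hv2⟩))
    · have h1 : ∀ v, Reach A ∅ r v → v ≠ x₂ → Reach A ↑L r v := fun v hv hvx =>
        (hgood v ((reach_bypass_empty_iff hr2).2 ⟨hv, hvx⟩)).of_bypass (by simpa using hx2)
      refine ⟨L, hk, fun v hv => (hL v hv).of_bypass (by simp), fun v hv => ?_⟩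
      by_cases hvx : v = x₂
      · rw [hvx] at hv ⊢
        by_cases hx1 : x₁ ∈ L
        · refine (h1 x₃ ?_ h.ne₂₃.symm).tail (fun h3 => hboth ⟨hx1, h3⟩)
            ((h.in₂ _).2 (.inr rfl))
          exact hv.tail (by simp) ((h.out₂ _).2 (.inr rfl))
        · refine (h1 x₁ ?_ h.ne₁₂).tail hx1 ((h.in₂ _).2 (.inl rfl))
          exact hv.tail (by simp) ((h.out₂ _).2 (.inl rfl))
      · exact h1 v hv hvx
  · rintro ⟨L, hk, hL, hgood⟩
    by_cases h2 : x₂ ∈ L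
    · by_cases h1 : x₁ ∈ L
      · have h3 : x₃ ∉ L := by
          intro h3
          refine (hgood x₂ (hL x₂ h2)).induct (· ≠ x₂) hr2 (fun p q _ _ hpL hpq e => ?_) rfl
          rcases (h.in₂ p).1 (e ▸ hpq) with rfl | rfl
          · exact hpL h1
          · exact hpL h3
        exact h.symm.hasLeaves_bypass hr L hk hL hgood h2 h3
      · exact h.hasLeaves_bypass hr L hk hL hgood h2 h1
    · refine ⟨L, hk, fun v hv => (hL v hv).bypass hr2 fun e => h2 (e ▸ hv), fun v hv => ?_⟩
      rw [reach_bypass_empty_iff hr2] at hv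
      exact (hgood v hv.1).bypass hr2 hv.2

end Reach

end LeafKernel

namespace LeafKernel

/-! ### Numberings -/

section Numbering

variable {V : Type} [DecidableEq V]

/-- Every set of vertices that contains neither `s` nor `t` has at least two in-neighbours. -/
def TwoConnected (S : Finset V) (A : V → V → Prop) (s t : V) : Prop :=
  ∀ Y ⊆ S, Y.Nonempty → s ∉ Y → t ∉ Y → ∀ x, ∃ u ∈ S, u ∉ Y ∧ u ≠ x ∧ ∃ v ∈ Y, A u v

/-- An injective numbering in which `s` comes first, `t` comes last, and every other vertex has a
lower and a higher in-neighbour. -/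
structure IsNumbering (S : Finset V) (A : V → V → Prop) (s t : V) (σ : V → ℤ) : Prop where
  inj : ∀ u ∈ S, ∀ v ∈ S, σ u = σ v → u = v
  first : ∀ v ∈ S, v ≠ s → σ s < σ v
  last : ∀ v ∈ S, v ≠ t → σ v < σ t
  low : ∀ v ∈ S, v ≠ s → v ≠ t → ∃ u ∈ S, A u v ∧ σ u < σ v
  high : ∀ v ∈ S, v ≠ s → v ≠ t → ∃ u ∈ S, A u v ∧ σ v < σ u

/-- Undoing the identification of `x` with `s`: `x` is placed directly after `s`, and doubling all
numbers makes room. A vertex that saw `s` only through `x` gets `x` as its lower in-neighbour. -/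
theorem IsNumbering.of_merge {S : Finset V} {A : V → V → Prop} {s t x : V} {σ : V → ℤ}
    (h : IsNumbering (S.erase x) (fun u v => A u v ∨ u = s ∧ A x v) s t σ) (hs : s ∈ S)
    (hxS : x ∈ S) (hxs : x ≠ s) (hxt : x ≠ t) (ht : t ∈ S) (hst : s ≠ t) (hsx : A s x)
    (hx : ∃ u ∈ S, u ≠ x ∧ u ≠ s ∧ A u x) :
    IsNumbering S A s t (fun v => if v = x then 2 * σ s + 1 else 2 * σ v) := by
  have hlt : σ s < σ t := h.first t (by simp [ht, hxt.symm]) hst.symm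
  refine ⟨fun u hu v hv huv => ?_, fun v hv hvs => ?_, fun v hv hvt => ?_, fun v hv hvs hvt => ?_,
    fun v hv hvs hvt => ?_⟩
  · by_cases hux : u = x <;> by_cases hvx : v = x
    · exact hux.trans hvx.symm
    · simp only [hux, hvx, if_true, if_false] at huv; omega
    · simp only [hux, hvx, if_true, if_false] at huv; omega
    · simp only [hux, hvx, if_false] at huv
      exact h.inj u (by simp [hu, hux]) v (by simp [hv, hvx]) (by omega)
  · by_cases hvx : v = x
    · simp [hvx, hxs.symm]
    · have := h.first v (by simp [hv, hvx]) hvs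
      simp only [hxs.symm, hvx, if_false]; omega
  · by_cases hvx : v = x
    · simp only [hvx, hxt.symm, if_true, if_false]; omega
    · have := h.last v (by simp [hv, hvx]) hvt
      simp only [hxt.symm, hvx, if_false]; omega
  · by_cases hvx : v = x
    · exact ⟨s, hs, hvx ▸ hsx, by simp [hvx, hxs.symm]⟩
    · have hv' : v ∈ S.erase x := by simp [hv, hvx]
      obtain ⟨u, hu, hA, hlt'⟩ := h.low v hv' hvs hvt
      have hux := Finset.ne_of_mem_erase hu
      rcases hA with hA | ⟨rfl, hA⟩
      · exact ⟨u, Finset.mem_of_mem_erase hu, hA, by simp only [hux, hvx, if_false]; omega⟩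
      · have := h.first v hv' hvs
        exact ⟨x, hxS, hA, by simp only [hvx, if_true, if_false]; omega⟩
  · by_cases hvx : v = x
    · obtain ⟨u, hu, hux, hus, hA⟩ := hx
      have := h.first u (by simp [hu, hux]) hus
      exact ⟨u, hu, hvx ▸ hA, by simp only [hux, hvx, if_true, if_false]; omega⟩
    · have hv' : v ∈ S.erase x := by simp [hv, hvx]
      obtain ⟨u, hu, hA, hlt'⟩ := h.high v hv' hvs hvt
      have hux := Finset.ne_of_mem_erase hu
      rcases hA with hA | ⟨rfl, hA⟩
      · exact ⟨u, Finset.mem_of_mem_erase hu, hA, by simp only [hux, hvx, if_false]; omega⟩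
      · have := h.first v hv' hvs
        omega

/-- Undoing the contraction of `U` into `x`: `U` goes directly below `x`, in the order of `σ₁`.
Scaling `σ₂` by the span `σ₁ x - σ₁ s` keeps `U` above everything below `x`, so a vertex of `U` can
stand in for `x` as a lower or a higher in-neighbour. -/
theorem IsNumbering.of_insert {S U : Finset V} {A : V → V → Prop} {s t x : V} {σ₁ σ₂ : V → ℤ}
    (h₁ : IsNumbering (insert s (insert x U)) A s x σ₁)
    (h₂ : IsNumbering (S \ U) (fun u v => A u v ∨ u = x ∧ ∃ w ∈ U, A w v) s t σ₂)
    (hs : s ∈ S) (hx : x ∈ S) (hU : U ⊆ S) (hsU : s ∉ U) (htU : t ∉ U) (hxU : x ∉ U)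
    (hxs : x ≠ s) (hxt : x ≠ t) :
    IsNumbering S A s t
      (fun v => if v ∈ U then (σ₁ x - σ₁ s) * σ₂ x + (σ₁ v - σ₁ x) else (σ₁ x - σ₁ s) * σ₂ v) := by
  have hpos : 0 < σ₁ x - σ₁ s := by
    have := h₁.first x (by simp) hxs
    omega
  have hU1 : ∀ v ∈ U, σ₁ s < σ₁ v ∧ σ₁ v < σ₁ x := fun v hv =>
    ⟨h₁.first v (by simp [hv]) fun e => hsU (e ▸ hv),
      h₁.last v (by simp [hv]) fun e => hxU (e ▸ hv)⟩
  generalize hM : σ₁ x - σ₁ s = M at *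
  have hmul : ∀ a b : ℤ, a < b → M * a + M ≤ M * b := fun a b hab => by
    have := mul_le_mul_of_nonneg_left (show a + 1 ≤ b by omega) hpos.le
    rwa [mul_add, mul_one] at this
  have mem2 : ∀ v ∈ S, v ∉ U → v ∈ S \ U := fun v h h' => by simp [h, h']
  have hsx : M * σ₂ s + M ≤ M * σ₂ x := hmul _ _ (h₂.first x (mem2 x hx hxU) hxs)
  have hxt' : M * σ₂ x + M ≤ M * σ₂ t := hmul _ _ (h₂.last x (mem2 x hx hxU) hxt)
  have hne : ∀ u ∈ U, ∀ v, M * σ₂ x + (σ₁ u - σ₁ x) ≠ M * σ₂ v := by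
    intro u hu v e
    have := hU1 u hu
    rcases lt_or_ge (σ₂ v) (σ₂ x) with h | h
    · have := hmul _ _ h; omega
    · have := mul_le_mul_of_nonneg_left h hpos.le; omega
  refine ⟨fun u hu v hv huv => ?_, fun v hv hvs => ?_, fun v hv hvt => ?_, fun v hv hvs hvt => ?_,
    fun v hv hvs hvt => ?_⟩
  · by_cases hux : u ∈ U <;> by_cases hvx : v ∈ U <;> simp only [hux, hvx, if_true, if_false] at huv
    · exact h₁.inj u (by simp [hux]) v (by simp [hvx]) (by omega)
    · exact absurd huv (hne u hux v)
    · exact absurd huv.symm (hne v hvx u)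
    · exact h₂.inj u (mem2 u hu hux) v (mem2 v hv hvx) (mul_left_cancel₀ hpos.ne' huv)
  · by_cases hvx : v ∈ U <;> simp only [hvx, hsU, if_true, if_false]
    · have := hU1 v hvx; omega
    · have := hmul _ _ (h₂.first v (mem2 v hv hvx) hvs); omega
  · by_cases hvx : v ∈ U <;> simp only [hvx, htU, if_true, if_false]
    · have := hU1 v hvx; omega
    · have := hmul _ _ (h₂.last v (mem2 v hv hvx) hvt); omega
  · by_cases hvx : v ∈ U
    · have hvU := hU1 v hvx
      obtain ⟨u, hu, hA, hlt⟩ := h₁.low v (by simp [hvx]) hvs fun e => hxU (e ▸ hvx)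
      rcases Finset.mem_insert.1 hu with rfl | hu
      · exact ⟨u, hs, hA, by simp only [hvx, hsU, if_true, if_false]; omega⟩
      rcases Finset.mem_insert.1 hu with rfl | hu
      · omega
      · exact ⟨u, hU hu, hA, by simp only [hvx, hu, if_true]; omega⟩
    · obtain ⟨u, hu, hA, hlt⟩ := h₂.low v (mem2 v hv hvx) hvs hvt
      have := hmul _ _ hlt
      have huU := (Finset.mem_sdiff.1 hu)
      rcases hA with hA | ⟨rfl, w, hw, hA⟩
      · exact ⟨u, huU.1, hA, by simp only [hvx, huU.2, if_false]; omega⟩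
      · have := hU1 w hw
        exact ⟨w, hU hw, hA, by simp only [hvx, hw, if_true, if_false]; omega⟩
  · by_cases hvx : v ∈ U
    · have hvU := hU1 v hvx
      obtain ⟨u, hu, hA, hlt⟩ := h₁.high v (by simp [hvx]) hvs fun e => hxU (e ▸ hvx)
      rcases Finset.mem_insert.1 hu with rfl | hu
      · omega
      rcases Finset.mem_insert.1 hu with rfl | hu
      · exact ⟨u, hx, hA, by simp only [hvx, hxU, if_true, if_false]; omega⟩
      · exact ⟨u, hU hu, hA, by simp only [hvx, hu, if_true]; omega⟩
    · obtain ⟨u, hu, hA, hlt⟩ := h₂.high v (mem2 v hv hvx) hvs hvt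
      have := hmul _ _ hlt
      have huU := (Finset.mem_sdiff.1 hu)
      rcases hA with hA | ⟨rfl, w, hw, hA⟩
      · exact ⟨u, huU.1, hA, by simp only [hvx, huU.2, if_false]; omega⟩
      · have := hU1 w hw
        exact ⟨w, hU hw, hA, by simp only [hvx, hw, if_true, if_false]; omega⟩

/-- After the identification only a set fed by `s` and `x` alone would be left with a single
in-neighbour, and `hU` rules out such sets. -/
theorem TwoConnected.merge {S : Finset V} {A : V → V → Prop} {s t x : V}
    (h : TwoConnected S A s t) (hs : s ∈ S) (hxs : x ≠ s)
    (hU : ∀ Y ⊆ S, Y.Nonempty → s ∉ Y → t ∉ Y → x ∉ Y →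
      ∃ u ∈ S, u ∉ Y ∧ u ≠ s ∧ u ≠ x ∧ ∃ v ∈ Y, A u v) :
    TwoConnected (S.erase x) (fun u v => A u v ∨ u = s ∧ A x v) s t := by
  intro Y hY hne hsY htY y
  have hxY : x ∉ Y := fun h => Finset.notMem_erase x S (hY h)
  have hYS : Y ⊆ S := hY.trans (Finset.erase_subset _ _)
  by_cases hy : y = s
  · obtain ⟨u, hu, huY, hus, hux, v, hv, hA⟩ := hU Y hYS hne hsY htY hxY
    exact ⟨u, by simp [hu, hux], huY, hy ▸ hus, v, hv, .inl hA⟩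
  · obtain ⟨u, hu, huY, huy, v, hv, hA⟩ := h Y hYS hne hsY htY y
    by_cases hux : u = x
    · exact ⟨s, by simp [hs, hxs.symm], hsY, fun e => hy e.symm, v, hv, .inr ⟨rfl, hux ▸ hA⟩⟩
    · exact ⟨u, by simp [hu, hux], huY, huy, v, hv, .inl hA⟩

/-- A set containing `x` is enlarged by `U`; an outside arc into `U` then comes from `s`, which
sends an arc to `x` as well. For a set `Y` without `x`, an in-neighbour in `U` is replaced by `x`,
and if `x` were the only in-neighbour left, `Y ∪ U` would contradict the maximality of `U`. -/
theorem TwoConnected.contract {S U : Finset V} {A : V → V → Prop} {s t x : V}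
    (h : TwoConnected S A s t) (hs : s ∈ S) (hx : x ∈ S) (hU : U ⊆ S)
    (hsU : s ∉ U) (htU : t ∉ U) (hxU : x ∉ U) (hsx : A s x)
    (hin : ∀ u ∈ S, u ∉ U → (∃ v ∈ U, A u v) → u = s ∨ u = x)
    (hmax : ∀ Y ⊆ S, s ∉ Y → t ∉ Y → x ∉ Y →
      (∀ u ∈ S, u ∉ Y → (∃ v ∈ Y, A u v) → u = s ∨ u = x) → Y.card ≤ U.card) :
    TwoConnected (S \ U) (fun u v => A u v ∨ u = x ∧ ∃ w ∈ U, A w v) s t := by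
  intro Y hY hne hsY htY y
  have hYS : Y ⊆ S := hY.trans Finset.sdiff_subset
  have hdisj : ∀ v ∈ Y, v ∉ U := fun v hv => (Finset.mem_sdiff.1 (hY hv)).2
  by_cases hxY : x ∈ Y
  · obtain ⟨u, hu, huY, huy, v, hv, hA⟩ := h (Y ∪ U) (Finset.union_subset hYS hU)
      (hne.mono Finset.subset_union_left) (by simp [hsY, hsU]) (by simp [htY, htU]) y
    simp only [Finset.mem_union, not_or] at huY hv
    refine ⟨u, by simp [hu, huY.2], huY.1, huy, ?_⟩
    rcases hv with hv | hv
    · exact ⟨v, hv, .inl hA⟩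
    · rcases hin u hu huY.2 ⟨v, hv, hA⟩ with rfl | rfl
      · exact ⟨x, hxY, .inl hsx⟩
      · exact absurd hxY huY.1
  · by_cases hyx : y = x
    · by_contra hcon
      push Not at hcon
      have := hmax (Y ∪ U) (Finset.union_subset hYS hU) (by simp [hsY, hsU]) (by simp [htY, htU])
        (by simp [hxY, hxU]) fun u hu huY hv => by
          obtain ⟨v, hv, hA⟩ := hv
          simp only [Finset.mem_union, not_or] at huY hv
          rcases hv with hv | hv
          · by_contra hux
            push Not at hux
            exact (hcon u (by simp [hu, huY.2]) huY.1 (hyx ▸ hux.2) v hv).1 hA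
          · exact hin u hu huY.2 ⟨v, hv, hA⟩
      rw [Finset.card_union_of_disjoint (Finset.disjoint_left.2 hdisj)] at this
      have := hne.card_pos
      omega
    · obtain ⟨u, hu, huY, huy, v, hv, hA⟩ := h Y hYS hne hsY htY y
      by_cases huU : u ∈ U
      · exact ⟨x, by simp [hx, hxU], hxY, fun e => hyx e.symm, v, hv, .inr ⟨rfl, u, huU, hA⟩⟩
      · exact ⟨u, by simp [hu, huU], huY, huy, v, hv, .inl hA⟩

/-- Induction on the number of vertices. Some `x` other than `s` and `t` has an arc from `s`. If a
nonempty set without `s`, `t`, `x` is entered only from `s` and `x`, a largest such `U` is numbered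
between `s` and `x` and is contracted into `x` in the rest; otherwise `x` is merged into `s`. -/
theorem TwoConnected.exists_numbering {S : Finset V} {A : V → V → Prop} {s t : V}
    (h : TwoConnected S A s t) (hs : s ∈ S) (ht : t ∈ S) (hst : s ≠ t) :
    ∃ σ, IsNumbering S A s t σ := by
  induction hn : S.card using Nat.strong_induction_on generalizing S A s t with
  | _ n ih =>
  by_cases hbig : (S \ {s, t}).Nonempty
  · obtain ⟨u, hu, huY, hut, x, hx, hsx⟩ := h (S \ {s, t}) Finset.sdiff_subset hbig (by simp)
      (by simp) t
    have hus : u = s := by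
      simp only [Finset.mem_sdiff, hu, Finset.mem_insert, Finset.mem_singleton, true_and,
        not_not] at huY
      exact huY.resolve_right hut
    subst hus
    simp only [Finset.mem_sdiff, Finset.mem_insert, Finset.mem_singleton, not_or] at hx
    obtain ⟨hxS, hxs, hxt⟩ := hx
    replace hxs : x ≠ u := hxs
    replace hxt : x ≠ t := hxt
    classical
    let F := S.powerset.filter fun Y => u ∉ Y ∧ t ∉ Y ∧ x ∉ Y ∧
      ∀ w ∈ S, w ∉ Y → (∃ v ∈ Y, A w v) → w = u ∨ w = x
    obtain ⟨U, hUF, hUmax⟩ := Finset.exists_max_image F Finset.card ⟨∅, by simp [F]⟩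
    simp only [F, Finset.mem_filter, Finset.mem_powerset] at hUF hUmax
    obtain ⟨hU, huU, htU, hxU, hin⟩ := hUF
    by_cases hUne : U.Nonempty
    · obtain ⟨σ₁, h₁⟩ := ih _ (by
          rw [← hn]
          refine Finset.card_lt_card ⟨?_, fun hh => ?_⟩
          · intro w hw
            simp only [Finset.mem_insert] at hw
            rcases hw with rfl | rfl | hw
            exacts [hu, hxS, hU hw]
          · have := hh ht
            simp only [Finset.mem_insert, htU, hut.symm, hxt.symm, or_self] at this)
        (S := insert u (insert x U)) (A := A) (s := u) (t := x) (by
          intro Y hY hne huY hxY y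
          have hYU : Y ⊆ U := fun v hv => by
            have := hY hv
            simp only [Finset.mem_insert] at this
            rcases this with rfl | rfl | h
            exacts [absurd hv huY, absurd hv hxY, h]
          obtain ⟨w, hw, hwY, hwy, v, hv, hA⟩ := h Y (hYU.trans hU) hne huY
            (fun h => htU (hYU h)) y
          refine ⟨w, ?_, hwY, hwy, v, hv, hA⟩
          by_cases hwU : w ∈ U
          · simp [hwU]
          · rcases hin w hw hwU ⟨v, hYU hv, hA⟩ with rfl | rfl <;> simp)
        (by simp) (by simp) hxs.symm rfl
      obtain ⟨σ₂, h₂⟩ := ih _ (by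
          rw [← hn]
          exact Finset.card_lt_card (Finset.sdiff_ssubset hU hUne))
        (h.contract hs hxS hU huU htU hxU hsx hin
          fun Y h1 h2 h3 h4 h5 => hUmax Y ⟨h1, h2, h3, h4, h5⟩)
        (by simp [hs, huU]) (by simp [ht, htU]) hst rfl
      exact ⟨_, h₁.of_insert h₂ hs hxS hU huU htU hxU hxs hxt⟩
    · have hU0 : U = ∅ := Finset.not_nonempty_iff_eq_empty.1 hUne
      obtain ⟨σ, hσ⟩ := ih _ (by
          rw [← hn]
          exact Finset.card_erase_lt_of_mem hxS)
        (h.merge hs hxs fun Y hY hne h1 h2 h3 => by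
          by_contra hcon
          push Not at hcon
          have := hUmax Y ⟨hY, h1, h2, h3, fun w hw hwY hv => by
            by_contra hw'
            push Not at hw'
            obtain ⟨v, hv, hA⟩ := hv
            exact hcon w hw hwY hw'.1 hw'.2 v hv hA⟩
          rw [hU0, Finset.card_empty] at this
          have := hne.card_pos
          omega)
        (by simp [hs, hxs.symm]) (by simp [ht, hxt.symm]) hst rfl
      refine ⟨_, hσ.of_merge hs hxS hxs hxt ht hst hsx ?_⟩
      obtain ⟨w, hw, hwx, hws, v, hv, hA⟩ := h {x} (by simpa using hxS) (by simp)
        (by simpa using hxs.symm) (by simpa using hxt.symm) u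
      exact ⟨w, hw, by simpa using hwx, hws, (Finset.mem_singleton.1 hv) ▸ hA⟩
  · have hS : ∀ v ∈ S, v = s ∨ v = t := fun v hv => by
      by_contra hv'
      exact hbig ⟨v, by simpa [hv] using hv'⟩
    refine ⟨fun v => if v = s then 0 else 1, ?_, ?_, ?_, ?_, ?_⟩
    · intro u hu v hv
      rcases hS u hu with rfl | rfl <;> rcases hS v hv with rfl | rfl <;> simp [hst, hst.symm]
    · intro v hv hvs; simp [hvs]
    · intro v hv hvt; simp [(hS v hv).resolve_right hvt, hst.symm]
    · intro v hv h1 h2; exact absurd (hS v hv) (by simp [h1, h2])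
    · intro v hv h1 h2; exact absurd (hS v hv) (by simp [h1, h2])

/-- In a digraph without cut vertices the vertices can be numbered such that every vertex is an
out-neighbour of the root or has a lower and a higher in-neighbour. -/
theorem exists_numbering [Fintype V] {A : V → V → Prop} {r : V} (h0 : ∀ v, Reach A ∅ r v)
    (h1 : ∀ x ≠ r, ∀ v ≠ x, Reach A {x} r v) :
    ∃ σ : V → ℤ, Function.Injective σ ∧ ∀ v ≠ r, A r v ∨
      (∃ u ≠ r, A u v ∧ σ u < σ v) ∧ ∃ u ≠ r, A u v ∧ σ v < σ u := by
  -- The root is split into two copies with the same out-arcs, `some r` to come first and `none` to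
  -- come last. This is why an out-neighbour of the root needs no further in-neighbours.
  let A' : Option V → Option V → Prop := fun u v => ∃ w, v = some w ∧ A (u.getD r) w
  have key : TwoConnected Finset.univ A' (some r) none := by
    intro Y _ hne hsY htY y
    obtain ⟨v, hv⟩ := hne
    obtain ⟨v, rfl⟩ := Option.ne_none_iff_exists'.1 fun e => htY (e ▸ hv)
    by_contra hcon
    push Not at hcon
    -- An in-neighbour different from `y` is wanted; `e` picks a copy of the root that is not `y`.
    let e : V → Option V := fun a => if a = r ∧ y = some r then none else some a
    have he : ∀ a, (e a).getD r = a := by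
      intro a
      by_cases h : a = r ∧ y = some r <;> simp [e, h]
    have hstep : ∀ L : Set V, Reach A L r v → (∀ a, a ∉ L → some a ∉ Y → some a ≠ y ∨ a = r) →
        False := by
      intro L hL hy
      refine hL.induct (fun a => some a ∉ Y) hsY (fun a b _ ha haL hab hb => ?_) hv
      refine hcon (e a) (Finset.mem_univ _) ?_ ?_ (some b) hb ⟨b, rfl, by rw [he]; exact hab⟩
      · by_cases h : a = r ∧ y = some r <;> simp [e, h, htY, ha]
      · by_cases h : a = r ∧ y = some r
        · simp [e, h]
        · simp only [e, h, if_false]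
          intro hay
          rcases hy a haL ha with h' | h'
          · exact h' hay
          · exact h ⟨h', by rw [← hay, h']⟩
    by_cases hyc : ∃ x, x ≠ r ∧ y = some x ∧ some x ∉ Y
    · obtain ⟨x, hxr, rfl, hxY⟩ := hyc
      exact hstep {x} (h1 x hxr v fun e => hxY (e ▸ hv)) fun a ha _ =>
        .inl fun e => ha (Option.some_injective _ e)
    · push Not at hyc
      refine hstep ∅ (h0 v) fun a _ haY => ?_
      by_contra hcon'
      push Not at hcon'
      exact haY (hyc a hcon'.2 hcon'.1.symm)
  obtain ⟨σ, hσ⟩ := key.exists_numbering (Finset.mem_univ _) (Finset.mem_univ _) (by simp)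
  refine ⟨fun v => σ (some v), fun u v huv => Option.some_injective _
    (hσ.inj _ (Finset.mem_univ _) _ (Finset.mem_univ _) huv), fun v hv => ?_⟩
  by_cases hrv : A r v
  · exact .inl hrv
  have conv : ∀ u : Option V, A' u (some v) → ∃ w ≠ r, u = some w ∧ A w v := by
    rintro u ⟨w, hw, hA⟩
    rw [← Option.some_injective _ hw] at hA
    cases u with
    | none => exact absurd hA hrv
    | some w => exact ⟨w, fun e => hrv (e ▸ hA), rfl, hA⟩
  have hv' : (some v : Option V) ≠ some r := fun e => hv (Option.some_injective _ e)
  obtain ⟨u, -, hu, hlt⟩ := hσ.low (some v) (Finset.mem_univ _) hv' (by simp)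
  obtain ⟨u', -, hu', hlt'⟩ := hσ.high (some v) (Finset.mem_univ _) hv' (by simp)
  obtain ⟨w, hw, rfl, hA⟩ := conv u hu
  obtain ⟨w', hw', rfl, hA'⟩ := conv u' hu'
  exact .inr ⟨⟨w, hw, hA, hlt⟩, w', hw', hA', hlt'⟩

end Numbering

end LeafKernel

namespace LeafKernel

section Layout

open Classical

/-! ### Leaves from numberings -/

/-- Some vertex of `M` has at most one preimage in `M` under `φ`. Selecting it and discarding its
image and its preimage uses up at most three vertices. Fixed points of `φ` are permitted. -/
theorem exists_independent {V : Type} (φ : V → V) (M : Finset V) :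
    ∃ F ⊆ M, M.card ≤ 3 * F.card ∧ ∀ v ∈ F, ∀ w ∈ F, w ≠ v → φ v ≠ w := by
  induction hn : M.card using Nat.strong_induction_on generalizing M with
  | _ n ih =>
  rcases M.eq_empty_or_nonempty with rfl | hne
  · exact ⟨∅, by simp, by simp [← hn], by simp⟩
  obtain ⟨y, hy, hfib⟩ := Finset.exists_card_fiber_le_of_card_le_mul (s := M) (f := φ) (n := 1) hne
    (by omega)
  set D := insert y (insert (φ y) {x ∈ M | φ x = y}) with hD
  have hDcard : D.card ≤ 3 := by
    rw [hD]
    have h1 := Finset.card_insert_le y (insert (φ y) {x ∈ M | φ x = y})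
    have h2 := Finset.card_insert_le (φ y) {x ∈ M | φ x = y}
    omega
  have hlt : (M \ D).card < n := by
    rw [← hn]
    exact Finset.card_lt_card ⟨Finset.sdiff_subset, fun h => by simpa [hD] using h hy⟩
  obtain ⟨F, hF, hcard, hind⟩ := ih _ hlt (M \ D) rfl
  have hnot : ∀ v ∈ F, v ≠ y ∧ v ≠ φ y ∧ φ v ≠ y := fun v hv => by
    have := hF hv
    simp only [hD, Finset.mem_sdiff, Finset.mem_insert, Finset.mem_filter, not_or, not_and] at this
    exact ⟨this.2.1, this.2.2.1, this.2.2.2 this.1⟩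
  refine ⟨insert y F, ?_, ?_, ?_⟩
  · exact Finset.insert_subset hy (hF.trans Finset.sdiff_subset)
  · rw [Finset.card_insert_of_notMem fun h => (hnot y h).1 rfl]
    have := Finset.le_card_sdiff D M
    omega
  · intro v hv w hw hwv
    rcases Finset.mem_insert.1 hv with rfl | hv' <;> rcases Finset.mem_insert.1 hw with rfl | hw'
    · exact absurd rfl hwv
    · exact fun e => (hnot w hw').2.1 e.symm
    · exact (hnot v hv').2.2
    · exact hind v hv' w hw' hwv

/-- Let `T` be a transversal of the fibres. A vertex that shares its value lies outside `T` or
represents a value taken outside `T`; either kind numbers at most `|S| - |f(S)|`. -/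
theorem card_nonunique_le {V W : Type} (f : V → W) (S : Finset V) :
    {v ∈ S | ∃ w ∈ S, w ≠ v ∧ f w = f v}.card + 2 * (S.image f).card ≤ 2 * S.card := by
  obtain ⟨T, hT, hinj, hTf⟩ := Finset.exists_subset_injOn_image_eq_of_surjOn (f := f) ↑S (S.image f)
    (by rw [Finset.coe_image]; exact Set.surjOn_image f ↑S)
  rw [Finset.coe_subset] at hT
  have h1 : (S.image f).card = T.card := by rw [← hTf, Finset.card_image_of_injOn hinj]
  have h2 : {v ∈ S | ∃ w ∈ S, w ≠ v ∧ f w = f v} ⊆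
      (S \ T) ∪ {v ∈ T | f v ∈ (S \ T).image f} := by
    intro v hv
    simp only [Finset.mem_filter] at hv
    obtain ⟨hvS, w, hw, hwv, hfw⟩ := hv
    by_cases hvT : v ∈ T
    · refine Finset.mem_union_right _ (Finset.mem_filter.2 ⟨hvT, Finset.mem_image.2 ⟨w, ?_, hfw⟩⟩)
      exact Finset.mem_sdiff.2 ⟨hw, fun hwT => hwv (hinj hwT hvT hfw)⟩
    · exact Finset.mem_union_left _ (Finset.mem_sdiff.2 ⟨hvS, hvT⟩)
  have h3 : {v ∈ T | f v ∈ (S \ T).image f}.card ≤ (S \ T).card := by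
    refine le_trans ?_ (Finset.card_image_le (s := S \ T) (f := f))
    refine Finset.card_le_card_of_injOn f (fun v hv => (Finset.mem_filter.1 hv).2) ?_
    exact hinj.mono fun v hv => (Finset.mem_filter.1 hv).1
  have h4 := (Finset.card_le_card h2).trans (Finset.card_union_le _ _)
  have h5 := Finset.card_sdiff_add_card_eq_card hT
  omega

theorem rank_induction {V : Type} [Finite V] (σ : V → ℤ) {P : V → Prop}
    (h : ∀ v, (∀ u, σ u < σ v → P u) → P v) (v : V) : P v := by
  have : IsTrans V fun u v => σ u < σ v := ⟨fun _ _ _ => lt_trans⟩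
  have : Std.Irrefl fun u v : V => σ u < σ v := ⟨fun _ => lt_irrefl _⟩
  exact (Finite.wellFounded_of_trans_of_irrefl fun u v => σ u < σ v).induction v h

variable {V : Type} [Fintype V]

/-- The leaves of the tree with root `r` in which the parent of `v ≠ r` is `g v`. -/
noncomputable def treeLeaves (r : V) (g : V → V) : Finset V :=
  Finset.univ \ (Finset.univ.erase r).image g

theorem mem_treeLeaves {r : V} {g : V → V} {v : V} :
    v ∈ treeLeaves r g ↔ ∀ w ≠ r, g w ≠ v := by
  simp [treeLeaves]

/-- A digraph with root `r` all of whose out-trees have fewer than `k` leaves, together with a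
numbering `σ` of its vertices, and a lower in-neighbour `f v` and a higher in-neighbour `b v` of
every vertex `v ≠ r`. -/
structure Layout (A : V → V → Prop) (r : V) (k : ℕ) (σ : V → ℤ) (f b : V → V) : Prop where
  few : ∀ L : Finset V, (∀ v, Reach A ↑L r v) → L.card < k
  loopless : ∀ v, ¬ A v v
  root : ∀ v, ¬ A v r
  sole : ∀ u v, A r v → A u v → u = r
  inj : Function.Injective σ
  fwd : ∀ v ≠ r, A (f v) v ∧ (f v = r ∨ σ (f v) < σ v)
  bwd : ∀ v ≠ r, A (b v) v ∧ (b v = r ∨ σ v < σ (b v))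

/-! ### Counting leaves of spanning trees obtained by changing parents -/

namespace Layout

variable {A : V → V → Prop} {r : V} {k : ℕ} {σ : V → ℤ} {f b : V → V}

omit [Fintype V] in
theorem symm (h : Layout A r k σ f b) : Layout A r k (fun v => -σ v) b f where
  few := h.few
  loopless := h.loopless
  root := h.root
  sole := h.sole
  inj := fun _ _ huv => h.inj (neg_injective huv)
  fwd := fun v hv => ⟨(h.bwd v hv).1, (h.bwd v hv).2.imp_right neg_lt_neg⟩
  bwd := fun v hv => ⟨(h.fwd v hv).1, (h.fwd v hv).2.imp_right neg_lt_neg⟩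

/-- Parents that decrease along any rank `ρ`, not necessarily the numbering, form a spanning
out-tree. The counts below come from suitable choices of `g` and `ρ`. -/
theorem card_treeLeaves_lt (h : Layout A r k σ f b) (g : V → V) (ρ : V → ℤ)
    (hg : ∀ v ≠ r, A (g v) v ∧ (g v = r ∨ ρ (g v) < ρ v)) : (treeLeaves r g).card < k := by
  refine h.few _ (rank_induction ρ fun v ih => ?_)
  by_cases hv : v = r
  · exact hv ▸ .refl
  have hnot : g v ∉ (↑(treeLeaves r g) : Set V) := fun hh => mem_treeLeaves.1 hh v hv rfl
  refine Reach.tail ?_ hnot (hg v hv).1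
  rcases (hg v hv).2 with e | hlt
  · exact e ▸ .refl
  · exact ih _ hlt

theorem k_pos (h : Layout A r k σ f b) : 0 < k :=
  (Nat.zero_le _).trans_lt (h.card_treeLeaves_lt f σ h.fwd)

/-- Changing the parents of independent only children turns their former parents into leaves. -/
theorem card_le_of_flip (z : V → V) (M : Finset V) (hr : r ∉ M)
    (honly : ∀ v ∈ M, ∀ w ≠ r, b w = b v → w = v) (hz : ∀ v ∈ M, z v ≠ b v)
    (hT : ∀ F ⊆ M, (treeLeaves r fun v => if v ∈ F then z v else b v).card < k) :
    M.card ≤ 3 * k := by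
  -- `φ v` is the vertex of `M` whose old parent is the new parent of `v`. Flipping both would keep
  -- that old parent from becoming a leaf, so an independent set is flipped.
  let φ : V → V := fun v => if h : ∃ w ∈ M, b w = z v then h.choose else v
  obtain ⟨F, hF, hcard, hind⟩ := exists_independent φ M
  have hφ : ∀ v, ∀ w ∈ M, b w = z v → φ v = w := by
    intro v w hw hbw
    have hex : ∃ w ∈ M, b w = z v := ⟨w, hw, hbw⟩
    have := hex.choose_spec
    simp only [φ, hex, dif_pos]
    exact honly w hw _ (fun e => hr (e ▸ this.1)) (this.2.trans hbw.symm)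
  have hsub : F.image b ⊆ treeLeaves r fun v => if v ∈ F then z v else b v := by
    intro u hu
    obtain ⟨v, hv, rfl⟩ := Finset.mem_image.1 hu
    refine mem_treeLeaves.2 fun w hw => ?_
    by_cases hwF : w ∈ F <;> simp only [hwF, if_true, if_false]
    · intro e
      by_cases hwv : w = v
      · exact hz v (hF hv) (hwv ▸ e)
      · exact hind w hwF v hv (Ne.symm hwv) (hφ w v (hF hv) e.symm)
    · exact fun e => hwF (honly v (hF hv) w hw e ▸ hv)
  have h1 := (Finset.card_le_card hsub).trans_lt (hT F hF)
  rw [Finset.card_image_of_injOn] at h1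
  · omega
  · intro v hv w hw e
    exact honly w (hF hw) v (fun e' => hr (e' ▸ hF hv)) e

/-- `v` has exactly two in-neighbours `f v` and `b v`, and is their only child in the forward
and in the backward tree. -/
structure Good (A : V → V → Prop) (r : V) (σ : V → ℤ) (f b : V → V) (v : V) : Prop where
  mem_in : ∀ u, A u v ↔ u = f v ∨ u = b v
  f_ne : f v ≠ r
  b_ne : b v ≠ r
  f_lt : σ (f v) < σ v
  lt_b : σ v < σ (b v)
  f_only : ∀ w ≠ r, f w = f v → w = v
  b_only : ∀ w ≠ r, b w = b v → w = v

omit [Fintype V] in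
theorem Good.symm {v : V} (h : Good A r σ f b v) : Good A r (fun v => -σ v) b f v :=
  ⟨fun u => (h.mem_in u).trans or_comm, h.b_ne, h.f_ne, neg_lt_neg h.lt_b, neg_lt_neg h.f_lt,
    h.b_only, h.f_only⟩

/-- The leaves number as many as the vertices minus the distinct parents, so few leaves mean few
vertices that share a parent. -/
theorem card_siblings_le (h : Layout A r k σ f b) :
    {v ∈ Finset.univ.erase r | ∃ w ∈ Finset.univ.erase r, w ≠ v ∧ f w = f v}.card ≤ 2 * k := by
  have h1 : {v ∈ Finset.univ.erase r | ∃ w ∈ Finset.univ.erase r, w ≠ v ∧ f w = f v}.card +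
      2 * ((Finset.univ.erase r).image f).card ≤ 2 * (Finset.univ.erase r).card := by
    convert card_nonunique_le f (Finset.univ.erase r)
  have h2 := h.card_treeLeaves_lt f σ h.fwd
  have h3 := Finset.card_sdiff_add_card_eq_card (Finset.subset_univ ((Finset.univ.erase r).image f))
  have h4 := Finset.card_erase_le (s := Finset.univ) (a := r)
  unfold treeLeaves at h2
  omega

/-- An only child may be hung from a second lower in-neighbour instead. The tree still increases
along `σ`, so `card_le_of_flip` applies. -/
theorem card_second_le (h : Layout A r k σ f b) :
    {v ∈ Finset.univ.erase r | (∀ w ≠ r, f w = f v → w = v) ∧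
      ∃ u, u ≠ f v ∧ A u v ∧ (u = r ∨ σ u < σ v)}.card ≤ 3 * k := by
  let z : V → V := fun v => if h : ∃ u, u ≠ f v ∧ A u v ∧ (u = r ∨ σ u < σ v) then h.choose else v
  have hz : ∀ v, (∃ u, u ≠ f v ∧ A u v ∧ (u = r ∨ σ u < σ v)) →
      z v ≠ f v ∧ A (z v) v ∧ (z v = r ∨ σ (z v) < σ v) := by
    intro v hv
    simp only [z, hv, dif_pos]
    exact hv.choose_spec
  refine card_le_of_flip (b := f) (r := r) z _ (by simp) (fun v hv => ?_) (fun v hv => ?_)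
    fun F hF => h.card_treeLeaves_lt _ σ fun v hv => ?_
  · exact (Finset.mem_filter.1 hv).2.1
  · exact (hz v (Finset.mem_filter.1 hv).2.2).1
  · by_cases hvF : v ∈ F <;> simp only [hvF, if_true, if_false]
    · exact (hz v (Finset.mem_filter.1 (hF hvF)).2.2).2
    · exact h.fwd v hv

/-- The vertices that are not good. -/
noncomputable def bad (A : V → V → Prop) (r : V) (σ : V → ℤ) (f b : V → V) :
    Finset V :=
  {v ∈ Finset.univ.erase r | ¬ Good A r σ f b v}

omit [Fintype V] in
theorem good_of_not (h : Layout A r k σ f b) {v : V} (hv : v ≠ r) (hrv : ¬ A r v)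
    (h1 : ∀ w ≠ r, f w = f v → w = v) (h2 : ∀ w ≠ r, b w = b v → w = v)
    (h3 : ¬ ∃ u, u ≠ f v ∧ A u v ∧ (u = r ∨ σ u < σ v))
    (h4 : ¬ ∃ u, u ≠ b v ∧ A u v ∧ (u = r ∨ σ v < σ u)) : Good A r σ f b v := by
  have hf := h.fwd v hv
  have hb := h.bwd v hv
  have hfr : f v ≠ r := fun e => hrv (e ▸ hf.1)
  have hbr : b v ≠ r := fun e => hrv (e ▸ hb.1)
  refine ⟨fun u => ⟨fun hu => ?_, ?_⟩, hfr, hbr, hf.2.resolve_left hfr, hb.2.resolve_left hbr,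
    h1, h2⟩
  · push Not at h3 h4
    rcases lt_trichotomy (σ u) (σ v) with hlt | he | hlt
    · by_contra hne
      push Not at hne
      exact absurd hlt (not_lt.2 (h3 u hne.1 hu).2)
    · exact absurd (h.inj he ▸ hu) (h.loopless v)
    · by_contra hne
      push Not at hne
      exact absurd hlt (not_lt.2 (h4 u hne.2 hu).2)
  · rintro (rfl | rfl)
    exacts [hf.1, hb.1]

/-- `13 = 2 + 2 + 3 + 3 + 3`: siblings in either tree, vertices with a second lower or a second
higher in-neighbour, and out-neighbours of the root. By `sole` the last are siblings of each other
as soon as there are two. -/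
theorem card_bad_le (h : Layout A r k σ f b) :
    (bad A r σ f b).card ≤ 13 * k := by
  have h1 := h.card_siblings_le
  have h2 := h.symm.card_siblings_le
  have h3 := h.card_second_le
  have h4 := h.symm.card_second_le
  simp only [neg_lt_neg_iff] at h4
  have hf : ∀ v, v ≠ r → A r v → f v = r := fun v hv hrv => h.sole _ _ hrv (h.fwd v hv).1
  have h5 : {v ∈ Finset.univ.erase r | A r v}.card ≤ 3 * k := by
    rcases le_or_gt {v ∈ Finset.univ.erase r | A r v}.card 1 with hle | hlt
    · have := h.k_pos; omega
    · refine le_trans (Finset.card_le_card fun v hv => ?_) (h1.trans (by omega))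
      obtain ⟨w, hw, hwv⟩ := Finset.exists_mem_ne hlt v
      simp only [Finset.mem_filter, Finset.mem_erase, Finset.mem_univ, and_true] at hv hw ⊢
      exact ⟨hv.1, w, hw.1, hwv, (hf w hw.1 hw.2).trans (hf v hv.1 hv.2).symm⟩
  have hsub : bad A r σ f b ⊆
      {v ∈ Finset.univ.erase r | ∃ w ∈ Finset.univ.erase r, w ≠ v ∧ f w = f v} ∪
      ({v ∈ Finset.univ.erase r | ∃ w ∈ Finset.univ.erase r, w ≠ v ∧ b w = b v} ∪
      ({v ∈ Finset.univ.erase r | (∀ w ≠ r, f w = f v → w = v) ∧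
        ∃ u, u ≠ f v ∧ A u v ∧ (u = r ∨ σ u < σ v)} ∪
      ({v ∈ Finset.univ.erase r | (∀ w ≠ r, b w = b v → w = v) ∧
        ∃ u, u ≠ b v ∧ A u v ∧ (u = r ∨ σ v < σ u)} ∪
      {v ∈ Finset.univ.erase r | A r v}))) := by
    intro v hv
    simp only [bad, Finset.mem_filter, Finset.mem_erase, Finset.mem_univ, and_true,
      Finset.mem_union] at hv ⊢
    obtain ⟨hvr, hg⟩ := hv
    by_contra hcon
    simp only [hvr, ne_eq, not_false_eq_true, true_and, not_or] at hcon
    obtain ⟨c1, c2, c3, c4, c5⟩ := hcon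
    have e1 : ∀ w ≠ r, f w = f v → w = v := fun w hw e => by
      by_contra hne
      exact c1 ⟨w, hw, hne, e⟩
    have e2 : ∀ w ≠ r, b w = b v → w = v := fun w hw e => by
      by_contra hne
      exact c2 ⟨w, hw, hne, e⟩
    exact hg (h.good_of_not hvr c5 e1 e2 (fun hh => c3 ⟨e1, hh⟩) fun hh => c4 ⟨e2, hh⟩)
  have := Finset.card_le_card hsub
  refine this.trans ?_
  refine (Finset.card_union_le _ _).trans ?_
  have u1 := Finset.card_union_le
      {v ∈ Finset.univ.erase r | ∃ w ∈ Finset.univ.erase r, w ≠ v ∧ b w = b v}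
      ({v ∈ Finset.univ.erase r | (∀ w ≠ r, f w = f v → w = v) ∧
        ∃ u, u ≠ f v ∧ A u v ∧ (u = r ∨ σ u < σ v)} ∪
      ({v ∈ Finset.univ.erase r | (∀ w ≠ r, b w = b v → w = v) ∧
        ∃ u, u ≠ b v ∧ A u v ∧ (u = r ∨ σ v < σ u)} ∪
      {v ∈ Finset.univ.erase r | A r v}))
  have u2 := Finset.card_union_le
      {v ∈ Finset.univ.erase r | (∀ w ≠ r, f w = f v → w = v) ∧
        ∃ u, u ≠ f v ∧ A u v ∧ (u = r ∨ σ u < σ v)}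
      ({v ∈ Finset.univ.erase r | (∀ w ≠ r, b w = b v → w = v) ∧
        ∃ u, u ≠ b v ∧ A u v ∧ (u = r ∨ σ v < σ u)} ∪
      {v ∈ Finset.univ.erase r | A r v})
  have u3 := Finset.card_union_le
      {v ∈ Finset.univ.erase r | (∀ w ≠ r, b w = b v → w = v) ∧
        ∃ u, u ≠ b v ∧ A u v ∧ (u = r ∨ σ v < σ u)}
      {v ∈ Finset.univ.erase r | A r v}
  omega

/-- Good vertices `v` whose grandparent `b (f v)` lies above `v`. -/
theorem card_above_le (h : Layout A r k σ f b) (M : Finset V)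
    (hM : ∀ v ∈ M, v ≠ r ∧ Good A r σ f b v ∧ σ v < σ (b (f v))) : M.card ≤ 9 * k := by
  -- The factor `9` is `3 * 3`: one `3` for never flipping both `v` and `f v`, the other for
  -- `card_le_of_flip`.
  obtain ⟨N, hN, hcard, hind⟩ := exists_independent f M
  suffices N.card ≤ 3 * k by omega
  have hN' : ∀ v ∈ N, v ≠ r ∧ Good A r σ f b v ∧ σ v < σ (b (f v)) := fun v hv => hM v (hN hv)
  have hnotf : ∀ v ∈ N, ∀ w ∈ N, f w ≠ v := fun v hv w hw e => by
    by_cases hwv : v = w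
    · exact absurd (hN' w hw).2.1.f_lt (by rw [e, hwv]; exact lt_irrefl _)
    · exact hind w hw v hv hwv e
  refine card_le_of_flip (b := b) (r := r) f N (fun hr => (hN' r hr).1 rfl)
    (fun v hv => (hN' v hv).2.1.b_only) (fun v hv e => ?_) fun F hF => ?_
  · have := (hN' v hv).2.1.f_lt.trans (hN' v hv).2.1.lt_b
    rw [e] at this
    exact lt_irrefl _ this
  · let ρ : V → ℤ := fun x => if hx : ∃ v ∈ F, f v = x then -2 * σ hx.choose - 1 else -2 * σ x
    have hρf : ∀ v ∈ F, ρ (f v) = -2 * σ v - 1 := by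
      intro v hv
      have hex : ∃ w ∈ F, f w = f v := ⟨v, hv, rfl⟩
      have hs := hex.choose_spec
      have : hex.choose = v :=
        (hN' v (hF hv)).2.1.f_only _ (hN' _ (hF hs.1)).1 hs.2
      simp only [ρ, hex, dif_pos, this]
    have hρn : ∀ x, (¬ ∃ v ∈ F, f v = x) → ρ x = -2 * σ x := by
      intro x hx
      simp only [ρ, hx, dif_neg, not_false_eq_true]
    have hρle : ∀ x, ρ x ≤ -2 * σ x := by
      intro x
      by_cases hx : ∃ v ∈ F, f v = x
      · obtain ⟨v, hv, rfl⟩ := hx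
        have := (hN' v (hF hv)).2.1.f_lt
        rw [hρf v hv]; omega
      · rw [hρn x hx]
    refine h.card_treeLeaves_lt _ ρ fun v hv => ?_
    by_cases hvF : v ∈ F <;> simp only [hvF, if_true, if_false]
    · refine ⟨(h.fwd v hv).1, .inr ?_⟩
      rw [hρf v hvF, hρn v fun ⟨w, hw, e⟩ => hnotf v (hF hvF) w (hF hw) e]
      omega
    · refine ⟨(h.bwd v hv).1, (h.bwd v hv).2.imp_right fun hlt => ?_⟩
      have hle := hρle (b v)
      by_cases hx : ∃ w ∈ F, f w = v
      · obtain ⟨w, hw, rfl⟩ := hx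
        have := (hN' w (hF hw)).2.2
        rw [hρf w hw]; omega
      · rw [hρn v hx]; omega

/-- Few vertices above a threshold have an in-neighbour below it. -/
theorem card_crossing_lt (h : Layout A r k σ f b) (c : ℤ) (M : Finset V)
    (hM : ∀ v ∈ M, v ≠ r ∧ c < σ v ∧ ∃ u ≠ r, A u v ∧ σ u ≤ c) : M.card < k := by
  obtain ⟨B, hB⟩ : ∃ B, ∀ v, σ v ≤ B := by
    obtain ⟨B, hB⟩ := (Set.finite_range σ).bddAbove
    exact ⟨B, fun v => hB ⟨v, rfl⟩⟩
  choose! z hz using fun v (hv : v ∈ M) => (hM v hv).2.2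
  -- Forward parents up to the threshold, backward parents above it, and the vertices of `M` hung
  -- from below. In the upper part only the vertices outside `M` choose parents from that part, so
  -- at least `|M|` of its vertices are leaves.
  let g : V → V := fun v => if σ v ≤ c then f v else if v ∈ M then z v else b v
  let ρ : V → ℤ := fun v => if σ v ≤ c then σ v else c + 1 + (B - σ v)
  have hρ1 : ∀ v, σ v ≤ c → ρ v = σ v := fun v hv => by simp [ρ, hv]
  have hρ2 : ∀ v, ¬ σ v ≤ c → ρ v = c + 1 + (B - σ v) := fun v hv => by simp [ρ, hv]
  have hg : ∀ v ≠ r, A (g v) v ∧ (g v = r ∨ ρ (g v) < ρ v) := by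
    intro v hv
    by_cases hc : σ v ≤ c
    · simp only [g, hc, if_true]
      refine ⟨(h.fwd v hv).1, (h.fwd v hv).2.imp_right fun hlt => ?_⟩
      rw [hρ1 _ hc, hρ1 _ (by omega)]
      exact hlt
    · by_cases hvM : v ∈ M <;> simp only [g, hc, hvM, if_true, if_false]
      · refine ⟨(hz v hvM).2.1, .inr ?_⟩
        rw [hρ1 _ (hz v hvM).2.2, hρ2 _ hc]
        have := hB v
        have := (hz v hvM).2.2
        omega
      · refine ⟨(h.bwd v hv).1, (h.bwd v hv).2.imp_right fun hlt => ?_⟩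
        rw [hρ2 _ hc, hρ2 _ (by omega)]
        omega
  refine lt_of_le_of_lt ?_ (h.card_treeLeaves_lt g ρ hg)
  set R : Finset V := {v ∈ Finset.univ.erase r | c < σ v} with hR
  have hMR : M ⊆ R := fun v hv => by simp [hR, (hM v hv).1, (hM v hv).2.1]
  have hsub : R \ (R \ M).image b ⊆ treeLeaves r g := by
    intro x hx
    refine mem_treeLeaves.2 fun w hw e => ?_
    simp only [hR, Finset.mem_sdiff, Finset.mem_filter, Finset.mem_erase, Finset.mem_univ,
      and_true, Finset.mem_image, not_exists, not_and] at hx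
    obtain ⟨⟨hxr, hxc⟩, hx⟩ := hx
    by_cases hc : σ w ≤ c
    · have := (hg w hw).2.resolve_left (e ▸ hxr)
      rw [hρ1 w hc, e, hρ2 x (by omega)] at this
      have := hB x
      omega
    · by_cases hwM : w ∈ M
      · simp only [g, hc, hwM, if_true, if_false] at e
        have := (hz w hwM).2.2
        rw [e] at this
        omega
      · simp only [g, hc, hwM, if_false] at e
        exact hx w ⟨⟨hw, by omega⟩, hwM⟩ e
  have h1 := Finset.card_le_card hsub
  have h2 := Finset.le_card_sdiff ((R \ M).image b) R
  have h3 := Finset.card_image_le (s := R \ M) (f := b)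
  have h4 := Finset.card_sdiff_add_card_eq_card hMR
  omega

end Layout

end Layout

end LeafKernel

namespace LeafKernel

/-! ### Unmatched vertices and arcs that leave a chain -/

section Bound

open Classical

variable {V : Type} [Fintype V] {A : V → V → Prop} {r : V} {k : ℕ} {σ : V → ℤ} {f b : V → V}

namespace Layout

omit [Fintype V] in
theorem mem_bad [Fintype V] {v : V} : v ∈ bad A r σ f b ↔ v ≠ r ∧ ¬ Good A r σ f b v := by
  simp [bad]

/-- Few good vertices `v` differ from `b (f v)`. -/
theorem card_unmatched_le (h : Layout A r k σ f b) :
    {v : V | v ≠ r ∧ Good A r σ f b v ∧ Good A r σ f b (f v) ∧ b (f v) ≠ v}.toFinset.card ≤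
      44 * k * k := by
  set S := {v : V | v ≠ r ∧ Good A r σ f b v ∧ Good A r σ f b (f v) ∧ b (f v) ≠ v}.toFinset with hS
  have hmem : ∀ v, v ∈ S ↔ v ≠ r ∧ Good A r σ f b v ∧ Good A r σ f b (f v) ∧ b (f v) ≠ v := by
    intro v; simp [hS]
  have hinj : ∀ v ∈ S, ∀ w ∈ S, b (f v) = b (f w) → v = w := by
    intro v hv w hw e
    rw [hmem] at hv hw
    exact hw.2.1.f_only v hv.1 (hw.2.2.1.b_only _ hv.2.1.f_ne e)
  -- The obstacles to passing from `v` to the next unmatched vertex `b (f v)`; together they give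
  -- `44 = 9 + 13 + 13 + 9`.
  let T := {v ∈ S | σ v < σ (b (f v))} ∪ ({v ∈ S | b (f v) ∈ bad A r σ f b} ∪
    ({v ∈ S | Good A r σ f b (b (f v)) ∧ f (b (f v)) ∈ bad A r σ f b} ∪
      {v ∈ S | Good A r σ f b (b (f v)) ∧ σ (f (b (f v))) < σ (f v)}))
  have hbad := h.card_bad_le
  have hTcard : T.card ≤ 44 * k := by
    have h1 : {v ∈ S | σ v < σ (b (f v))}.card ≤ 9 * k := h.card_above_le _ fun v hv => by
      rw [Finset.mem_filter, hmem] at hv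
      exact ⟨hv.1.1, hv.1.2.1, hv.2⟩
    have h2 : {v ∈ S | b (f v) ∈ bad A r σ f b}.card ≤ 13 * k :=
      (Finset.card_le_card_of_injOn (fun v => b (f v)) (fun v hv => (Finset.mem_filter.1 hv).2)
        fun v hv w hw e => hinj v (Finset.mem_filter.1 hv).1 w (Finset.mem_filter.1 hw).1 e).trans
        hbad
    have h3 : {v ∈ S | Good A r σ f b (b (f v)) ∧ f (b (f v)) ∈ bad A r σ f b}.card ≤ 13 * k := by
      refine (Finset.card_le_card_of_injOn (fun v => f (b (f v)))
        (fun v hv => (Finset.mem_filter.1 hv).2.2) fun v hv w hw e => ?_).trans hbad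
      have hv' := Finset.mem_filter.1 hv
      have hw' := Finset.mem_filter.1 hw
      refine hinj v hv'.1 w hw'.1 (hw'.2.1.f_only _ ((hmem v).1 hv'.1).2.2.1.b_ne e)
    have h4 : {v ∈ S | Good A r σ f b (b (f v)) ∧ σ (f (b (f v))) < σ (f v)}.card ≤ 9 * k := by
      refine le_trans (Finset.card_le_card_of_injOn f (t := Finset.image f
        {v ∈ S | Good A r σ f b (b (f v)) ∧ σ (f (b (f v))) < σ (f v)})
        (fun v hv => Finset.mem_coe.2 (Finset.mem_image_of_mem f hv)) fun v hv w hw e => ?_)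
        (h.symm.card_above_le _ fun u hu => ?_)
      · have hv' := (hmem v).1 (Finset.mem_filter.1 hv).1
        have hw' := (hmem w).1 (Finset.mem_filter.1 hw).1
        exact hw'.2.1.f_only _ hv'.1 e
      · obtain ⟨v, hv, rfl⟩ := Finset.mem_image.1 hu
        rw [Finset.mem_filter, hmem] at hv
        exact ⟨hv.1.2.1.f_ne, hv.1.2.2.1.symm, neg_lt_neg hv.2.2⟩
    refine (Finset.card_union_le _ _).trans ?_
    have u1 := Finset.card_union_le {v ∈ S | b (f v) ∈ bad A r σ f b}
      ({v ∈ S | Good A r σ f b (b (f v)) ∧ f (b (f v)) ∈ bad A r σ f b} ∪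
        {v ∈ S | Good A r σ f b (b (f v)) ∧ σ (f (b (f v))) < σ (f v)})
    have u2 := Finset.card_union_le
      {v ∈ S | Good A r σ f b (b (f v)) ∧ f (b (f v)) ∈ bad A r σ f b}
      {v ∈ S | Good A r σ f b (b (f v)) ∧ σ (f (b (f v))) < σ (f v)}
    omega
  -- For `v` outside `T` the interval from `f v` to `v` strictly contains the one from `f (b (f v))`
  -- to `b (f v)`, and `b (f v)` is unmatched again. Going inwards ends in `T`.
  have hcover : ∀ v, v ∈ S → ∃ t ∈ T, σ (f v) ≤ σ (f t) ∧ σ t ≤ σ v := by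
    refine rank_induction σ fun v ih hv => ?_
    by_cases hvT : v ∈ T
    · exact ⟨v, hvT, le_rfl, le_rfl⟩
    simp only [T, Finset.mem_union, Finset.mem_filter, hv, true_and, not_or, mem_bad] at hvT
    obtain ⟨c1, c2, c3, c4⟩ := hvT
    have hv' := (hmem v).1 hv
    have hg : Good A r σ f b (b (f v)) := by
      by_contra hg
      exact c2 ⟨hv'.2.2.1.b_ne, hg⟩
    have hg2 : Good A r σ f b (f (b (f v))) := by
      by_contra hg2
      exact c3 ⟨hg, hg.f_ne, hg2⟩
    have hne : f (b (f v)) ≠ f v := fun e =>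
      hv'.2.2.2 (hv'.2.1.f_only _ hv'.2.2.1.b_ne e)
    have hlt1 : σ (b (f v)) < σ v := by
      refine lt_of_le_of_ne (not_lt.1 c1) fun e => hv'.2.2.2 (h.inj e)
    have hlt2 : σ (f v) < σ (f (b (f v))) := by
      refine lt_of_le_of_ne (not_lt.1 fun hlt => c4 ⟨hg, hlt⟩) fun e => hne (h.inj e).symm
    have hS1 : b (f v) ∈ S := by
      refine (hmem _).2 ⟨hv'.2.2.1.b_ne, hg, hg2, fun e => hne ?_⟩
      exact hv'.2.2.1.b_only _ hg.f_ne e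
    obtain ⟨t, ht, h1, h2⟩ := ih _ hlt1 hS1
    exact ⟨t, ht, hlt2.le.trans h1, h2.trans hlt1.le⟩
  have hsub : S ⊆ T.biUnion fun t => {v ∈ S | σ (f v) ≤ σ (f t) ∧ σ t ≤ σ v} := by
    intro v hv
    obtain ⟨t, ht, h1, h2⟩ := hcover v hv
    exact Finset.mem_biUnion.2 ⟨t, ht, Finset.mem_filter.2 ⟨hv, h1, h2⟩⟩
  have hTS : T ⊆ S := by
    intro v hv
    simp only [T, Finset.mem_union, Finset.mem_filter] at hv
    tauto
  refine (Finset.card_le_card hsub).trans ((Finset.card_biUnion_le_card_mul _ _ k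
    fun t ht => ?_).trans (Nat.mul_le_mul_right k hTcard))
  -- All `v` covered by `t` lie above the threshold `σ (f t)` and have the in-neighbour `f v` at or
  -- below it.
  refine (h.card_crossing_lt (σ (f t)) _ fun v hv => ?_).le
  rw [Finset.mem_filter] at hv
  have hv' := (hmem v).1 hv.1
  have ht' := ((hmem t).1 (hTS ht)).2.1.f_lt
  exact ⟨hv'.1, by omega, f v, hv'.2.1.f_ne, (hv'.2.1.mem_in _).2 (.inl rfl), hv.2.1⟩

/-- Few vertices outside a forward chain `Z` have a lower in-neighbour in `Z`. -/
theorem card_targets_lt (h : Layout A r k σ f b) (Z M : Finset V) (t : V) (ht : t ∈ Z)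
    (hrZ : r ∉ Z) (hZ : ∀ v ∈ Z, v ≠ t → f v ∈ Z) (hMZ : ∀ x ∈ M, x ∉ Z)
    (hM : ∀ x ∈ M, ∃ v ∈ Z, A v x ∧ σ v < σ x) : M.card < k := by
  choose! z hz using hM
  have hrM : r ∉ M := fun hr => h.root _ (hz r hr).2.1
  let g : V → V := fun v => if v ∈ M then z v else f v
  refine lt_of_le_of_lt ?_ (h.card_treeLeaves_lt g σ fun v hv => ?_)
  -- With `M` hung from `Z`, the vertices of `M` and of `Z` without `t` have all their parents in
  -- `Z`, so `|Z|` vertices serve `|Z| - 1 + |M|` children. The root, which needs no parent, makes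
  -- up for `t`, and `|M|` leaves result.
  · have hsub : (Finset.univ.erase r).image g ⊆
        Z ∪ (((Finset.univ.erase r) \ (Z.erase t ∪ M)).image f) := by
      intro u hu
      obtain ⟨v, hv, rfl⟩ := Finset.mem_image.1 hu
      by_cases hvM : v ∈ M <;> simp only [g, hvM, if_true, if_false]
      · exact Finset.mem_union_left _ (hz v hvM).1
      · by_cases hvZ : v ∈ Z.erase t
        · exact Finset.mem_union_left _
            (hZ v (Finset.mem_of_mem_erase hvZ) (Finset.ne_of_mem_erase hvZ))
        · refine Finset.mem_union_right _ (Finset.mem_image_of_mem f ?_)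
          simp only [Finset.mem_sdiff, hv, Finset.mem_union, hvZ, hvM, or_self, not_false_eq_true,
            and_self]
    have hdisj : Disjoint (Z.erase t) M := Finset.disjoint_left.2 fun x hx hxM =>
      hMZ x hxM (Finset.mem_of_mem_erase hx)
    have hsub2 : Z.erase t ∪ M ⊆ Finset.univ.erase r := by
      intro x hx
      refine Finset.mem_erase.2 ⟨fun e => ?_, Finset.mem_univ _⟩
      rcases Finset.mem_union.1 hx with hx | hx
      · exact hrZ (e ▸ Finset.mem_of_mem_erase hx)
      · exact hrM (e ▸ hx)
    have h1 := (Finset.card_le_card hsub).trans (Finset.card_union_le _ _)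
    have h2 := Finset.card_image_le (s := (Finset.univ.erase r) \ (Z.erase t ∪ M)) (f := f)
    have h3 := Finset.card_sdiff_add_card_eq_card hsub2
    rw [Finset.card_union_of_disjoint hdisj] at h3
    have h4 := Finset.card_erase_add_one ht
    have h5 := Finset.card_erase_add_one (Finset.mem_univ r)
    have h6 := Finset.card_sdiff_add_card_eq_card
      (Finset.subset_univ ((Finset.univ.erase r).image g))
    unfold treeLeaves
    omega
  · by_cases hvM : v ∈ M <;> simp only [g, hvM, if_true, if_false]
    · exact ⟨(hz v hvM).2.1, .inr (hz v hvM).2.2⟩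
    · exact h.fwd v hv

end Layout

/-! ### The size of a reduced digraph -/

/-- A set of good vertices that are matched with their two in-neighbours if these are good. -/
structure Matched (A : V → V → Prop) (r : V) (σ : V → ℤ) (f b : V → V) (O : Finset V) : Prop where
  ne : ∀ v ∈ O, v ≠ r
  good : ∀ v ∈ O, Layout.Good A r σ f b v
  b_f : ∀ v ∈ O, f v ∈ O → b (f v) = v
  f_b : ∀ v ∈ O, b v ∈ O → f (b v) = v

namespace Matched

variable {O : Finset V}

-- A good head `x` has only the in-neighbours `f x` and `b x`, and matching inverts these maps: arcs
-- within `O` join consecutive vertices of a chain.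
omit [Fintype V] in
theorem adj (h : Matched A r σ f b O) {v x : V} (hv : v ∈ O) (hx : x ∈ O) (hA : A v x) :
    x = f v ∨ x = b v := by
  rcases ((h.good x hx).mem_in v).1 hA with rfl | rfl
  · exact .inr (h.b_f x hx hv).symm
  · exact .inl (h.f_b x hx hv).symm

/-- One step upwards along a chain. -/
def Step (f : V → V) (O : Finset V) (a c : V) : Prop := a ∈ O ∧ c ∈ O ∧ f c = a

/-- The chain of vertices that starts at `t`. -/
noncomputable def chain (f : V → V) (O : Finset V) (t : V) : Finset V :=
  {v ∈ O | Relation.ReflTransGen (Step f O) t v}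

omit [Fintype V] in
theorem mem_chain {t v : V} :
    v ∈ chain f O t ↔ v ∈ O ∧ Relation.ReflTransGen (Step f O) t v := Finset.mem_filter

theorem exists_chain (h : Matched A r σ f b O) (v : V) :
    v ∈ O → ∃ t ∈ {t ∈ O | f t ∉ O}, v ∈ chain f O t := by
  revert v
  refine rank_induction σ fun v ih hv => ?_
  by_cases hfv : f v ∈ O
  · obtain ⟨t, ht, hvt⟩ := ih _ (h.good v hv).f_lt hfv
    exact ⟨t, ht, mem_chain.2 ⟨hv, (mem_chain.1 hvt).2.tail ⟨hfv, hv, rfl⟩⟩⟩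
  · exact ⟨v, Finset.mem_filter.2 ⟨hv, hfv⟩, mem_chain.2 ⟨hv, .refl⟩⟩

omit [Fintype V] in
theorem le_of_chain (h : Matched A r σ f b O) {u v : V}
    (huv : Relation.ReflTransGen (Step f O) u v) : σ u ≤ σ v := by
  induction huv with
  | refl => rfl
  | tail _ h2 ih =>
    have := (h.good _ h2.2.1).f_lt
    rw [h2.2.2] at this
    exact ih.trans this.le

omit [Fintype V] in
theorem step_b (h : Matched A r σ f b O) {u v : V} (huv : Step f O u v) : b u = v := by
  obtain ⟨h1, h2, rfl⟩ := huv
  exact h.b_f v h2 h1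

omit [Fintype V] in
theorem chain_total (h : Matched A r σ f b O) {t u v : V} (hu : u ∈ chain f O t)
    (hv : v ∈ chain f O t) :
    Relation.ReflTransGen (Step f O) u v ∨ Relation.ReflTransGen (Step f O) v u :=
  Relation.ReflTransGen.total_of_right_unique
    (fun _ _ _ h1 h2 => (h.step_b h1).symm.trans (h.step_b h2)) (mem_chain.1 hu).2
    (mem_chain.1 hv).2

omit [Fintype V] in
theorem f_mem_chain {t v : V} (hv : v ∈ chain f O t) (hvt : v ≠ t) : f v ∈ chain f O t := by
  rcases Relation.ReflTransGen.cases_tail (mem_chain.1 hv).2 with e | ⟨c, h1, h2⟩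
  · exact absurd e hvt
  · exact mem_chain.2 ⟨h2.2.2 ▸ h2.1, h2.2.2 ▸ h1⟩

omit [Fintype V] in
theorem b_mem_chain (h : Matched A r σ f b O) {t v : V} (hv : v ∈ chain f O t) (hb : b v ∈ O) :
    b v ∈ chain f O t :=
  mem_chain.2 ⟨hb, (mem_chain.1 hv).2.tail
    ⟨(mem_chain.1 hv).1, hb, h.f_b v (mem_chain.1 hv).1 hb⟩⟩

omit [Fintype V] in
/-- At most two vertices of a chain are in-neighbours of a given vertex. -/
theorem card_in_chain_le (h : Matched A r σ f b O)
    (harc : ∀ y x, A y x → Reach A {z | A z x ∧ z ≠ y} r y) (hinj : Function.Injective σ)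
    (t x : V) : {v ∈ chain f O t | A v x}.card ≤ 2 := by
  by_contra hcon
  push Not at hcon
  set N := {v ∈ chain f O t | A v x} with hN
  have hne : N.Nonempty := Finset.card_pos.1 (by omega)
  obtain ⟨p, hp, hpmin⟩ := Finset.exists_min_image N σ hne
  obtain ⟨q, hq, hqmax⟩ := Finset.exists_max_image N σ hne
  obtain ⟨y, hy, hyp⟩ : ∃ y ∈ N, y ∉ ({p, q} : Finset V) := by
    by_contra hall
    push Not at hall
    have := Finset.card_le_card (show N ⊆ {p, q} from hall)
    have := Finset.card_le_two (a := p) (b := q)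
    omega
  simp only [Finset.mem_insert, Finset.mem_singleton, not_or] at hyp
  simp only [hN, Finset.mem_filter] at hp hq hy
  have hpy : σ p < σ y := lt_of_le_of_ne (hpmin y (by simp [hN, hy])) fun e => hyp.1 (hinj e).symm
  have hyq : σ y < σ q := lt_of_le_of_ne (hqmax y (by simp [hN, hy])) fun e => hyp.2 (hinj e)
  -- The chain vertices strictly between the lowest and the highest in-neighbours `p`, `q` of `x`
  -- can be entered only from one another, from `p` or from `q`. So a third in-neighbour `y` between
  -- them is unreachable once the other in-neighbours are avoided, against `harc`.
  have key := (harc y x hy.2).induct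
    (fun v => ¬ (v ∈ chain f O t ∧ σ p < σ v ∧ σ v < σ q))
    (fun hr => h.ne r (mem_chain.1 hr.1).1 rfl) ?_
  · exact key ⟨hy.1, hpy, hyq⟩
  rintro u v - hu huL hA ⟨hv, hpv, hvq⟩
  have hvO := (mem_chain.1 hv).1
  have hpL : u ≠ p := fun e => huL ⟨e ▸ hp.2, fun e' => hyp.1 (e'.symm.trans e)⟩
  have hqL : u ≠ q := fun e => huL ⟨e ▸ hq.2, fun e' => hyp.2 (e'.symm.trans e)⟩
  rcases ((h.good v hvO).mem_in u).1 hA with rfl | rfl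
  · rcases h.chain_total hp.1 hv with hh | hh
    · rcases Relation.ReflTransGen.cases_tail hh with e | ⟨c, h1, h2⟩
      · exact absurd hpv (by rw [e]; exact lt_irrefl _)
      · rw [← h2.2.2] at h1
        refine hu ⟨mem_chain.2 ⟨h2.2.2 ▸ h2.1, (mem_chain.1 hp.1).2.trans h1⟩,
          lt_of_le_of_ne (h.le_of_chain h1) fun e => hpL (hinj e).symm,
          (h.good v hvO).f_lt.trans hvq⟩
    · exact absurd (h.le_of_chain hh) (not_le.2 hpv)
  · rcases h.chain_total hq.1 hv with hh | hh
    · exact absurd (h.le_of_chain hh) (not_le.2 hvq)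
    · rcases Relation.ReflTransGen.cases_head hh with e | ⟨c, h1, h2⟩
      · exact absurd hvq (by rw [e]; exact lt_irrefl _)
      · have hbc := h.step_b h1
        rw [← hbc] at h1 h2
        exact hu ⟨mem_chain.2 ⟨h1.2.1, (mem_chain.1 hv).2.tail h1⟩,
          hpv.trans (h.good v hvO).lt_b,
          lt_of_le_of_ne (h.le_of_chain h2) fun e => hqL (hinj e)⟩

/-- Few vertices of a chain have out-neighbours other than their two in-neighbours. -/
theorem card_exits_le (h : Matched A r σ f b O) (hl : Layout A r k σ f b)
    (harc : ∀ y x, A y x → Reach A {z | A z x ∧ z ≠ y} r y) {t : V} (ht : t ∈ O) :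
    {v ∈ chain f O t | ∃ x, A v x ∧ x ≠ f v ∧ x ≠ b v}.card ≤ 4 * k := by
  set Z := chain f O t with hZ
  have htZ : t ∈ Z := mem_chain.2 ⟨ht, .refl⟩
  have hrZ : r ∉ Z := fun hr => h.ne r (mem_chain.1 hr).1 rfl
  let M₁ : Finset V := {x | ∃ v ∈ Z, (A v x ∧ σ v < σ x) ∧ x ≠ f v ∧ x ≠ b v}
  let M₂ : Finset V := {x | ∃ v ∈ Z, (A v x ∧ σ x < σ v) ∧ x ≠ f v ∧ x ≠ b v}
  have hM₁ : M₁.card < k := by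
    refine hl.card_targets_lt Z M₁ t htZ hrZ (fun v hv => f_mem_chain hv) (fun x hx hxZ => ?_)
      fun x hx => ?_
    · obtain ⟨v, hv, hA, h1, h2⟩ := (Finset.mem_filter.1 hx).2
      rcases h.adj (mem_chain.1 hv).1 (mem_chain.1 hxZ).1 hA.1 with e | e
      exacts [h1 e, h2 e]
    · obtain ⟨v, hv, hA, -⟩ := (Finset.mem_filter.1 hx).2
      exact ⟨v, hv, hA⟩
  -- For the reversed numbering the upper end of the chain takes the role of `t`. If `b` never
  -- leaves the chain, any vertex serves.
  obtain ⟨t', ht', htop⟩ : ∃ t' ∈ Z, ∀ v ∈ Z, v ≠ t' → b v ∈ Z := by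
    by_cases hall : ∀ v ∈ Z, b v ∈ Z
    · exact ⟨t, htZ, fun v hv _ => hall v hv⟩
    · push Not at hall
      obtain ⟨t', ht', hb⟩ := hall
      have hb' : b t' ∉ O := fun hb' => hb (h.b_mem_chain ht' hb')
      refine ⟨t', ht', fun v hv hvt => ?_⟩
      rcases h.chain_total hv ht' with hh | hh
      · rcases Relation.ReflTransGen.cases_head hh with e | ⟨c, h1, h2⟩
        · exact absurd e hvt
        · exact h.b_mem_chain hv ((h.step_b h1) ▸ h1.2.1)
      · rcases Relation.ReflTransGen.cases_head hh with e | ⟨c, h1, h2⟩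
        · exact absurd e.symm hvt
        · exact absurd ((h.step_b h1) ▸ h1.2.1) hb'
  have hM₂ : M₂.card < k := by
    refine hl.symm.card_targets_lt Z M₂ t' ht' hrZ htop (fun x hx hxZ => ?_) fun x hx => ?_
    · obtain ⟨v, hv, hA, h1, h2⟩ := (Finset.mem_filter.1 hx).2
      rcases h.adj (mem_chain.1 hv).1 (mem_chain.1 hxZ).1 hA.1 with e | e
      exacts [h1 e, h2 e]
    · obtain ⟨v, hv, hA, -⟩ := (Finset.mem_filter.1 hx).2
      exact ⟨v, hv, hA.1, neg_lt_neg hA.2⟩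
  have hsub : {v ∈ Z | ∃ x, A v x ∧ x ≠ f v ∧ x ≠ b v} ⊆
      (M₁ ∪ M₂).biUnion fun x => {v ∈ Z | A v x} := by
    intro v hv
    obtain ⟨hvZ, x, hA, h1, h2⟩ := Finset.mem_filter.1 hv
    refine Finset.mem_biUnion.2 ⟨x, ?_, Finset.mem_filter.2 ⟨hvZ, hA⟩⟩
    rcases lt_trichotomy (σ v) (σ x) with hlt | he | hlt
    · exact Finset.mem_union_left _ (Finset.mem_filter.2 ⟨Finset.mem_univ _, v, hvZ, ⟨hA, hlt⟩,
        h1, h2⟩)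
    · exact absurd (hl.inj he ▸ hA) (hl.loopless _)
    · exact Finset.mem_union_right _ (Finset.mem_filter.2 ⟨Finset.mem_univ _, v, hvZ, ⟨hA, hlt⟩,
        h1, h2⟩)
  -- At most `2 * k` targets, each entered from at most two vertices of the chain.
  refine (Finset.card_le_card hsub).trans ((Finset.card_biUnion_le_card_mul _ _ 2
    fun x _ => h.card_in_chain_le harc hl.inj t x).trans ?_)
  have := Finset.card_union_le M₁ M₂
  omega

end Matched

/-- Let `X` consist of the root, the bad and the unmatched vertices. Outside `X` the maps `f` and
`b` are injective, so at most `|X|` chains start and at most `|X|` end there. If `W` collects the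
ends and exits of all chains, any other vertex outside `X` is next to one in `W`; otherwise it and
its two neighbours would be the inner vertices of a forbidden bidirected path. -/
theorem Layout.card_le (h : Layout A r k σ f b)
    (harc : ∀ y x, A y x → Reach A {z | A z x ∧ z ≠ y} r y)
    (hbip : ∀ a x₁ x₂ x₃ c, ¬ IsBipath A a x₁ x₂ x₃ c) : Fintype.card V ≤ 2000 * k ^ 3 := by
  set K := Layout.bad A r σ f b with hK
  set S₁ := {v : V | v ≠ r ∧ Good A r σ f b v ∧ Good A r σ f b (f v) ∧ b (f v) ≠ v}.toFinset
    with hS₁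
  set S₂ := {v : V | v ≠ r ∧ Good A r (fun v => -σ v) b f v ∧ Good A r (fun v => -σ v) b f (b v) ∧
    f (b v) ≠ v}.toFinset with hS₂
  have hKc : K.card ≤ 13 * k := h.card_bad_le
  have hS₁c : S₁.card ≤ 44 * k * k := h.card_unmatched_le
  have hS₂c : S₂.card ≤ 44 * k * k := h.symm.card_unmatched_le
  set X := insert r (K ∪ (S₁ ∪ S₂)) with hX
  have hXc : X.card ≤ 1 + 13 * k + 88 * k * k := by
    have h1 := Finset.card_insert_le r (K ∪ (S₁ ∪ S₂))
    have h2 := Finset.card_union_le K (S₁ ∪ S₂)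
    have h3 := Finset.card_union_le S₁ S₂
    have h4 : 88 * k * k = 44 * k * k + 44 * k * k := by ring
    rw [hX]
    omega
  set O := Finset.univ \ X with hO
  have hOm : ∀ v ∈ O, v ≠ r ∧ Good A r σ f b v ∧ v ∉ S₁ ∧ v ∉ S₂ := by
    intro v hv
    simp only [hO, hX, Finset.mem_sdiff, Finset.mem_univ, true_and, Finset.mem_insert,
      Finset.mem_union, not_or, hK, Layout.mem_bad, not_and, not_not] at hv
    exact ⟨hv.1, hv.2.1 hv.1, hv.2.2⟩
  have hm : Matched A r σ f b O := by
    refine ⟨fun v hv => (hOm v hv).1, fun v hv => (hOm v hv).2.1, fun v hv hfv => ?_,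
      fun v hv hbv => ?_⟩
    · have := (hOm v hv).2.2.1
      by_contra hne
      exact this (by simp [hS₁, (hOm v hv).1, (hOm v hv).2.1, (hOm _ hfv).2.1, hne])
    · have := (hOm v hv).2.2.2
      by_contra hne
      exact this (by simp [hS₂, (hOm v hv).1, (hOm v hv).2.1.symm, (hOm _ hbv).2.1.symm, hne])
  have hfinj : Set.InjOn f ↑O := fun v hv w hw e =>
    (hOm w hw).2.1.f_only v (hOm v hv).1 e
  have hbinj : Set.InjOn b ↑O := fun v hv w hw e =>
    (hOm w hw).2.1.b_only v (hOm v hv).1 e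
  set T := {t ∈ O | f t ∉ O} with hT
  set T' := {t ∈ O | b t ∉ O} with hT'
  set E := {v ∈ O | ∃ x, A v x ∧ x ≠ f v ∧ x ≠ b v} with hE
  have hnO : ∀ v, v ∉ O → v ∈ X := fun v hv => by simpa [hO] using hv
  have hTc : T.card ≤ X.card := Finset.card_le_card_of_injOn f
    (fun v hv => hnO _ (Finset.mem_filter.1 hv).2)
    (hfinj.mono fun v hv => (Finset.mem_filter.1 hv).1)
  have hT'c : T'.card ≤ X.card := Finset.card_le_card_of_injOn b
    (fun v hv => hnO _ (Finset.mem_filter.1 hv).2)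
    (hbinj.mono fun v hv => (Finset.mem_filter.1 hv).1)
  have hEc : E.card ≤ X.card * (4 * k) := by
    have hsub : E ⊆ T.biUnion fun t =>
        {v ∈ Matched.chain f O t | ∃ x, A v x ∧ x ≠ f v ∧ x ≠ b v} := by
      intro v hv
      obtain ⟨hvO, hx⟩ := Finset.mem_filter.1 hv
      obtain ⟨t, ht, hvt⟩ := hm.exists_chain v hvO
      exact Finset.mem_biUnion.2 ⟨t, ht, Finset.mem_filter.2 ⟨hvt, hx⟩⟩
    exact (Finset.card_le_card hsub).trans ((Finset.card_biUnion_le_card_mul _ _ _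
      fun t ht => hm.card_exits_le h harc (Finset.mem_filter.1 ht).1).trans
      (Nat.mul_le_mul_right _ hTc))
  set W := T ∪ (T' ∪ E) with hW
  have hWc : W.card ≤ 2 * X.card + X.card * (4 * k) := by
    have h1 := Finset.card_union_le T (T' ∪ E)
    have h2 := Finset.card_union_le T' E
    rw [hW]
    omega
  have hI : ∀ v ∈ O, v ∉ W → f v ∈ O ∧ b v ∈ O ∧ ∀ w, A v w ↔ w = f v ∨ w = b v := by
    intro v hv hvW
    simp only [hW, hT, hT', hE, Finset.mem_union, Finset.mem_filter, hv, true_and, not_or,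
      not_not, not_exists, not_and] at hvW
    obtain ⟨h1, h2, h3⟩ := hvW
    refine ⟨h1, h2, fun w => ⟨fun hA => ?_, ?_⟩⟩
    · by_contra hne
      push Not at hne
      exact hne.2 (h3 w hA hne.1)
    · rintro (rfl | rfl)
      · exact ((hOm _ h1).2.1.mem_in v).2 (.inr (hm.b_f v hv h1).symm)
      · exact ((hOm _ h2).2.1.mem_in v).2 (.inl (hm.f_b v hv h2).symm)
  have hIsub : O \ W ⊆ {v ∈ O | f v ∈ W} ∪ {v ∈ O | b v ∈ W} := by
    intro v hv
    obtain ⟨hvO, hvW⟩ := Finset.mem_sdiff.1 hv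
    obtain ⟨hf, hb, hout⟩ := hI v hvO hvW
    by_contra hcon
    simp only [Finset.mem_union, Finset.mem_filter, hvO, true_and, not_or] at hcon
    obtain ⟨hff, hfb, hfout⟩ := hI _ hf hcon.1
    obtain ⟨hbf, hbb, hbout⟩ := hI _ hb hcon.2
    have e1 := hm.b_f v hvO hf
    have e2 := hm.f_b v hvO hb
    have g1 := (hOm _ hf).2.1
    have g2 := (hOm _ hvO).2.1
    have g3 := (hOm _ hb).2.1
    have l1 := g1.f_lt
    have l2 := g2.f_lt
    have l3 := g2.lt_b
    have l4 := g3.lt_b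
    have hne : ∀ {u w : V}, σ u < σ w → u ≠ w := fun hlt e => by
      rw [e] at hlt; exact lt_irrefl _ hlt
    refine hbip (f (f v)) (f v) v (b v) (b (b v)) ⟨?_, ?_, g2.mem_in, hout, ?_, ?_, hne l2,
      hne (l2.trans l3), hne l3, hne l1, hne (l1.trans l2), (hne (l3.trans l4)).symm,
      (hne l4).symm⟩
    · intro w; rw [g1.mem_in, e1]
    · intro w; rw [hfout, e1]
    · intro w; rw [g3.mem_in, e2, or_comm]
    · intro w; rw [hbout, e2, or_comm]
  have hIc : (O \ W).card ≤ 2 * W.card := by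
    have h1 := (Finset.card_le_card hIsub).trans (Finset.card_union_le _ _)
    have h2 : {v ∈ O | f v ∈ W}.card ≤ W.card := Finset.card_le_card_of_injOn f
      (fun v hv => (Finset.mem_filter.1 hv).2)
      (hfinj.mono fun v hv => (Finset.mem_filter.1 hv).1)
    have h3 : {v ∈ O | b v ∈ W}.card ≤ W.card := Finset.card_le_card_of_injOn b
      (fun v hv => (Finset.mem_filter.1 hv).2)
      (hbinj.mono fun v hv => (Finset.mem_filter.1 hv).1)
    omega
  have hWO : W ⊆ O := by
    refine Finset.union_subset (Finset.filter_subset _ _) (Finset.union_subset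
      (Finset.filter_subset _ _) (Finset.filter_subset _ _))
  have c1 := Finset.card_sdiff_add_card_eq_card hWO
  have c2 := Finset.card_sdiff_add_card_eq_card (Finset.subset_univ X)
  rw [Finset.card_univ, ← hO] at c2
  have hk := h.k_pos
  -- `102 = 1 + 13 + 88`, by `1 ≤ k`. The vertices are `X`, `W` and at most `2 * |W|` others, whence
  -- the factor `1 + 3 * (2 + 4 * k) = 7 + 12 * k`.
  have hX' : X.card ≤ 102 * (k * k) := by nlinarith
  have hV : Fintype.card V ≤ X.card * (7 + 12 * k) := by
    have : X.card * (7 + 12 * k) = X.card * 7 + 3 * (X.card * (4 * k)) := by ring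
    omega
  calc Fintype.card V ≤ X.card * (7 + 12 * k) := hV
    _ ≤ (102 * (k * k)) * (19 * k) := Nat.mul_le_mul hX' (by omega)
    _ ≤ 2000 * k ^ 3 := by nlinarith [Nat.zero_le (k ^ 3)]

/-- A reduced digraph that has no out-tree with root `r` and `k` leaves has `O(k³)` vertices. -/
theorem card_le_of_reduced (hloop : ∀ v, ¬ A v v) (hroot : ∀ v, ¬ A v r)
    (hreach : ∀ v, Reach A ∅ r v) (hcut : ∀ x ≠ r, ∀ v ≠ x, Reach A {x} r v)
    (harc : ∀ y x, A y x → Reach A {z | A z x ∧ z ≠ y} r y)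
    (hbip : ∀ a x₁ x₂ x₃ c, ¬ IsBipath A a x₁ x₂ x₃ c) (hno : ¬ HasLeaves A r k) :
    Fintype.card V ≤ 2000 * k ^ 3 := by
  obtain ⟨σ, hinj, hσ⟩ := exists_numbering hreach hcut
  have hf : ∀ v, v ≠ r → ∃ u, A u v ∧ (u = r ∨ σ u < σ v) := fun v hv =>
    (hσ v hv).elim (fun h => ⟨r, h, .inl rfl⟩) fun ⟨⟨u, _, h1, h2⟩, _⟩ => ⟨u, h1, .inr h2⟩
  have hb : ∀ v, v ≠ r → ∃ u, A u v ∧ (u = r ∨ σ v < σ u) := fun v hv =>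
    (hσ v hv).elim (fun h => ⟨r, h, .inl rfl⟩) fun ⟨_, ⟨u, _, h1, h2⟩⟩ => ⟨u, h1, .inr h2⟩
  choose! f hf using hf
  choose! b hb using hb
  have h : Layout A r k σ f b := by
    refine ⟨fun L hL => ?_, hloop, hroot, fun u v hrv huv => ?_, hinj, hf, hb⟩
    · by_contra hk
      exact hno ⟨L, not_lt.1 hk, fun v _ => hreach v, fun v _ => hL v⟩
    -- If `r` and `u` both have arcs to `v`, then `r` is among the vertices to be avoided on the way
    -- to `u`. The walk cannot leave `r`, so the arc from `u` would be avoidable.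
    · by_contra hur
      refine (harc u v huv).induct (· = r) rfl (fun a c _ ha haL _ => ?_) |> hur
      exact absurd ⟨ha ▸ hrv, ha ▸ (Ne.symm hur)⟩ haL
  exact h.card_le harc hbip

end Bound

end LeafKernel

namespace LeafKernel

/-! ### Out-trees and leaf sets -/

section Semantics

variable {V : Type} [Finite V] {D : Digraph V}

omit [Finite V] in
theorem Subdigraph.adj_coe {T : Subdigraph D} {a b : T.verts} :
    T.coe.toSimpleGraphInclusive.Adj a b ↔ a ≠ b ∧ (T.Adj a b ∨ T.Adj b a) := Iff.rfl

theorem card_ne_add_one {W : Type} [Finite W] (r : W) :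
    Nat.card {v : W // v ≠ r} + 1 = Nat.card W := by
  classical
  have := Fintype.ofFinite W
  rw [Nat.card_eq_fintype_card, Nat.card_eq_fintype_card, Fintype.card_subtype_compl,
    Fintype.card_subtype_eq]
  have : 0 < Fintype.card W := Fintype.card_pos_iff.2 ⟨r⟩
  omega

omit [Finite V] in
theorem Subdigraph.IsOutTree.root_mem {T : Subdigraph D} {r : V} (h : T.IsOutTree r) :
    r ∈ T.verts := ((h.2 r).2 rfl).1

/-- In an out-tree every vertex has at most one in-neighbour. -/
theorem Subdigraph.IsOutTree.unique_parent {T : Subdigraph D} {r : V} (h : T.IsOutTree r)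
    {u u' v : V} (hu : T.Adj u v) (hu' : T.Adj u' v) : u = u' := by
  obtain ⟨⟨hanti, htree⟩, hroot⟩ := h
  have hpar : ∀ v : {v : T.verts // v ≠ ⟨r, ((hroot r).2 rfl).1⟩}, ∃ u : T.verts, T.Adj u v := by
    rintro ⟨v, hv⟩
    by_contra hcon
    push Not at hcon
    refine hv (Subtype.ext ((hroot v).1 ⟨v.2, fun u hu => hcon ⟨u, T.tail_mem hu⟩ hu⟩))
  choose p hp using hpar
  have hloop : ∀ {a b : V}, T.Adj a b → a ≠ b := fun hab e => hanti _ _ hab (e ▸ e ▸ hab)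
  -- A chosen parent gives every vertex but the root its own edge. A tree has exactly that many
  -- edges, so every arc comes from a chosen parent.
  let φ : {v : T.verts // v ≠ ⟨r, ((hroot r).2 rfl).1⟩} → T.coe.toSimpleGraphInclusive.edgeSet :=
    fun v => ⟨s(p v, v.1), (SimpleGraph.mem_edgeSet _).2
      (Subdigraph.adj_coe.2 ⟨fun e => hloop (hp v) (congrArg Subtype.val e), .inl (hp v)⟩)⟩
  have hinj : Function.Injective φ := by
    intro v w e
    have e' : s(p v, v.1) = s(p w, w.1) := congrArg Subtype.val e
    rcases Sym2.eq_iff.1 e' with ⟨-, h2⟩ | ⟨h1, h2⟩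
    · exact Subtype.ext h2
    · refine absurd (hp w) (hanti _ _ ?_)
      have := hp v
      rwa [h1, h2] at this
  have hcard := (SimpleGraph.isTree_iff_connected_and_card.1 htree).2
  have hsurj := (hinj.bijective_of_nat_card_le (by
    have := card_ne_add_one (W := ↥T.verts) ⟨r, ((hroot r).2 rfl).1⟩
    omega)).2
  have key : ∀ u, (hu : T.Adj u v) → ∃ w, w.1.1 = v ∧ (p w).1 = u := by
    intro u hu
    obtain ⟨w, hw⟩ := hsurj ⟨s(⟨u, T.tail_mem hu⟩, ⟨v, T.head_mem hu⟩),
      (SimpleGraph.mem_edgeSet _).2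
      (Subdigraph.adj_coe.2 ⟨fun e => hloop hu (congrArg Subtype.val e), .inl hu⟩)⟩
    have e' : s(p w, w.1) = s(⟨u, T.tail_mem hu⟩, ⟨v, T.head_mem hu⟩) := congrArg Subtype.val hw
    rcases Sym2.eq_iff.1 e' with ⟨h1, h2⟩ | ⟨h1, h2⟩
    · exact ⟨w, congrArg Subtype.val h2, congrArg Subtype.val h1⟩
    · refine absurd (hp w) (hanti _ _ ?_)
      rw [h1, h2]
      exact hu
  obtain ⟨w, hw, rfl⟩ := key u hu
  obtain ⟨w', hw', rfl⟩ := key u' hu'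
  rw [Subtype.ext (Subtype.ext (hw.trans hw'.symm))]

/-- Follow an undirected path from the root. A step against an arc leads to the parent, which by
uniqueness is the previous vertex of the directed path built so far. -/
theorem Subdigraph.IsOutTree.reach {T : Subdigraph D} {r : V} (h : T.IsOutTree r) {v : V}
    (hv : v ∈ T.verts) : Relation.ReflTransGen T.Adj r v := by
  have h1 := h.1.2.connected.preconnected ⟨r, h.root_mem⟩ ⟨v, hv⟩
  rw [SimpleGraph.reachable_iff_reflTransGen] at h1
  have key : ∀ w : T.verts, Relation.ReflTransGen T.coe.toSimpleGraphInclusive.Adj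
      ⟨r, h.root_mem⟩ w → Relation.ReflTransGen T.Adj r w := by
    intro w hw
    induction hw with
    | refl => exact .refl
    | tail _ hab ih =>
      rcases (Subdigraph.adj_coe.1 hab).2 with hab | hba
      · exact ih.tail hab
      · rcases Relation.ReflTransGen.cases_tail ih with e | ⟨c, hc, hca⟩
        · exact absurd hba (((h.2 _).2 e).2 _)
        · exact h.unique_parent hca hba ▸ hc
  exact key ⟨v, hv⟩ h1

/-- An out-tree extends to one on all vertices that can be reached, without losing leaves. -/
theorem hasLeaves_of_partial {A : V → V → Prop} {r : V} {k : ℕ} (W : Finset V) (L : Finset V)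
    (hLW : L ⊆ W) (hr : r ∈ W) (hW : ∀ w ∈ W, Reach A (↑L ∪ (↑W)ᶜ) r w) (hk : k ≤ L.card) :
    HasLeaves A r k := by
  classical
  have := Fintype.ofFinite V
  induction hn : Fintype.card V - W.card using Nat.strong_induction_on generalizing W L with
  | _ n ih =>
  by_cases hclosed : ∀ w ∈ W, ∀ x, A w x → x ∈ W
  · refine ⟨L, hk, fun v hv => (hW v (hLW hv)).mono (Set.empty_subset _) fun _ _ h => h,
      fun v hv => ?_⟩
    refine (hW v ?_).mono Set.subset_union_left fun _ _ h => h
    exact Reach.induct (· ∈ W) hv hr fun a b _ ha _ hab => hclosed a ha b hab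
  · push Not at hclosed
    obtain ⟨w, hw, x, hwx, hx⟩ := hclosed
    have hxL : x ∉ L := fun h => hx (hLW h)
    have hwx' : w ≠ x := fun e => hx (e ▸ hw)
    have hsub : (↑(insert x (L.erase w)) ∪ (↑(insert x W))ᶜ : Set V) ⊆ ↑L ∪ (↑W)ᶜ := by
      intro y hy
      simp only [Finset.coe_insert, Finset.coe_erase, Set.mem_union, Set.mem_insert_iff,
        Set.mem_sdiff, Finset.mem_coe, Set.mem_singleton_iff, Set.mem_compl_iff, not_or] at hy ⊢
      rcases hy with (rfl | hy) | hy
      exacts [.inr hx, .inl hy.1, .inr hy.2]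
    -- Hanging a new vertex `x` below `w` costs at most the leaf `w` and gains the leaf `x`.
    refine ih _ ?_ (insert x W) (insert x (L.erase w)) ?_ (by simp [hr]) (fun y hy => ?_) ?_ rfl
    · rw [Finset.card_insert_of_notMem hx]
      have := Finset.card_lt_univ_of_notMem hx
      omega
    · exact Finset.insert_subset_insert _ ((Finset.erase_subset _ _).trans hLW)
    · rcases Finset.mem_insert.1 hy with rfl | hy
      · refine ((hW w hw).mono hsub fun _ _ h => h).tail ?_ hwx
        simp [hw, hwx']
      · exact (hW y hy).mono hsub fun _ _ h => h
    · rw [Finset.card_insert_of_notMem fun h => hxL (Finset.mem_of_mem_erase h)]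
      have := Finset.pred_card_le_card_erase (s := L) (a := w)
      omega

theorem hasLeaves_of_outTree {T : Subdigraph D} {r : V} (h : T.IsOutTree r) {k : ℕ}
    (hk : k ≤ T.leaves.ncard) : HasLeaves D.Adj r k := by
  classical
  have := Fintype.ofFinite V
  refine hasLeaves_of_partial T.verts.toFinset T.leaves.toFinset ?_ (by simpa using h.root_mem)
    (fun w hw => ?_) (by rwa [← Set.ncard_eq_toFinset_card'])
  · intro v hv
    simp only [Set.mem_toFinset] at hv ⊢
    exact hv.1
  · have h1 := h.reach (Set.mem_toFinset.1 hw)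
    clear hw
    induction h1 with
    | refl => exact .refl
    | tail _ hab ih =>
      refine ih.tail ?_ (T.adj_sub hab)
      simp only [Set.coe_toFinset, Set.mem_union, Set.mem_compl_iff, not_or, not_not]
      exact ⟨fun hl => hl.2 _ hab, T.tail_mem hab⟩

/-- The vertices reached in at most `n` steps. -/
def ReachIn (A : V → V → Prop) (L : Set V) (r : V) : ℕ → V → Prop
  | 0, v => v = r
  | n + 1, v => ReachIn A L r n v ∨ ∃ u, ReachIn A L r n u ∧ u ∉ L ∧ A u v

-- `d` is the breadth-first distance and `p v` a predecessor of `v` on a shortest walk; the decrease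
-- of `d` excludes cycles of parents.
omit [Finite V] in
theorem Reach.exists_parent (A : V → V → Prop) (L : Set V) (r : V) : ∃ (p : V → V) (d : V → ℕ),
    ∀ v, Reach A L r v → v ≠ r → Reach A L r (p v) ∧ p v ∉ L ∧ A (p v) v ∧ d (p v) < d v := by
  classical
  have h1 : ∀ v, Reach A L r v → ∃ n, ReachIn A L r n v := fun v hv =>
    hv.induct (fun v => ∃ n, ReachIn A L r n v) ⟨0, rfl⟩ fun a _ _ ⟨n, hn⟩ haL hab =>
      ⟨n + 1, .inr ⟨a, hn, haL, hab⟩⟩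
  have h2 : ∀ n v, ReachIn A L r n v → Reach A L r v := by
    intro n
    induction n with
    | zero => rintro v rfl; exact .refl
    | succ n ih =>
      rintro v (h | ⟨u, hu, huL, huv⟩)
      exacts [ih v h, (ih u hu).tail huL huv]
  let d : V → ℕ := fun v => if h : ∃ n, ReachIn A L r n v then Nat.find h else 0
  have hd : ∀ v n, ReachIn A L r n v → d v ≤ n ∧ ReachIn A L r (d v) v := by
    intro v n hn
    have hex : ∃ n, ReachIn A L r n v := ⟨n, hn⟩
    simp only [d, hex, dif_pos]
    exact ⟨Nat.find_min' hex hn, Nat.find_spec hex⟩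
  have key : ∀ v, Reach A L r v → v ≠ r → ∃ u, Reach A L r u ∧ u ∉ L ∧ A u v ∧ d u < d v := by
    intro v hv hvr
    obtain ⟨n, hn⟩ := h1 v hv
    have hdv := (hd v n hn).2
    cases hm : d v with
    | zero => rw [hm] at hdv; exact absurd hdv hvr
    | succ m =>
      rw [hm] at hdv
      rcases hdv with h | ⟨u, hu, huL, huv⟩
      · have := (hd v m h).1; omega
      · exact ⟨u, h2 m u hu, huL, huv, Nat.lt_succ_of_le (hd u m hu).1⟩
  choose! p hp using key
  exact ⟨p, d, hp⟩

/-- Breadth-first parents on walks avoiding `L` never lie in `L`, so all of `L` become leaves. The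
graph is connected through the root and has at most one edge per non-root vertex, hence is a tree.
-/
theorem exists_outTree_of_hasLeaves {r : V} {k : ℕ} (h : HasLeaves D.Adj r k) :
    ∃ T : Subdigraph D, T.IsOutTree r ∧ k ≤ T.leaves.ncard ∧ T.verts = {v | Reach D.Adj ∅ r v} := by
  obtain ⟨L, hk, hL, hgood⟩ := h
  obtain ⟨p, d, hp⟩ := Reach.exists_parent D.Adj ↑L r
  have hp' : ∀ v, Reach D.Adj ∅ r v → v ≠ r →
      Reach D.Adj ∅ r (p v) ∧ p v ∉ L ∧ D.Adj (p v) v ∧ d (p v) < d v := fun v hv hvr => by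
    obtain ⟨h1, h2, h3⟩ := hp v (hgood v hv) hvr
    exact ⟨h1.mono (by simp) fun _ _ h => h, by simpa using h2, h3⟩
  let T : Subdigraph D :=
    { verts := {v | Reach D.Adj ∅ r v}
      Adj := fun u v => Reach D.Adj ∅ r v ∧ v ≠ r ∧ u = p v
      adj_sub := fun h => h.2.2 ▸ (hp' _ h.1 h.2.1).2.2.1
      tail_mem := fun h => h.2.2 ▸ (hp' _ h.1 h.2.1).1
      head_mem := fun h => h.1 }
  have hlt : ∀ {u v : V}, T.Adj u v → d u < d v := fun h => h.2.2 ▸ (hp' _ h.1 h.2.1).2.2.2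
  have hrT : r ∈ T.verts := Reach.refl
  have hconn : T.coe.toSimpleGraphInclusive.Connected := by
    have key : ∀ n, ∀ v : T.verts, d v = n →
        T.coe.toSimpleGraphInclusive.Reachable v ⟨r, hrT⟩ := by
      intro n
      induction n using Nat.strong_induction_on with
      | _ n ih =>
        intro v hv
        by_cases hvr : v = ⟨r, hrT⟩
        · exact hvr ▸ .refl _
        · have hadj : T.Adj (p v) v := ⟨v.2, fun e => hvr (Subtype.ext e), rfl⟩
          refine SimpleGraph.Reachable.trans (SimpleGraph.Adj.reachable ?_)
            (ih _ (hv ▸ hlt hadj) ⟨p v, T.tail_mem hadj⟩ rfl)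
          refine Subdigraph.adj_coe.2 ⟨fun e => ?_, .inr hadj⟩
          have h1 := hlt hadj
          have h2 : (v : V) = p v := congrArg Subtype.val e
          rw [← h2] at h1
          exact lt_irrefl _ h1
    have : Nonempty T.verts := ⟨⟨r, hrT⟩⟩
    exact ⟨fun u v => (key _ u rfl).trans (key _ v rfl).symm⟩
  have htree : T.coe.toSimpleGraphInclusive.IsTree := by
    refine SimpleGraph.isTree_iff_connected_and_card.2 ⟨hconn, ?_⟩
    have h1 := hconn.card_vert_le_card_edgeSet_add_one
    have h2 := card_ne_add_one (W := ↥T.verts) ⟨r, hrT⟩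
    have hadj : ∀ v : {v : T.verts // v ≠ ⟨r, hrT⟩}, T.Adj (p v) v := fun v =>
      ⟨v.1.2, fun e => v.2 (Subtype.ext e), rfl⟩
    have h3 : Nat.card T.coe.toSimpleGraphInclusive.edgeSet ≤
        Nat.card {v : T.verts // v ≠ ⟨r, hrT⟩} := by
      refine Nat.card_le_card_of_surjective (fun v => ⟨s(⟨p v, T.tail_mem (hadj v)⟩, v.1),
        (SimpleGraph.mem_edgeSet _).2 (Subdigraph.adj_coe.2 ⟨fun e => ?_, .inl (hadj v)⟩)⟩) ?_
      · have h4 := hlt (hadj v)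
        have h5 : p v = (v.1 : V) := congrArg Subtype.val e
        rw [h5] at h4
        exact lt_irrefl _ h4
      · rintro ⟨e, he⟩
        induction e using Sym2.ind with
        | _ a b =>
          have hab := (Subdigraph.adj_coe.1 ((SimpleGraph.mem_edgeSet _).1 he)).2
          rcases hab with hab | hba
          · refine ⟨⟨b, fun e => hab.2.1 (congrArg Subtype.val e)⟩, Subtype.ext ?_⟩
            exact Sym2.eq_iff.2 (.inl ⟨Subtype.ext hab.2.2.symm, rfl⟩)
          · refine ⟨⟨a, fun e => hba.2.1 (congrArg Subtype.val e)⟩, Subtype.ext ?_⟩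
            exact Sym2.eq_iff.2 (.inr ⟨Subtype.ext hba.2.2.symm, rfl⟩)
    omega
  refine ⟨T, ⟨⟨fun u v huv hvu => ?_, htree⟩, fun v => ⟨fun hv => ?_, ?_⟩⟩, ?_, rfl⟩
  · exact lt_asymm (hlt huv) (hlt hvu)
  · by_contra hvr
    exact hv.2 (p v) ⟨hv.1, hvr, rfl⟩
  · rintro rfl
    exact ⟨hrT, fun u hu => hu.2.1 rfl⟩
  · rw [← Set.ncard_coe_finset] at hk
    refine hk.trans (Set.ncard_le_ncard (fun v hv => ⟨hL v hv, fun w hw => ?_⟩) (Set.toFinite _))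
    exact (hp' w hw.1 hw.2.1).2.1 (hw.2.2 ▸ hv)

end Semantics

/-! ### The rooted problems in terms of leaf sets -/

theorem RootedInstance.outTree_iff (J : RootedInstance) :
    J.OutTree ↔ HasLeaves J.graph.Adj J.root J.k := by
  constructor
  · rintro ⟨T, h, hk⟩
    exact hasLeaves_of_outTree h hk
  · intro h
    obtain ⟨T, h, hk, -⟩ := exists_outTree_of_hasLeaves h
    exact ⟨T, h, hk⟩

theorem RootedInstance.outBranching_iff (J : RootedInstance) :
    J.OutBranching ↔ (∀ v, Reach J.graph.Adj ∅ J.root v) ∧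
      HasLeaves J.graph.Adj J.root J.k := by
  constructor
  · rintro ⟨T, h, hk⟩
    refine ⟨fun v => ?_, hasLeaves_of_outTree h.1 hk⟩
    have h1 := h.1.reach (v := v) (h.2 ▸ Set.mem_univ v)
    exact Relation.ReflTransGen.mono (fun _ _ h => ⟨by simp, T.adj_sub h⟩) _ _ h1
  · rintro ⟨hall, h⟩
    obtain ⟨T, h, hk, hv⟩ := exists_outTree_of_hasLeaves h
    exact ⟨T, ⟨h, by rw [hv]; exact Set.eq_univ_of_forall hall⟩, hk⟩

end LeafKernel

namespace LeafKernel

/-! ### The reduction algorithm on lists -/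

/-- The test whether `v` occurs in a list. -/
def hasVertex (l : List ℕ) (v : ℕ) : Bool := l.any fun w => w == v

/-- The test whether `(u, v)` occurs in a list of arcs. -/
def hasArc (E : List (ℕ × ℕ)) (u v : ℕ) : Bool := E.any fun e => e.1 == u && e.2 == v

@[simp]
theorem hasVertex_eq_true {l : List ℕ} {v : ℕ} : hasVertex l v = true ↔ v ∈ l := by
  simp [hasVertex]

@[simp]
theorem hasArc_eq_true {E : List (ℕ × ℕ)} {u v : ℕ} : hasArc E u v = true ↔ (u, v) ∈ E := by
  simp only [hasArc, List.any_eq_true, Bool.and_eq_true, beq_iff_eq, Prod.exists]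
  constructor
  · rintro ⟨a, b, h, rfl, rfl⟩; exact h
  · intro h; exact ⟨u, v, h, rfl, rfl⟩

/-- The adjacency relation of a list of arcs. -/
def arcRel (E : List (ℕ × ℕ)) (u v : ℕ) : Prop := (u, v) ∈ E

/-- One round of the search from the vertices in `R`, avoiding `L`. -/
def reachStep (V : List ℕ) (E : List (ℕ × ℕ)) (L R : List ℕ) : List ℕ :=
  V.filter fun v => hasVertex R v ||
    E.any fun e => e.2 == v && (hasVertex R e.1 && !hasVertex L e.1)

/-- The list of vertices that can be reached from `r` avoiding `L`. -/
def reachList (V : List ℕ) (E : List (ℕ × ℕ)) (r : ℕ) (L : List ℕ) : List ℕ :=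
  (reachStep V E L)^[V.length] (V.filter fun v => v == r)

theorem sublist_filter_filter {α : Type} {p q : α → Bool} {l : List α}
    (h : ∀ a ∈ l, p a = true → q a = true) : List.Sublist (l.filter p) (l.filter q) := by
  induction l with
  | nil => exact List.Sublist.refl _
  | cons a l ih =>
    have ih := ih fun b hb => h b (List.mem_cons_of_mem _ hb)
    by_cases hp : p a = true
    · rw [List.filter_cons_of_pos hp, List.filter_cons_of_pos (h a List.mem_cons_self hp)]
      exact ih.cons_cons a
    · rw [List.filter_cons_of_neg hp]
      refine ih.trans ((List.sublist_cons_self a l).filter q)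

/-- A potential that drops with every proper step bounds the number of such steps. It serves both
the search and the exhaustive reduction. -/
theorem iterate_fixed {α : Type} (s : α → α) (μ : α → ℕ) (x : α)
    (h : ∀ i, s (s^[i] x) ≠ s^[i] x → μ (s (s^[i] x)) < μ (s^[i] x)) {n : ℕ} (hn : μ x ≤ n) :
    s (s^[n] x) = s^[n] x := by
  have key : ∀ i, s (s^[i] x) = s^[i] x ∨ μ (s^[i] x) + i ≤ μ x := by
    intro i
    induction i with
    | zero => exact .inr le_rfl
    | succ i ih =>
      rw [Function.iterate_succ_apply']
      by_cases hfix : s (s^[i] x) = s^[i] x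
      · exact .inl (by rw [hfix, hfix])
      · have := h i hfix
        have := ih.resolve_left hfix
        exact .inr (by omega)
  by_contra hfix
  have := h n hfix
  have := (key n).resolve_left hfix
  omega

theorem mem_reachStep {V : List ℕ} {E : List (ℕ × ℕ)} {L R : List ℕ} {v : ℕ} :
    v ∈ reachStep V E L R ↔ v ∈ V ∧ (v ∈ R ∨ ∃ u, (u, v) ∈ E ∧ u ∈ R ∧ u ∉ L) := by
  simp only [reachStep, List.mem_filter, Bool.or_eq_true, hasVertex_eq_true, List.any_eq_true,
    Bool.and_eq_true, beq_iff_eq, Bool.not_eq_true', Prod.exists]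
  refine and_congr_right fun _ => or_congr_right ?_
  constructor
  · rintro ⟨u, w, h, rfl, hu, huL⟩
    exact ⟨u, h, hu, fun hm => by rw [hasVertex_eq_true.2 hm] at huL; exact absurd huL (by simp)⟩
  · rintro ⟨u, h, hu, huL⟩
    exact ⟨u, v, h, rfl, hu, by
      rw [← Bool.not_eq_true, hasVertex_eq_true]; exact huL⟩

/-- Every round returns a filtered copy of `V`; this yields the termination measure, the absence of
duplicates and the size bounds of the search. -/
theorem exists_filter_reachStep_iterate (V : List ℕ) (E : List (ℕ × ℕ)) (r : ℕ) (L : List ℕ)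
    (n : ℕ) : ∃ p : ℕ → Bool, (reachStep V E L)^[n] (V.filter fun v => v == r) = V.filter p := by
  cases n with
  | zero => exact ⟨_, rfl⟩
  | succ n => rw [Function.iterate_succ_apply']; exact ⟨_, rfl⟩

theorem mem_reachList {V : List ℕ} {E : List (ℕ × ℕ)} {r : ℕ} {L : List ℕ} (hr : r ∈ V)
    (hE : ∀ u v, (u, v) ∈ E → v ∈ V) {v : ℕ} :
    v ∈ reachList V E r L ↔ Reach (arcRel E) {z | z ∈ L} r v := by
  constructor
  · have key : ∀ n v, v ∈ (reachStep V E L)^[n] (V.filter fun v => v == r) →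
        Reach (arcRel E) {z | z ∈ L} r v := by
      intro n
      induction n with
      | zero =>
        intro v hv
        simp only [Function.iterate_zero, id_eq, List.mem_filter, beq_iff_eq] at hv
        exact hv.2 ▸ .refl
      | succ n ih =>
        intro v hv
        rw [Function.iterate_succ_apply', mem_reachStep] at hv
        rcases hv.2 with hv | ⟨u, huv, hu, huL⟩
        exacts [ih v hv, (ih u hu).tail huL huv]
    exact key _ v
  · have hfix : reachStep V E L (reachList V E r L) = reachList V E r L := by
      refine iterate_fixed (reachStep V E L) (fun R => V.length - R.length) _ (fun i hi => ?_)
        (Nat.sub_le _ _)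
      obtain ⟨p, hp⟩ := exists_filter_reachStep_iterate V E r L i
      rw [hp] at hi ⊢
      have hsub : List.Sublist (V.filter p) (reachStep V E L (V.filter p)) := by
        refine sublist_filter_filter fun v hv hpv => ?_
        simp [hv, hpv]
      have h1 := hsub.length_le
      have h2 : (reachStep V E L (V.filter p)).length ≤ V.length :=
        List.length_filter_le _ _
      have h3 : (V.filter p).length ≠ (reachStep V E L (V.filter p)).length := fun e =>
        hi (hsub.eq_of_length e).symm
      omega
    intro h
    have hr' : r ∈ reachList V E r L := by
      have : ∀ n, r ∈ (reachStep V E L)^[n] (V.filter fun v => v == r) := by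
        intro n
        induction n with
        | zero => simp [hr]
        | succ n ih =>
          rw [Function.iterate_succ_apply', mem_reachStep]
          exact ⟨hr, .inl ih⟩
      exact this _
    refine h.induct (· ∈ reachList V E r L) hr' fun a b _ ha haL hab => ?_
    rw [← hfix, mem_reachStep]
    exact ⟨hE a b hab, .inr ⟨a, hab, ha, haL⟩⟩

/-- The test whether the removal of `x` cuts off another vertex. -/
def isCut (V : List ℕ) (E : List (ℕ × ℕ)) (r x : ℕ) : Bool :=
  !(x == r) && V.any fun v => !(v == x) && !hasVertex (reachList V E r [x]) v

/-- The test whether the in-neighbours and the out-neighbours of `x` are `p` and `q`. -/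
def nbrsAre (V : List ℕ) (E : List (ℕ × ℕ)) (x p q : ℕ) : Bool :=
  V.all fun w => (hasArc E w x == (w == p || w == q)) && (hasArc E x w == (w == p || w == q))

/-- The test whether `p`, `x`, `q` are the inner vertices of a bidirected path with ends `a`
and `c`. -/
def isBipathList (V : List ℕ) (E : List (ℕ × ℕ)) (x a p q c : ℕ) : Bool :=
  (nbrsAre V E p a x && (nbrsAre V E x p q && nbrsAre V E q c x)) &&
    (!(p == x) && (!(p == q) && (!(x == q) && (!(a == p) && (!(a == x) &&
      (!(c == x) && !(c == q)))))))

/-- The test whether `x` is in the middle of three inner vertices of a bidirected path. -/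
def isMid (V : List ℕ) (E : List (ℕ × ℕ)) (x : ℕ) : Bool :=
  V.any fun a => V.any fun p => V.any fun q => V.any fun c => isBipathList V E x a p q c

/-- The in-neighbours of `x` other than `y`. -/
def otherIn (E : List (ℕ × ℕ)) (x y : ℕ) : List ℕ :=
  (E.filter fun e => e.2 == x && !(e.1 == y)).map fun e => e.1

/-- The test whether an arc is avoidable. -/
def isAvoidable (V : List ℕ) (E : List (ℕ × ℕ)) (r : ℕ) (e : ℕ × ℕ) : Bool :=
  !hasVertex (reachList V E r (otherIn E e.2 e.1)) e.1

/-- Delete `x` and join its in-neighbours to its out-neighbours; `P` lists the possible arcs. -/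
def bypassList (P : List (ℕ × ℕ)) (V : List ℕ) (E : List (ℕ × ℕ)) (x : ℕ) :
    List ℕ × List (ℕ × ℕ) :=
  (V.filter fun v => !(v == x), P.filter fun e => !(e.1 == x) && (!(e.2 == x) && (!(e.1 == e.2) &&
    (hasArc E e.1 e.2 || (hasArc E e.1 x && hasArc E x e.2)))))

/-- The vertices to which the first or the third reduction rule applies. -/
def vertexCandidates (V : List ℕ) (E : List (ℕ × ℕ)) (r : ℕ) : List ℕ :=
  V.filter fun x => isCut V E r x || isMid V E x

/-- The arcs to which the second reduction rule applies. -/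
def arcCandidates (V : List ℕ) (E : List (ℕ × ℕ)) (r : ℕ) : List (ℕ × ℕ) :=
  E.filter fun e => isAvoidable V E r e

/-- Delete an arc. -/
def eraseArc (E : List (ℕ × ℕ)) (d : ℕ × ℕ) : List (ℕ × ℕ) :=
  E.filter fun e => !(e.1 == d.1 && e.2 == d.2)

/-- Apply one reduction rule, if possible. -/
def reduceStep (P : List (ℕ × ℕ)) (r : ℕ) (G : List ℕ × List (ℕ × ℕ)) : List ℕ × List (ℕ × ℕ) :=
  if (vertexCandidates G.1 G.2 r).isEmpty = true then
    if (arcCandidates G.1 G.2 r).isEmpty = true then G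
    else (G.1, eraseArc G.2 ((arcCandidates G.1 G.2 r).headD (0, 0)))
  else bypassList P G.1 G.2 ((vertexCandidates G.1 G.2 r).headD 0)

/-- Apply the reduction rules as long as possible. -/
def reduce (P : List (ℕ × ℕ)) (r : ℕ) (G : List ℕ × List (ℕ × ℕ)) : List ℕ × List (ℕ × ℕ) :=
  (reduceStep P r)^[G.1.length * (P.length + 1) + P.length] G

/-- The invariant of the reduction. -/
structure Invariant (P : List (ℕ × ℕ)) (r : ℕ) (G : List ℕ × List (ℕ × ℕ)) : Prop where
  nodup : G.1.Nodup
  sublist : List.Sublist G.2 P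
  pairs : ∀ u ∈ G.1, ∀ v ∈ G.1, (u, v) ∈ P
  mem_iff : ∀ v, v ∈ G.1 ↔ Reach (arcRel G.2) ∅ r v
  arc : ∀ u v, (u, v) ∈ G.2 → u ∈ G.1 ∧ v ∈ G.1 ∧ u ≠ v ∧ v ≠ r

/-! ### Correctness of the tests and of the reduction rules on lists -/

section Step

variable {P : List (ℕ × ℕ)} {r : ℕ} {V : List ℕ} {E : List (ℕ × ℕ)}

theorem Invariant.root_mem (h : Invariant P r (V, E)) : r ∈ V := (h.mem_iff r).2 .refl

theorem Invariant.mem_reachList (h : Invariant P r (V, E)) {L : List ℕ} {v : ℕ} :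
    v ∈ reachList V E r L ↔ Reach (arcRel E) {z | z ∈ L} r v :=
  LeafKernel.mem_reachList h.root_mem fun u v huv => (h.arc u v huv).2.1

theorem Invariant.isCut_iff (h : Invariant P r (V, E)) {x : ℕ} :
    isCut V E r x = true ↔
      x ≠ r ∧ ∃ v ≠ x, Reach (arcRel E) ∅ r v ∧ ¬ Reach (arcRel E) {x} r v := by
  have hx : {z | z ∈ [x]} = ({x} : Set ℕ) := by ext; simp
  simp only [isCut, Bool.and_eq_true, Bool.not_eq_true', List.any_eq_true,
    ← Bool.not_eq_true, hasVertex_eq_true, h.mem_reachList, hx, beq_iff_eq]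
  refine and_congr_right fun _ => exists_congr fun v => ?_
  rw [← h.mem_iff]
  tauto

theorem Invariant.nbrsAre_iff (h : Invariant P r (V, E)) {x p q : ℕ} (hp : p ∈ V) (hq : q ∈ V) :
    nbrsAre V E x p q = true ↔ (∀ w, arcRel E w x ↔ w = p ∨ w = q) ∧
      ∀ w, arcRel E x w ↔ w = p ∨ w = q := by
  have key : ∀ u v w, (hasArc E u v == (w == p || w == q)) = true ↔
      ((u, v) ∈ E ↔ w = p ∨ w = q) := by
    intro u v w
    rw [beq_iff_eq, Bool.eq_iff_iff, hasArc_eq_true, Bool.or_eq_true, beq_iff_eq, beq_iff_eq]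
  simp only [nbrsAre, List.all_eq_true, Bool.and_eq_true, key, arcRel]
  constructor
  · intro hall
    refine ⟨fun w => ⟨fun hw => ((hall w (h.arc _ _ hw).1).1.1 hw), fun hw => ?_⟩,
      fun w => ⟨fun hw => ((hall w (h.arc _ _ hw).2.1).2.1 hw), fun hw => ?_⟩⟩
    · rcases hw with rfl | rfl
      exacts [(hall w hp).1.2 (.inl rfl), (hall w hq).1.2 (.inr rfl)]
    · rcases hw with rfl | rfl
      exacts [(hall w hp).2.2 (.inl rfl), (hall w hq).2.2 (.inr rfl)]
  · rintro ⟨h1, h2⟩ w -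
    exact ⟨h1 w, h2 w⟩

theorem Invariant.isMid_iff (h : Invariant P r (V, E)) {x : ℕ} (hx : x ∈ V) :
    isMid V E x = true ↔ ∃ a p q c, IsBipath (arcRel E) a p x q c := by
  simp only [isMid, List.any_eq_true]
  constructor
  · rintro ⟨a, ha, p, hp, q, hq, c, hc, hb⟩
    simp only [isBipathList, Bool.and_eq_true, Bool.not_eq_true', beq_eq_false_iff_ne,
      h.nbrsAre_iff ha hx, h.nbrsAre_iff hp hq, h.nbrsAre_iff hc hx] at hb
    obtain ⟨⟨⟨h1, h2⟩, ⟨h3, h4⟩, h5, h6⟩, h7, h8, h9, h10, h11, h12, h13⟩ := hb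
    exact ⟨a, p, q, c, h1, h2, h3, h4, h5, h6, h7, h8, h9, h10, h11, h12, h13⟩
  · rintro ⟨a, p, q, c, h1, h2, h3, h4, h5, h6, h7, h8, h9, h10, h11, h12, h13⟩
    have ha := (h.arc _ _ ((h1 a).2 (.inl rfl))).1
    have hp := (h.arc _ _ ((h3 p).2 (.inl rfl))).1
    have hq := (h.arc _ _ ((h3 q).2 (.inr rfl))).1
    have hc := (h.arc _ _ ((h5 c).2 (.inl rfl))).1
    refine ⟨a, ha, p, hp, q, hq, c, hc, ?_⟩
    simp only [isBipathList, Bool.and_eq_true, Bool.not_eq_true', beq_eq_false_iff_ne,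
      h.nbrsAre_iff ha hx, h.nbrsAre_iff hp hq, h.nbrsAre_iff hc hx]
    exact ⟨⟨⟨h1, h2⟩, ⟨h3, h4⟩, h5, h6⟩, h7, h8, h9, h10, h11, h12, h13⟩

theorem Invariant.isAvoidable_iff (h : Invariant P r (V, E)) {e : ℕ × ℕ} :
    isAvoidable V E r e = true ↔
      ¬ Reach (arcRel E) {z | arcRel E z e.2 ∧ z ≠ e.1} r e.1 := by
  have hx : {z | z ∈ otherIn E e.2 e.1} = {z | arcRel E z e.2 ∧ z ≠ e.1} := by
    ext z
    simp only [otherIn, List.mem_map, List.mem_filter, Bool.and_eq_true, beq_iff_eq,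
      Bool.not_eq_true', beq_eq_false_iff_ne, Set.mem_ofPred_eq, Prod.exists, arcRel]
    constructor
    · rintro ⟨a, b, ⟨h1, rfl, h2⟩, rfl⟩; exact ⟨h1, h2⟩
    · rintro ⟨h1, h2⟩; exact ⟨z, e.2, ⟨h1, rfl, h2⟩, rfl⟩
  rw [isAvoidable, Bool.not_eq_true', ← Bool.not_eq_true, hasVertex_eq_true, h.mem_reachList, hx]

theorem Invariant.ne_of_isMid (h : Invariant P r (V, E)) {a p x q c : ℕ}
    (hb : IsBipath (arcRel E) a p x q c) : r ≠ x :=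
  fun e => (h.arc _ _ ((hb.in₂ p).2 (.inl rfl))).2.2.2 e.symm

theorem Invariant.arcRel_bypassList (h : Invariant P r (V, E)) (x : ℕ) :
    arcRel (bypassList P V E x).2 = bypass (arcRel E) x := by
  ext u w
  simp only [arcRel, bypassList, bypass, List.mem_filter, Bool.and_eq_true, Bool.not_eq_true',
    beq_eq_false_iff_ne, Bool.or_eq_true, hasArc_eq_true]
  refine ⟨fun h => h.2, fun h' => ⟨?_, h'⟩⟩
  rcases h'.2.2.2 with h1 | h1
  · exact h.sublist.subset h1
  · exact h.pairs _ (h.arc _ _ h1.1).1 _ (h.arc _ _ h1.2).2.1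

theorem Invariant.bypassList (h : Invariant P r (V, E)) {x : ℕ} (hx : r ≠ x) :
    Invariant P r (LeafKernel.bypassList P V E x) := by
  have hmem : ∀ v, v ∈ (LeafKernel.bypassList P V E x).1 ↔ v ∈ V ∧ v ≠ x := by
    intro v; simp [LeafKernel.bypassList]
  refine ⟨h.nodup.filter _, List.filter_sublist, fun u hu v hv => ?_, fun v => ?_,
    fun u v huv => ?_⟩
  · exact h.pairs u ((hmem u).1 hu).1 v ((hmem v).1 hv).1
  · rw [hmem, h.arcRel_bypassList, reach_bypass_empty_iff hx]
    exact and_congr_left' (h.mem_iff v)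
  · have huv' : bypass (arcRel E) x u v := by rw [← h.arcRel_bypassList]; exact huv
    rw [hmem, hmem]
    obtain ⟨h1, h2, h3, h4⟩ := huv'
    rcases h4 with h4 | ⟨h4, h5⟩
    · exact ⟨⟨(h.arc _ _ h4).1, h1⟩, ⟨(h.arc _ _ h4).2.1, h2⟩, h3, (h.arc _ _ h4).2.2.2⟩
    · exact ⟨⟨(h.arc _ _ h4).1, h1⟩, ⟨(h.arc _ _ h5).2.1, h2⟩, h3, (h.arc _ _ h5).2.2.2⟩

theorem arcRel_eraseArc (d : ℕ × ℕ) : arcRel (eraseArc E d) = delArc (arcRel E) d.1 d.2 := by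
  ext u w
  simp only [arcRel, eraseArc, delArc, List.mem_filter, Bool.not_eq_true', Bool.and_eq_false_iff,
    beq_eq_false_iff_ne]
  refine and_congr_right fun _ => ?_
  tauto

theorem Invariant.eraseArc (h : Invariant P r (V, E)) {d : ℕ × ℕ}
    (hd : isAvoidable V E r d = true) : Invariant P r (V, LeafKernel.eraseArc E d) := by
  refine ⟨h.nodup, List.filter_sublist.trans h.sublist, h.pairs, fun v => ?_,
    fun u v huv => h.arc u v (List.mem_of_mem_filter huv)⟩
  rw [arcRel_eraseArc, reach_delArc_iff (h.isAvoidable_iff.1 hd)]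
  exact h.mem_iff v

theorem headD_mem {α : Type} {l : List α} (h : l ≠ []) (d : α) : l.headD d ∈ l := by
  cases l with
  | nil => exact absurd rfl h
  | cons a l => simp

end Step

/-- The invariant together with the answer is preserved by `reduceStep`, which makes progress. -/
theorem Invariant.step {P : List (ℕ × ℕ)} {r : ℕ} {G : List ℕ × List (ℕ × ℕ)}
    (h : Invariant P r G) (k : ℕ) :
    Invariant P r (reduceStep P r G) ∧
      (HasLeaves (arcRel (reduceStep P r G).2) r k ↔ HasLeaves (arcRel G.2) r k) ∧
      List.Sublist (reduceStep P r G).1 G.1 ∧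
      (reduceStep P r G ≠ G → (reduceStep P r G).1.length * (P.length + 1) +
        (reduceStep P r G).2.length < G.1.length * (P.length + 1) + G.2.length) := by
  obtain ⟨V, E⟩ := G
  unfold reduceStep
  dsimp only
  by_cases hc : (vertexCandidates V E r).isEmpty = true
  · rw [if_pos hc]
    by_cases ha : (arcCandidates V E r).isEmpty = true
    · rw [if_pos ha]
      exact ⟨h, Iff.rfl, List.Sublist.refl _, fun hne => absurd rfl hne⟩
    · rw [if_neg ha]
      have hd := headD_mem (fun e => ha (by rw [e]; rfl)) (0, 0) (l := arcCandidates V E r)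
      generalize (arcCandidates V E r).headD (0, 0) = d at hd
      obtain ⟨hdE, hd⟩ := List.mem_filter.1 hd
      refine ⟨h.eraseArc hd, ?_, List.Sublist.refl _, fun _ => ?_⟩
      · dsimp only
        rw [arcRel_eraseArc]
        exact hasLeaves_delArc_iff (h.isAvoidable_iff.1 hd)
      · have : (LeafKernel.eraseArc E d).length < E.length := by
          unfold LeafKernel.eraseArc
          exact List.length_filter_lt_length_iff_exists.2 ⟨d, hdE, by simp⟩
        dsimp only
        omega
  · rw [if_neg hc]
    have hx := headD_mem (fun e => hc (by rw [e]; rfl)) 0 (l := vertexCandidates V E r)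
    generalize (vertexCandidates V E r).headD 0 = x at hx
    obtain ⟨hxV, hx⟩ := List.mem_filter.1 hx
    rw [Bool.or_eq_true, h.isCut_iff, h.isMid_iff hxV] at hx
    have hrx : r ≠ x := by
      rcases hx with hx | ⟨a, p, q, c, hb⟩
      exacts [hx.1.symm, h.ne_of_isMid hb]
    have hinv := h.bypassList hrx
    refine ⟨hinv, ?_, List.filter_sublist, fun _ => ?_⟩
    · rw [h.arcRel_bypassList]
      rcases hx with ⟨_, v, hv, h1, h2⟩ | ⟨a, p, q, c, hb⟩
      · exact hasLeaves_bypass_cutVertex_iff hrx hv h1 h2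
      · exact hb.hasLeaves_bypass_iff fun w hw => (h.arc _ _ hw).2.2.2 rfl
    -- A bypass may create arcs, but all arcs lie in `P`; the weight `P.length + 1` of the lost
    -- vertex outweighs them.
    · have h1 : (LeafKernel.bypassList P V E x).1.length < V.length := by
        unfold LeafKernel.bypassList
        exact List.length_filter_lt_length_iff_exists.2 ⟨x, hxV, by simp⟩
      have h2 := hinv.sublist.length_le
      have h3 := Nat.mul_le_mul_right (P.length + 1) (Nat.succ_le_of_lt h1)
      rw [Nat.succ_mul] at h3
      omega

theorem Invariant.iterate {P : List (ℕ × ℕ)} {r : ℕ} {G : List ℕ × List (ℕ × ℕ)}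
    (h : Invariant P r G) (k n : ℕ) :
    Invariant P r ((reduceStep P r)^[n] G) ∧
      (HasLeaves (arcRel ((reduceStep P r)^[n] G).2) r k ↔ HasLeaves (arcRel G.2) r k) ∧
      List.Sublist ((reduceStep P r)^[n] G).1 G.1 := by
  induction n with
  | zero => exact ⟨h, Iff.rfl, List.Sublist.refl _⟩
  | succ n ih =>
    rw [Function.iterate_succ_apply']
    obtain ⟨h1, h2, h3, -⟩ := ih.1.step k
    exact ⟨h1, h2.trans ih.2.1, h3.trans ih.2.2⟩

theorem Invariant.reduce {P : List (ℕ × ℕ)} {r : ℕ} {G : List ℕ × List (ℕ × ℕ)}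
    (h : Invariant P r G) (k : ℕ) :
    Invariant P r (reduce P r G) ∧
      (HasLeaves (arcRel (reduce P r G).2) r k ↔ HasLeaves (arcRel G.2) r k) ∧
      List.Sublist (reduce P r G).1 G.1 ∧
      vertexCandidates (reduce P r G).1 (reduce P r G).2 r = [] ∧
      arcCandidates (reduce P r G).1 (reduce P r G).2 r = [] := by
  obtain ⟨h1, h2, h3⟩ := h.iterate k (G.1.length * (P.length + 1) + P.length)
  have hfix : reduceStep P r (LeafKernel.reduce P r G) = LeafKernel.reduce P r G :=
    iterate_fixed (reduceStep P r) (fun G => G.1.length * (P.length + 1) + G.2.length) G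
      (fun i hi => ((h.iterate k i).1.step k).2.2.2 hi)
      (Nat.add_le_add_left h.sublist.length_le _)
  refine ⟨h1, h2, h3, ?_⟩
  change Invariant P r (LeafKernel.reduce P r G) at h1
  generalize LeafKernel.reduce P r G = H at hfix h1
  obtain ⟨V, E⟩ := H
  unfold reduceStep at hfix
  dsimp only at hfix ⊢
  by_cases hc : (vertexCandidates V E r).isEmpty = true
  · rw [if_pos hc] at hfix
    by_cases ha : (arcCandidates V E r).isEmpty = true
    · exact ⟨List.isEmpty_iff.1 hc, List.isEmpty_iff.1 ha⟩
    · rw [if_neg ha] at hfix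
      have hd := headD_mem (fun e => ha (by rw [e]; rfl)) (0, 0) (l := arcCandidates V E r)
      generalize (arcCandidates V E r).headD (0, 0) = d at hd hfix
      -- A remaining candidate would be removed by one more step, yet at a fixed point it is still
      -- present.
      have hdE := (List.mem_filter.1 hd).1
      rw [← (Prod.mk.inj hfix).2] at hdE
      simp [LeafKernel.eraseArc] at hdE
  · rw [if_neg hc] at hfix
    have hx := headD_mem (fun e => hc (by rw [e]; rfl)) 0 (l := vertexCandidates V E r)
    generalize (vertexCandidates V E r).headD 0 = x at hx hfix
    have hxV := (List.mem_filter.1 hx).1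
    rw [← (Prod.mk.inj hfix).1] at hxV
    simp at hxV

end LeafKernel

namespace LeafKernel

/-! ### Transport of reachability and leaf sets -/

section Transport

variable {V W : Type} {A : V → V → Prop} {B : W → W → Prop} {e : V → W}

theorem Reach.map {L : Set W} {L' : Set V} {r v : V} (hL : ∀ a, e a ∈ L → a ∈ L')
    (hAB : ∀ a b, A a b → B (e a) (e b)) (h : Reach A L' r v) : Reach B L (e r) (e v) :=
  h.induct (fun v => Reach B L (e r) (e v)) .refl fun a b _ h haL hab =>
    h.tail (fun h => haL (hL a h)) (hAB a b hab)

/-- By `hB` the image of `e` is closed under out-arcs, so a walk that starts in it stays in it and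
lifts. -/
theorem Reach.exists_of_map (hAB : ∀ a b, A a b ↔ B (e a) (e b))
    (hB : ∀ a w, B (e a) w → w ∈ Set.range e) {L : Set W} {L' : Set V} {r : V} {w : W}
    (hL : ∀ a, a ∈ L' → e a ∈ L) (h : Reach B L (e r) w) : ∃ v, e v = w ∧ Reach A L' r v := by
  refine h.induct (fun w => ∃ v, e v = w ∧ Reach A L' r v) ⟨r, rfl, .refl⟩ ?_
  rintro _ w - ⟨a, rfl, ha⟩ haL haw
  obtain ⟨b, rfl⟩ := hB a w haw
  exact ⟨b, rfl, ha.tail (fun h => haL (hL a h)) ((hAB a b).2 haw)⟩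

theorem reach_map_iff (he : Function.Injective e) (hAB : ∀ a b, A a b ↔ B (e a) (e b))
    (hB : ∀ a w, B (e a) w → w ∈ Set.range e) {L : Set W} {L' : Set V} {r v : V}
    (hL : ∀ a, a ∈ L' ↔ e a ∈ L) : Reach B L (e r) (e v) ↔ Reach A L' r v := by
  refine ⟨fun h => ?_, fun h => h.map (fun a => (hL a).2) fun a b => (hAB a b).1⟩
  obtain ⟨a, ha, h⟩ := h.exists_of_map hAB hB (L' := L') fun a => (hL a).1
  exact he ha ▸ h

theorem hasLeaves_map_iff (he : Function.Injective e) (hAB : ∀ a b, A a b ↔ B (e a) (e b))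
    (hB : ∀ a w, B (e a) w → w ∈ Set.range e) {r : V} {k : ℕ} :
    HasLeaves B (e r) k ↔ HasLeaves A r k := by
  classical
  have h0 : ∀ a : V, a ∈ (∅ : Set V) ↔ e a ∈ (∅ : Set W) := fun a => by simp
  constructor
  · rintro ⟨L, hk, hL, hL'⟩
    have hcoe : ∀ a : V, a ∈ (↑(L.preimage e he.injOn) : Set V) ↔ e a ∈ (↑L : Set W) := by simp
    refine ⟨L.preimage e he.injOn, ?_, fun v hv => ?_, fun v hv => ?_⟩
    · have : (L.preimage e he.injOn).image e = L := by
        refine Finset.image_preimage_of_bij e L ⟨fun _ h => h, he.injOn, fun w hw => ?_⟩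
        obtain ⟨v, rfl, -⟩ := (hL w hw).exists_of_map hAB hB (L' := ∅) fun a => (h0 a).1
        exact ⟨v, hw, rfl⟩
      rwa [← this, Finset.card_image_of_injective _ he] at hk
    · exact (reach_map_iff he hAB hB h0).1 (hL _ (Finset.mem_preimage.1 hv))
    · exact (reach_map_iff he hAB hB hcoe).1 (hL' _ ((reach_map_iff he hAB hB h0).2 hv))
  · rintro ⟨L, hk, hL, hL'⟩
    have hcoe : ∀ a : V, a ∈ (↑L : Set V) ↔ e a ∈ (↑(L.image e) : Set W) := by
      simp [he.eq_iff]
    refine ⟨L.image e, by rwa [Finset.card_image_of_injective _ he], fun w hw => ?_,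
      fun w hw => ?_⟩
    · obtain ⟨v, hv, rfl⟩ := Finset.mem_image.1 hw
      exact (reach_map_iff he hAB hB h0).2 (hL v hv)
    · obtain ⟨v, rfl, hv⟩ := hw.exists_of_map hAB hB (L' := ∅) fun a => (h0 a).1
      exact (reach_map_iff he hAB hB hcoe).2 (hL' v hv)

theorem IsBipath.map (hAB : ∀ a b, A a b ↔ B (e a) (e b)) (he : Function.Injective e)
    (hB : ∀ a w, B (e a) w → w ∈ Set.range e) (hB' : ∀ a w, B w (e a) → w ∈ Set.range e)
    {a x₁ x₂ x₃ b : V} (h : IsBipath A a x₁ x₂ x₃ b) :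
    IsBipath B (e a) (e x₁) (e x₂) (e x₃) (e b) := by
  have hin : ∀ x p q, (∀ w, A w x ↔ w = p ∨ w = q) → ∀ w, B w (e x) ↔ w = e p ∨ w = e q := by
    intro x p q h w
    constructor
    · intro hw
      obtain ⟨w, rfl⟩ := hB' x w hw
      exact ((h w).1 ((hAB _ _).2 hw)).imp (congrArg e) (congrArg e)
    · rintro (rfl | rfl)
      exacts [(hAB _ _).1 ((h _).2 (.inl rfl)), (hAB _ _).1 ((h _).2 (.inr rfl))]
  have hout : ∀ x p q, (∀ w, A x w ↔ w = p ∨ w = q) → ∀ w, B (e x) w ↔ w = e p ∨ w = e q := by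
    intro x p q h w
    constructor
    · intro hw
      obtain ⟨w, rfl⟩ := hB x w hw
      exact ((h w).1 ((hAB _ _).2 hw)).imp (congrArg e) (congrArg e)
    · rintro (rfl | rfl)
      exacts [(hAB _ _).1 ((h _).2 (.inl rfl)), (hAB _ _).1 ((h _).2 (.inr rfl))]
  exact ⟨hin _ _ _ h.in₁, hout _ _ _ h.out₁, hin _ _ _ h.in₂, hout _ _ _ h.out₂,
    hin _ _ _ h.in₃, hout _ _ _ h.out₃, he.ne h.ne₁₂, he.ne h.ne₁₃, he.ne h.ne₂₃, he.ne h.a₁,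
    he.ne h.a₂, he.ne h.b₂, he.ne h.b₃⟩

end Transport

/-- Loops, arcs into the root and unreachable vertices play no role. -/
theorem reach_congr {V : Type} {A A' : V → V → Prop} {r : V} (hA : ∀ a b, A' a b → A a b)
    (hA' : ∀ a b, Reach A ∅ r a → A a b → a ≠ b → b ≠ r → A' a b) {L : Set V} {v : V} :
    Reach A' L r v ↔ Reach A L r v := by
  refine ⟨fun h => h.mono subset_rfl hA, fun h => ?_⟩
  refine h.induct (Reach A' L r) .refl fun a b ha ha' haL hab => ?_
  by_cases h1 : a = b
  · exact h1 ▸ ha'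
  by_cases h2 : b = r
  · exact h2 ▸ .refl
  exact ha'.tail haL (hA' a b (ha.mono (Set.empty_subset L) fun _ _ h => h) hab h1 h2)

theorem hasLeaves_congr {V : Type} {A A' : V → V → Prop} {r : V} (hA : ∀ a b, A' a b → A a b)
    (hA' : ∀ a b, Reach A ∅ r a → A a b → a ≠ b → b ≠ r → A' a b) {k : ℕ} :
    HasLeaves A' r k ↔ HasLeaves A r k := by
  simp only [HasLeaves, reach_congr hA hA']

/-! ### Rooted graphs as lists -/

/-- A reduced graph with more than `2000 * k ^ 3` vertices has `k` leaves. -/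
theorem Invariant.hasLeaves_of_lt {P : List (ℕ × ℕ)} {r : ℕ} {V : List ℕ} {E : List (ℕ × ℕ)}
    (h : Invariant P r (V, E)) (hV : vertexCandidates V E r = []) (hE : arcCandidates V E r = [])
    {k : ℕ} (hk : 2000 * k ^ 3 < V.length) : HasLeaves (arcRel E) r k := by
  by_contra hno
  obtain ⟨i, rfl⟩ := List.mem_iff_get.1 h.root_mem
  have he : Function.Injective V.get := List.nodup_iff_injective_get.1 h.nodup
  have hB : ∀ a w, arcRel E (V.get a) w → w ∈ Set.range V.get := fun a w hw =>
    List.mem_iff_get.1 (h.arc _ _ hw).2.1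
  have hB' : ∀ a w, arcRel E w (V.get a) → w ∈ Set.range V.get := fun a w hw =>
    List.mem_iff_get.1 (h.arc _ _ hw).1
  let A : Fin V.length → Fin V.length → Prop := fun a b => arcRel E (V.get a) (V.get b)
  have hAB : ∀ a b, A a b ↔ arcRel E (V.get a) (V.get b) := fun a b => Iff.rfl
  have h0 : ∀ v, Reach (arcRel E) ∅ (V.get i) (V.get v) := fun v =>
    (h.mem_iff _).1 (List.get_mem _ _)
  have hcand : ∀ x ∈ V, isCut V E (V.get i) x = false ∧ isMid V E x = false := by
    intro x hx
    simpa using List.filter_eq_nil_iff.1 hV x hx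
  refine absurd (card_le_of_reduced (A := A) (r := i) (k := k) (fun v hv => ?_) (fun v hv => ?_)
    (fun v => ?_) (fun x hx v hv => ?_) (fun y x hyx => ?_) (fun a x₁ x₂ x₃ c hb => ?_) ?_)
    (by rw [Fintype.card_fin]; exact not_le.2 hk)
  · exact (h.arc _ _ hv).2.2.1 rfl
  · exact (h.arc _ _ hv).2.2.2 rfl
  · exact (reach_map_iff he hAB hB (by simp)).1 (h0 v)
  · refine (reach_map_iff he hAB hB (L := {V.get x}) fun a => he.eq_iff.symm).1 ?_
    by_contra hr
    have := (hcand _ (List.get_mem V x)).1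
    rw [← Bool.not_eq_true, h.isCut_iff] at this
    exact this ⟨he.ne hx, _, he.ne hv, h0 v, hr⟩
  · have := List.filter_eq_nil_iff.1 hE _ hyx
    rw [h.isAvoidable_iff, not_not] at this
    refine (reach_map_iff he hAB hB fun a => ?_).1 this
    exact and_congr_right fun _ => he.ne_iff.symm
  · have := (hcand _ (List.get_mem V x₂)).2
    rw [← Bool.not_eq_true, h.isMid_iff (List.get_mem _ _)] at this
    exact this ⟨_, _, _, _, hb.map hAB he hB hB'⟩
  · exact fun h' => hno ((hasLeaves_map_iff he hAB hB).2 h')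

/-- A rooted graph: the root, the list of the other vertices, the list of arcs. -/
abbrev RootedGraph := ℕ × List ℕ × List (ℕ × ℕ)

/-- A rooted graph as an instance of the rooted problems; the root becomes the vertex `0`. -/
def RootedGraph.toInstance (g : RootedGraph) (k : ℕ) : RootedInstance where
  n := (g.1 :: g.2.1).length
  graph := ⟨fun i j => arcRel g.2.2 ((g.1 :: g.2.1).get i) ((g.1 :: g.2.1).get j)⟩
  k := k
  root := ⟨0, Nat.succ_pos _⟩

/-- The lists of a rooted graph describe a digraph whose root has in-degree zero. -/
structure RootedGraph.WellFormed (g : RootedGraph) : Prop where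
  nodup : (g.1 :: g.2.1).Nodup
  arc : ∀ u v, (u, v) ∈ g.2.2 → u ∈ g.1 :: g.2.1 ∧ v ∈ g.1 :: g.2.1 ∧ v ≠ g.1

theorem RootedGraph.WellFormed.hasLeaves_iff {g : RootedGraph} (hg : g.WellFormed) {k : ℕ} :
    HasLeaves (g.toInstance k).graph.Adj (g.toInstance k).root k ↔
      HasLeaves (arcRel g.2.2) g.1 k :=
  (hasLeaves_map_iff (e := (g.1 :: g.2.1).get) (B := arcRel g.2.2)
    (r := ⟨0, Nat.succ_pos _⟩) (List.nodup_iff_injective_get.1 hg.nodup)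
    (fun _ _ => Iff.rfl) (fun _ w hw => List.mem_iff_get.1 (hg.arc _ w hw).2.1)).symm

theorem RootedGraph.WellFormed.reach_iff {g : RootedGraph} (hg : g.WellFormed) {k : ℕ} :
    (∀ v, Reach (g.toInstance k).graph.Adj ∅ (g.toInstance k).root v) ↔
      ∀ v ∈ g.1 :: g.2.1, Reach (arcRel g.2.2) ∅ g.1 v := by
  have key : ∀ v, Reach (arcRel g.2.2) ∅ g.1 ((g.1 :: g.2.1).get v) ↔
      Reach (g.toInstance k).graph.Adj ∅ (g.toInstance k).root v := fun v =>
    reach_map_iff (e := (g.1 :: g.2.1).get) (B := arcRel g.2.2) (L := ∅) (L' := ∅)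
      (r := ⟨0, Nat.succ_pos _⟩) (List.nodup_iff_injective_get.1 hg.nodup)
      (fun _ _ => Iff.rfl) (fun _ w hw => List.mem_iff_get.1 (hg.arc _ w hw).2.1) (by simp)
  constructor
  · intro h v hv
    obtain ⟨i, rfl⟩ := List.mem_iff_get.1 hv
    exact (key i).2 (h i)
  · exact fun h v => (key v).1 (h _ (List.get_mem _ _))

/-- Since the root has in-degree zero, it is the root of all out-branchings. -/
theorem RootedGraph.WellFormed.outBranching_iff {g : RootedGraph} (hg : g.WellFormed) {k : ℕ} :
    (g.toInstance k).toInstance.OutBranching ↔ (g.toInstance k).OutBranching := by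
  constructor
  · rintro ⟨T, r, hT, hk⟩
    have hr := (hT.1.2 (g.toInstance k).root).1
      ⟨hT.2 ▸ Set.mem_univ _, fun u hu => (hg.arc _ _ (T.adj_sub hu)).2.2 rfl⟩
    exact ⟨T, hr ▸ hT, hk⟩
  · rintro ⟨T, hT, hk⟩
    exact ⟨T, _, hT, hk⟩

/-! ### The kernel -/

/-- The entry of a matrix. -/
def entry (M : List (List Bool)) (i j : ℕ) : Bool := ((M.drop i).headD [] |>.drop j).headD false

/-- The arcs of a digraph given by its adjacency matrix. -/
def matrixArcs (M : List (List Bool)) : List (ℕ × ℕ) :=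
  (List.range M.length ×ˢ List.range M.length).filter fun e => entry M e.1 e.2

/-- The arcs except for loops and arcs into the root. -/
def rootArcs (M : List (List Bool)) (v : ℕ) : List (ℕ × ℕ) :=
  (matrixArcs M).filter fun e => !(e.1 == e.2) && !(e.2 == v)

/-- The vertices that can be reached from the root. -/
def rootReach (M : List (List Bool)) (v : ℕ) : List ℕ :=
  reachList (List.range M.length) (rootArcs M v) v []

/-- The digraph of vertices reachable from the root, reduced. -/
def reducedGraph (M : List (List Bool)) (v : ℕ) : List ℕ × List (ℕ × ℕ) :=
  reduce (rootReach M v ×ˢ rootReach M v) v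
    (rootReach M v, (rootReach M v ×ˢ rootReach M v).filter fun e => hasArc (rootArcs M v) e.1 e.2)

/-- The number with the given binary digits (least significant first), or `N` if it is larger. -/
def cappedVal (N : ℕ) (bits : List Bool) : ℕ :=
  bits.foldr (fun b v => min (v + v + if b = true then 1 else 0) N) 0

/-- A star with `k` leaves. -/
def star (k : ℕ) : RootedGraph :=
  (0, (List.range k).map fun i => i + 1, (List.range k).map fun i => (0, i + 1))

/-- The kernel for out-trees, for a graph whose size is compared to the number `kk`. -/
def treeKernelAux (G : List ℕ × List (ℕ × ℕ)) (v kk : ℕ) : RootedGraph :=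
  if decide (G.1.length ≤ 2000 * (kk * kk * kk)) = true then
    (v, G.1.filter fun u => !(u == v), G.2)
  else star kk

/-- The kernel for out-trees. -/
def treeKernel (M : List (List Bool)) (bits : List Bool) (v : ℕ) : RootedGraph :=
  treeKernelAux (reducedGraph M v) v (cappedVal (M.length + 1) bits)

/-- The kernel for out-branchings. -/
def branchingKernel (M : List (List Bool)) (bits : List Bool) (v : ℕ) : RootedGraph :=
  if decide (M.length ≤ (rootReach M v).length) = true then treeKernel M bits v
  else (0, [1], [])

/-! ### Correctness of the two kernels -/

theorem mem_matrixArcs {M : List (List Bool)} {u v : ℕ} :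
    (u, v) ∈ matrixArcs M ↔ u < M.length ∧ v < M.length ∧ entry M u v = true := by
  simp [matrixArcs, and_assoc]

theorem mem_rootArcs {M : List (List Bool)} {r u v : ℕ} :
    (u, v) ∈ rootArcs M r ↔ (u, v) ∈ matrixArcs M ∧ u ≠ v ∧ v ≠ r := by
  simp [rootArcs]

theorem mem_rootReach {M : List (List Bool)} {r v : ℕ} (hr : r < M.length) :
    v ∈ rootReach M r ↔ Reach (arcRel (matrixArcs M)) ∅ r v := by
  rw [rootReach, mem_reachList (List.mem_range.2 hr) fun u v huv =>
    List.mem_range.2 (mem_matrixArcs.1 (mem_rootArcs.1 huv).1).2.1]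
  have : {z | z ∈ ([] : List ℕ)} = ∅ := by ext; simp
  rw [this]
  exact reach_congr (fun a b h => (mem_rootArcs.1 h).1) fun a b _ h h1 h2 =>
    mem_rootArcs.2 ⟨h, h1, h2⟩

theorem nodup_reachList {V : List ℕ} {E : List (ℕ × ℕ)} {r : ℕ} {L : List ℕ} (hV : V.Nodup) :
    (reachList V E r L).Nodup := by
  obtain ⟨p, hp⟩ := exists_filter_reachStep_iterate V E r L V.length
  rw [reachList, hp]
  exact hV.filter p

theorem length_rootReach_le {M : List (List Bool)} {r : ℕ} : (rootReach M r).length ≤ M.length := by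
  obtain ⟨p, hp⟩ := exists_filter_reachStep_iterate (List.range M.length) (rootArcs M r) r []
    (List.range M.length).length
  rw [rootReach, reachList, hp]
  exact (List.length_filter_le _ _).trans_eq List.length_range

theorem invariant_rootReach {M : List (List Bool)} {r : ℕ} (hr : r < M.length) :
    Invariant (rootReach M r ×ˢ rootReach M r) r (rootReach M r,
      (rootReach M r ×ˢ rootReach M r).filter fun e => hasArc (rootArcs M r) e.1 e.2) ∧
    ∀ k, HasLeaves (arcRel ((rootReach M r ×ˢ rootReach M r).filter
      fun e => hasArc (rootArcs M r) e.1 e.2)) r k ↔ HasLeaves (arcRel (matrixArcs M)) r k := by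
  have hmem : ∀ u v, (u, v) ∈ (rootReach M r ×ˢ rootReach M r).filter
      (fun e => hasArc (rootArcs M r) e.1 e.2) ↔
      (u ∈ rootReach M r ∧ v ∈ rootReach M r) ∧ (u, v) ∈ matrixArcs M ∧ u ≠ v ∧ v ≠ r := by
    intro u v
    rw [List.mem_filter, List.mem_product, hasArc_eq_true, mem_rootArcs]
  have h1 : ∀ a b, arcRel ((rootReach M r ×ˢ rootReach M r).filter
      fun e => hasArc (rootArcs M r) e.1 e.2) a b → arcRel (matrixArcs M) a b :=
    fun a b h => ((hmem a b).1 h).2.1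
  have h2 : ∀ a b, Reach (arcRel (matrixArcs M)) ∅ r a → arcRel (matrixArcs M) a b → a ≠ b →
      b ≠ r → arcRel ((rootReach M r ×ˢ rootReach M r).filter
      fun e => hasArc (rootArcs M r) e.1 e.2) a b := fun a b ha hab h3 h4 =>
    (hmem a b).2 ⟨⟨(mem_rootReach hr).2 ha,
      (mem_rootReach hr).2 (ha.tail (Set.notMem_empty a) hab)⟩, hab, h3, h4⟩
  refine ⟨⟨nodup_reachList List.nodup_range, List.filter_sublist,
    fun u hu v hv => List.mem_product.2 ⟨hu, hv⟩, fun v => ?_, fun u v huv => ?_⟩,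
    fun k => hasLeaves_congr h1 h2⟩
  · rw [reach_congr h1 h2]
    exact mem_rootReach hr
  · have := (hmem u v).1 huv
    exact ⟨this.1.1, this.1.2, this.2.2⟩

/-- Capping after each digit agrees with capping at the end, because a value at the cap stays there
when doubled. -/
theorem cappedVal_bits (N m : ℕ) : cappedVal N m.bits = min m N := by
  induction m using Nat.binaryRec' with
  | zero => simp [cappedVal]
  | bit b m h ih =>
    rw [Nat.bits_append_bit m b h]
    change min (cappedVal N m.bits + cappedVal N m.bits + _) N = _
    rw [ih, Nat.bit_val]
    cases b <;> simp <;> omega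

theorem wellFormed_star (k : ℕ) : (star k).WellFormed := by
  refine ⟨?_, fun u v huv => ?_⟩
  · have : 0 :: (List.range k).map (fun i => i + 1) = List.range (k + 1) :=
      List.range_succ_eq_map.symm
    change (0 :: (List.range k).map (fun i => i + 1)).Nodup
    rw [this]
    exact List.nodup_range
  · simp only [star, List.mem_map, Prod.mk.injEq] at huv
    obtain ⟨i, hi, rfl, rfl⟩ := huv
    exact ⟨by simp [star], by simp [star]; simpa using hi, Nat.succ_ne_zero i⟩

theorem reach_star {k v : ℕ} {L : Set ℕ} (hL : 0 ∉ L) (hv : v ≤ k) :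
    Reach (arcRel (star k).2.2) L 0 v := by
  rcases Nat.eq_zero_or_pos v with rfl | h
  · exact .refl
  · refine Reach.refl.tail hL ?_
    exact List.mem_map.2 ⟨v - 1, List.mem_range.2 (by omega), by
      rw [Nat.sub_add_cancel h]⟩

theorem hasLeaves_star (k : ℕ) : HasLeaves (arcRel (star k).2.2) 0 k := by
  refine ⟨(Finset.range k).image fun i => i + 1, ?_, fun v hv => ?_, fun v hv => ?_⟩
  · rw [Finset.card_image_of_injective _ (add_left_injective 1), Finset.card_range]
  · obtain ⟨i, hi, rfl⟩ := Finset.mem_image.1 hv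
    exact reach_star (Set.notMem_empty 0) (Finset.mem_range.1 hi)
  · refine reach_star (by simp) ?_
    refine hv.induct (· ≤ k) (Nat.zero_le k) fun a b _ _ _ hab => ?_
    simp only [arcRel, star, List.mem_map, List.mem_range, Prod.mk.injEq] at hab
    obtain ⟨i, hi, rfl, rfl⟩ := hab
    exact hi

/-- The properties of the kernel for out-trees. -/
theorem treeKernel_spec {M : List (List Bool)} {r k : ℕ} (hr : r < M.length) (hk : 1 ≤ k) :
    (treeKernel M k.bits r).WellFormed ∧
      (∀ v ∈ (treeKernel M k.bits r).1 :: (treeKernel M k.bits r).2.1,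
        Reach (arcRel (treeKernel M k.bits r).2.2) ∅ (treeKernel M k.bits r).1 v) ∧
      (HasLeaves (arcRel (treeKernel M k.bits r).2.2) (treeKernel M k.bits r).1 k ↔
        HasLeaves (arcRel (matrixArcs M)) r k) ∧
      ((treeKernel M k.bits r).1 :: (treeKernel M k.bits r).2.1).length ≤ 2000 * k ^ 3 := by
  obtain ⟨hinv, hleaves⟩ := invariant_rootReach hr
  obtain ⟨h1, h2, h3, h4, h5⟩ := hinv.reduce k
  have h6 := h3.length_le.trans length_rootReach_le
  rw [hleaves] at h2
  change Invariant _ r (reducedGraph M r) at h1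
  change HasLeaves (arcRel (reducedGraph M r).2) r k ↔ _ at h2
  change vertexCandidates (reducedGraph M r).1 (reducedGraph M r).2 r = [] at h4
  change arcCandidates (reducedGraph M r).1 (reducedGraph M r).2 r = [] at h5
  change (reducedGraph M r).1.length ≤ _ at h6
  unfold treeKernel
  rw [cappedVal_bits]
  generalize reducedGraph M r = G at h1 h2 h4 h5 h6
  obtain ⟨V, E⟩ := G
  dsimp only at h2 h4 h5 h6
  have hpow : ∀ m : ℕ, m * m * m = m ^ 3 := fun m => by ring
  unfold treeKernelAux
  dsimp only
  rw [hpow]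
  by_cases hsize : V.length ≤ 2000 * min k (M.length + 1) ^ 3
  · rw [if_pos (decide_eq_true hsize)]
    have hmem : ∀ v, v ∈ r :: V.filter (fun u => !(u == r)) ↔ v ∈ V := by
      intro v
      by_cases hv : v = r
      · simp [hv, h1.root_mem]
      · simp [hv]
    have hnd : (r :: V.filter (fun u => !(u == r))).Nodup := by
      refine List.nodup_cons.2 ⟨by simp, h1.nodup.filter _⟩
    refine ⟨⟨hnd, fun u v huv => ?_⟩, fun v hv => ?_, h2, ?_⟩
    · have := h1.arc u v huv
      exact ⟨(hmem u).2 this.1, (hmem v).2 this.2.1, this.2.2.2⟩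
    · exact (h1.mem_iff v).1 ((hmem v).1 hv)
    · have : (r :: V.filter (fun u => !(u == r))).length ≤ V.length :=
        (List.subperm_of_subset hnd fun v hv => (hmem v).1 hv).length_le
      exact this.trans (hsize.trans (Nat.mul_le_mul_left _
        (Nat.pow_le_pow_left (min_le_left _ _) 3)))
  · rw [if_neg (by simpa using hsize)]
    -- The star is only produced when the cap is inactive: for larger `k` the size comparison
    -- succeeds, as `V` has at most `M.length` vertices.
    have hmin : min k (M.length + 1) = k := by
      by_contra hne
      have : min k (M.length + 1) = M.length + 1 := by omega
      rw [this] at hsize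
      have := Nat.le_self_pow (n := 3) (by omega) (M.length + 1)
      omega
    rw [hmin] at hsize ⊢
    refine ⟨wellFormed_star k, fun v hv => reach_star (Set.notMem_empty 0) ?_,
      iff_of_true (hasLeaves_star k) (h2.1 (h1.hasLeaves_of_lt h4 h5 (not_le.1 hsize))), ?_⟩
    · simp only [star, List.mem_cons, List.mem_map, List.mem_range] at hv
      rcases hv with rfl | ⟨i, hi, rfl⟩
      exacts [Nat.zero_le k, hi]
    · simp only [star, List.length_cons, List.length_map, List.length_range]
      have := Nat.le_self_pow (n := 3) (by omega) k
      omega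

/-- The properties of the kernel for out-branchings. -/
theorem branchingKernel_spec {M : List (List Bool)} {r k : ℕ} (hr : r < M.length) (hk : 1 ≤ k) :
    (branchingKernel M k.bits r).WellFormed ∧
      ((∀ v ∈ (branchingKernel M k.bits r).1 :: (branchingKernel M k.bits r).2.1,
        Reach (arcRel (branchingKernel M k.bits r).2.2) ∅ (branchingKernel M k.bits r).1 v) ∧
        HasLeaves (arcRel (branchingKernel M k.bits r).2.2) (branchingKernel M k.bits r).1 k ↔
        (∀ v < M.length, Reach (arcRel (matrixArcs M)) ∅ r v) ∧
        HasLeaves (arcRel (matrixArcs M)) r k) ∧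
      ((branchingKernel M k.bits r).1 :: (branchingKernel M k.bits r).2.1).length ≤
        2000 * k ^ 3 := by
  have hnd : (rootReach M r).Nodup := nodup_reachList List.nodup_range
  have hsub : rootReach M r ⊆ List.range M.length := by
    obtain ⟨p, hp⟩ := exists_filter_reachStep_iterate (List.range M.length) (rootArcs M r) r []
      (List.range M.length).length
    rw [rootReach, reachList, hp]
    exact List.filter_subset_self _
  unfold branchingKernel
  by_cases h : M.length ≤ (rootReach M r).length
  · rw [if_pos (decide_eq_true h)]
    obtain ⟨h1, h2, h3, h4⟩ := treeKernel_spec hr hk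
    refine ⟨h1, ?_, h4⟩
    rw [h3]
    refine and_congr_left' (iff_of_true h2 fun v hv => (mem_rootReach hr).1 ?_)
    refine ((List.subperm_of_subset hnd hsub).perm_of_length_le ?_).mem_iff.2 (List.mem_range.2 hv)
    rwa [List.length_range]
  -- An unreachable vertex excludes out-branchings, and two vertices without arcs form a fixed
  -- no-instance. Its size is within the bound because `1 ≤ k`.
  · rw [if_neg (by simpa using h)]
    refine ⟨⟨by simp, by simp⟩, iff_of_false (fun h' => ?_) (fun h' => h ?_), ?_⟩
    · refine absurd ((h'.1 1 (by simp)).induct (· = 0) rfl fun a b _ _ _ hab => ?_) one_ne_zero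
      simp [arcRel] at hab
    · refine List.length_range.symm.trans_le (List.subperm_of_subset List.nodup_range
        fun v hv => (mem_rootReach hr).2 (h'.1 v (List.mem_range.1 hv))).length_le
    · have := Nat.one_le_pow 3 k hk
      simp only [List.length_cons, List.length_nil]
      omega

end LeafKernel

namespace LeafKernel

open Enc

/-! ### The kernel is computed in polynomial time -/

section PolyTime

variable {α : Type} [Enc α]

theorem PT.hasVertex {l : α → List ℕ} {v : α → ℕ} (hl : PT l) (hv : PT v) :
    PT (fun a => hasVertex (l a) (v a)) :=
  PT.any (f := fun a w => w == v a) hl (PT.id.snd.beq (hv.comp PT.id.fst))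

theorem PT.hasArc {E : α → List (ℕ × ℕ)} {u v : α → ℕ} (hE : PT E) (hu : PT u) (hv : PT v) :
    PT (fun a => hasArc (E a) (u a) (v a)) :=
  PT.any (f := fun a (e : ℕ × ℕ) => e.1 == u a && e.2 == v a) hE
    ((PT.id.snd.fst.beq (hu.comp PT.id.fst)).and (PT.id.snd.snd.beq (hv.comp PT.id.fst)))

theorem PT.reachStep {V : α → List ℕ} {E : α → List (ℕ × ℕ)} {L R : α → List ℕ} (hV : PT V)
    (hE : PT E) (hL : PT L) (hR : PT R) : PT (fun a => reachStep (V a) (E a) (L a) (R a)) :=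
  PT.filter (f := fun a v => LeafKernel.hasVertex (R a) v ||
      (E a).any fun e => e.2 == v && (LeafKernel.hasVertex (R a) e.1 &&
        !LeafKernel.hasVertex (L a) e.1)) hV
    (((hR.comp PT.id.fst).hasVertex PT.id.snd).or
      (PT.any (f := fun (p : α × ℕ) (e : ℕ × ℕ) => e.2 == p.2 &&
          (LeafKernel.hasVertex (R p.1) e.1 && !LeafKernel.hasVertex (L p.1) e.1))
        (hE.comp PT.id.fst)
        ((PT.id.snd.snd.beq PT.id.fst.snd).and
          (((hR.comp PT.id.fst.fst).hasVertex PT.id.snd.fst).and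
            ((hL.comp PT.id.fst.fst).hasVertex PT.id.snd.fst).not))))

theorem PT.reachList {V : α → List ℕ} {E : α → List (ℕ × ℕ)} {r : α → ℕ} {L : α → List ℕ}
    (hV : PT V) (hE : PT E) (hr : PT r) (hL : PT L) :
    PT (fun a => reachList (V a) (E a) (r a) (L a)) := by
  refine PT.iterate (s := fun a => LeafKernel.reachStep (V a) (E a) (L a)) hV.length
    (PT.filter (f := fun a v => v == r a) hV (PT.id.snd.beq (hr.comp PT.id.fst)))
    ((hV.comp PT.id.fst).reachStep (hE.comp PT.id.fst) (hL.comp PT.id.fst) PT.id.snd) ?_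
  obtain ⟨Q, hQ⟩ := hV.sz_le
  refine ⟨Q, fun a m _ => ?_⟩
  obtain ⟨p, hp⟩ := exists_filter_reachStep_iterate (V a) (E a) (r a) (L a) m
  rw [hp]
  exact (sz_le_of_sublist List.filter_sublist).trans (hQ a)

theorem PT.isCut {V : α → List ℕ} {E : α → List (ℕ × ℕ)} {r x : α → ℕ}
    (hV : PT V) (hE : PT E) (hr : PT r) (hx : PT x) :
    PT (fun a => isCut (V a) (E a) (r a) (x a)) :=
  (hx.beq hr).not.and (PT.any (f := fun a v => !(v == x a) &&
      !LeafKernel.hasVertex (LeafKernel.reachList (V a) (E a) (r a) [x a]) v) hV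
    ((PT.id.snd.beq (hx.comp PT.id.fst)).not.and
      (((hV.reachList hE hr (hx.cons (PT.const []))).comp PT.id.fst).hasVertex PT.id.snd).not))

theorem PT.nbrsAre {V : α → List ℕ} {E : α → List (ℕ × ℕ)} {x p q : α → ℕ}
    (hV : PT V) (hE : PT E) (hx : PT x) (hp : PT p) (hq : PT q) :
    PT (fun a => nbrsAre (V a) (E a) (x a) (p a) (q a)) :=
  have h : PT (fun b : α × ℕ => b.2 == p b.1 || b.2 == q b.1) :=
    (PT.id.snd.beq (hp.comp PT.id.fst)).or (PT.id.snd.beq (hq.comp PT.id.fst))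
  PT.all (f := fun a w => (LeafKernel.hasArc (E a) w (x a) == (w == p a || w == q a)) &&
      (LeafKernel.hasArc (E a) (x a) w == (w == p a || w == q a))) hV
    ((((hE.comp PT.id.fst).hasArc PT.id.snd (hx.comp PT.id.fst)).beqBool h).and
      (((hE.comp PT.id.fst).hasArc (hx.comp PT.id.fst) PT.id.snd).beqBool h))

theorem PT.isBipathList {V : α → List ℕ} {E : α → List (ℕ × ℕ)} {x a' p q c : α → ℕ}
    (hV : PT V) (hE : PT E) (hx : PT x) (ha : PT a') (hp : PT p) (hq : PT q) (hc : PT c) :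
    PT (fun a => isBipathList (V a) (E a) (x a) (a' a) (p a) (q a) (c a)) :=
  ((hV.nbrsAre hE hp ha hx).and ((hV.nbrsAre hE hx hp hq).and (hV.nbrsAre hE hq hc hx))).and
    ((hp.beq hx).not.and ((hp.beq hq).not.and ((hx.beq hq).not.and ((ha.beq hp).not.and
      ((ha.beq hx).not.and ((hc.beq hx).not.and (hc.beq hq).not))))))

theorem PT.isMid {V : α → List ℕ} {E : α → List (ℕ × ℕ)} {x : α → ℕ} (hV : PT V) (hE : PT E)
    (hx : PT x) : PT (fun a => isMid (V a) (E a) (x a)) :=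
  PT.any (f := fun a y => (V a).any fun p => (V a).any fun q => (V a).any fun c =>
      LeafKernel.isBipathList (V a) (E a) (x a) y p q c) hV
    (PT.any (f := fun (b : α × ℕ) p => (V b.1).any fun q => (V b.1).any fun c =>
        LeafKernel.isBipathList (V b.1) (E b.1) (x b.1) b.2 p q c) (hV.comp PT.id.fst)
      (PT.any (f := fun (b : (α × ℕ) × ℕ) q => (V b.1.1).any fun c =>
          LeafKernel.isBipathList (V b.1.1) (E b.1.1) (x b.1.1) b.1.2 b.2 q c)
        (hV.comp PT.id.fst.fst)
        (PT.any (f := fun (b : ((α × ℕ) × ℕ) × ℕ) c => LeafKernel.isBipathList (V b.1.1.1)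
            (E b.1.1.1) (x b.1.1.1) b.1.1.2 b.1.2 b.2 c)
          (hV.comp PT.id.fst.fst.fst)
          ((hV.comp PT.id.fst.fst.fst.fst).isBipathList (hE.comp PT.id.fst.fst.fst.fst)
            (hx.comp PT.id.fst.fst.fst.fst) PT.id.fst.fst.fst.snd PT.id.fst.fst.snd
            PT.id.fst.snd PT.id.snd))))

theorem PT.otherIn {E : α → List (ℕ × ℕ)} {x y : α → ℕ} (hE : PT E) (hx : PT x) (hy : PT y) :
    PT (fun a => otherIn (E a) (x a) (y a)) :=
  PT.map (f := fun _ (e : ℕ × ℕ) => e.1)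
    (PT.filter (f := fun a (e : ℕ × ℕ) => e.2 == x a && !(e.1 == y a)) hE
    ((PT.id.snd.snd.beq (hx.comp PT.id.fst)).and
      (PT.id.snd.fst.beq (hy.comp PT.id.fst)).not)) PT.id.snd.fst

theorem PT.isAvoidable {V : α → List ℕ} {E : α → List (ℕ × ℕ)} {r : α → ℕ} {e : α → ℕ × ℕ}
    (hV : PT V) (hE : PT E) (hr : PT r) (he : PT e) :
    PT (fun a => isAvoidable (V a) (E a) (r a) (e a)) :=
  ((hV.reachList hE hr (hE.otherIn he.snd he.fst)).hasVertex he.fst).not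

theorem PT.bypassList {P : α → List (ℕ × ℕ)} {V : α → List ℕ} {E : α → List (ℕ × ℕ)} {x : α → ℕ}
    (hP : PT P) (hV : PT V) (hE : PT E) (hx : PT x) :
    PT (fun a => bypassList (P a) (V a) (E a) (x a)) :=
  (PT.filter (f := fun a v => !(v == x a)) hV (PT.id.snd.beq (hx.comp PT.id.fst)).not).pair
    (PT.filter (f := fun a (e : ℕ × ℕ) => !(e.1 == x a) && (!(e.2 == x a) && (!(e.1 == e.2) &&
        (LeafKernel.hasArc (E a) e.1 e.2 ||
          (LeafKernel.hasArc (E a) e.1 (x a) && LeafKernel.hasArc (E a) (x a) e.2))))) hP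
      ((PT.id.snd.fst.beq (hx.comp PT.id.fst)).not.and
        ((PT.id.snd.snd.beq (hx.comp PT.id.fst)).not.and
          ((PT.id.snd.fst.beq PT.id.snd.snd).not.and
            (((hE.comp PT.id.fst).hasArc PT.id.snd.fst PT.id.snd.snd).or
              (((hE.comp PT.id.fst).hasArc PT.id.snd.fst (hx.comp PT.id.fst)).and
                ((hE.comp PT.id.fst).hasArc (hx.comp PT.id.fst) PT.id.snd.snd)))))))

theorem PT.vertexCandidates {V : α → List ℕ} {E : α → List (ℕ × ℕ)} {r : α → ℕ} (hV : PT V)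
    (hE : PT E) (hr : PT r) : PT (fun a => vertexCandidates (V a) (E a) (r a)) :=
  PT.filter (f := fun a x => LeafKernel.isCut (V a) (E a) (r a) x ||
      LeafKernel.isMid (V a) (E a) x) hV
    (((hV.comp PT.id.fst).isCut (hE.comp PT.id.fst) (hr.comp PT.id.fst) PT.id.snd).or
      ((hV.comp PT.id.fst).isMid (hE.comp PT.id.fst) PT.id.snd))

theorem PT.arcCandidates {V : α → List ℕ} {E : α → List (ℕ × ℕ)} {r : α → ℕ} (hV : PT V)
    (hE : PT E) (hr : PT r) : PT (fun a => arcCandidates (V a) (E a) (r a)) :=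
  PT.filter (f := fun a (e : ℕ × ℕ) => LeafKernel.isAvoidable (V a) (E a) (r a) e) hE
    ((hV.comp PT.id.fst).isAvoidable (hE.comp PT.id.fst) (hr.comp PT.id.fst) PT.id.snd)

theorem PT.eraseArc {E : α → List (ℕ × ℕ)} {d : α → ℕ × ℕ} (hE : PT E) (hd : PT d) :
    PT (fun a => eraseArc (E a) (d a)) :=
  PT.filter (f := fun a (e : ℕ × ℕ) => !(e.1 == (d a).1 && e.2 == (d a).2)) hE
    ((PT.id.snd.fst.beq (hd.comp PT.id.fst).fst).and
      (PT.id.snd.snd.beq (hd.comp PT.id.fst).snd)).not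

theorem PT.reduceStep {P : α → List (ℕ × ℕ)} {r : α → ℕ} {G : α → List ℕ × List (ℕ × ℕ)}
    (hP : PT P) (hr : PT r) (hG : PT G) : PT (fun a => reduceStep (P a) (r a) (G a)) :=
  have hx := hG.fst.vertexCandidates hG.snd hr
  have hd := hG.fst.arcCandidates hG.snd hr
  PT.ite hx.isEmpty
    (PT.ite hd.isEmpty hG (hG.fst.pair (hG.snd.eraseArc (hd.headD (PT.const (0, 0))))))
    (hP.bypassList hG.fst hG.snd (hx.headD (PT.const 0)))

theorem reduceStep_sublist (P : List (ℕ × ℕ)) (r : ℕ) (G : List ℕ × List (ℕ × ℕ)) :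
    List.Sublist (reduceStep P r G).1 G.1 ∧
      (List.Sublist (reduceStep P r G).2 G.2 ∨ List.Sublist (reduceStep P r G).2 P) := by
  unfold reduceStep
  split_ifs
  · exact ⟨List.Sublist.refl _, .inl (List.Sublist.refl _)⟩
  · exact ⟨List.Sublist.refl _, .inl List.filter_sublist⟩
  · exact ⟨List.filter_sublist, .inr List.filter_sublist⟩

/-- Bypasses may add arcs, but every intermediate arc list is a sublist of the initial one or of
`P`, which gives the size bound needed for the iteration. -/
theorem PT.reduce {P : α → List (ℕ × ℕ)} {r : α → ℕ} {G : α → List ℕ × List (ℕ × ℕ)}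
    (hP : PT P) (hr : PT r) (hG : PT G) : PT (fun a => reduce (P a) (r a) (G a)) := by
  refine PT.iterate (s := fun a => LeafKernel.reduceStep (P a) (r a))
    ((hG.fst.length.mul hP.length.succ).add hP.length) hG
    ((hP.comp PT.id.fst).reduceStep (hr.comp PT.id.fst) PT.id.snd) ?_
  obtain ⟨Q, hQ⟩ := hG.sz_le
  obtain ⟨Q', hQ'⟩ := hP.sz_le
  refine ⟨Q + Q', fun a m _ => ?_⟩
  have key : List.Sublist ((LeafKernel.reduceStep (P a) (r a))^[m] (G a)).1 (G a).1 ∧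
      (List.Sublist ((LeafKernel.reduceStep (P a) (r a))^[m] (G a)).2 (G a).2 ∨
        List.Sublist ((LeafKernel.reduceStep (P a) (r a))^[m] (G a)).2 (P a)) := by
    induction m with
    | zero => exact ⟨List.Sublist.refl _, .inl (List.Sublist.refl _)⟩
    | succ m ih =>
      have ih := ih (by omega)
      rw [Function.iterate_succ_apply']
      obtain ⟨h1, h2⟩ := reduceStep_sublist (P a) (r a)
        ((LeafKernel.reduceStep (P a) (r a))^[m] (G a))
      exact ⟨h1.trans ih.1, h2.elim (fun h => ih.2.imp h.trans h.trans) .inr⟩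
  generalize (LeafKernel.reduceStep (P a) (r a))^[m] (G a) = H at key
  have h1 := sz_le_of_sublist key.1
  have h2 : sz H.2 ≤ sz (G a).2 + sz (P a) := by
    rcases key.2 with h | h
    · exact (sz_le_of_sublist h).trans (Nat.le_add_right _ _)
    · exact (sz_le_of_sublist h).trans (Nat.le_add_left _ _)
  have h3 : sz H = sz H.1 + sz H.2 + 1 := rfl
  have h4 : sz (G a) = sz (G a).1 + sz (G a).2 + 1 := rfl
  have h5 := hQ a
  have h6 := hQ' a
  rw [Polynomial.eval_add]
  omega

theorem PT.entry {M : α → List (List Bool)} {i j : α → ℕ} (hM : PT M) (hi : PT i) (hj : PT j) :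
    PT (fun a => entry (M a) (i a) (j a)) :=
  (hj.drop ((hi.drop hM).headD (PT.const []))).headD (PT.const false)

theorem PT.rootArcs {M : α → List (List Bool)} {v : α → ℕ} (hM : PT M) (hv : PT v) :
    PT (fun a => rootArcs (M a) (v a)) :=
  PT.filter (f := fun a (e : ℕ × ℕ) => !(e.1 == e.2) && !(e.2 == v a))
    (PT.filter (f := fun a (e : ℕ × ℕ) => LeafKernel.entry (M a) e.1 e.2)
      (hM.length.range.product hM.length.range)
      ((hM.comp PT.id.fst).entry PT.id.snd.fst PT.id.snd.snd))
    ((PT.id.snd.fst.beq PT.id.snd.snd).not.and (PT.id.snd.snd.beq (hv.comp PT.id.fst)).not)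

theorem PT.rootReach {M : α → List (List Bool)} {v : α → ℕ} (hM : PT M) (hv : PT v) :
    PT (fun a => rootReach (M a) (v a)) :=
  hM.length.range.reachList (hM.rootArcs hv) hv (PT.const [])

theorem PT.reducedGraph {M : α → List (List Bool)} {v : α → ℕ} (hM : PT M) (hv : PT v) :
    PT (fun a => reducedGraph (M a) (v a)) :=
  have hR := hM.rootReach hv
  (hR.product hR).reduce hv (hR.pair (PT.filter
    (f := fun a (e : ℕ × ℕ) => LeafKernel.hasArc (LeafKernel.rootArcs (M a) (v a)) e.1 e.2)
    (hR.product hR)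
    (((hM.rootArcs hv).comp PT.id.fst).hasArc PT.id.snd.fst PT.id.snd.snd)))

/-- `k` comes in binary, so its unary value could be exponentially long. Capping inside the fold
keeps every accumulator at most `N`, and unary arithmetic becomes affordable. -/
theorem PT.cappedVal {N : α → ℕ} {bits : α → List Bool} (hN : PT N) (hbits : PT bits) :
    PT (fun a => cappedVal (N a) (bits a)) := by
  refine (PT.foldl (l := fun a => (bits a).reverse) (i := fun _ => 0)
    (s := fun a v b => Min.min (v + v + if b = true then 1 else 0) (N a)) hbits.reverse
    (PT.const 0) ((((PT.id.snd.fst.add PT.id.snd.fst).add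
      (PT.id.snd.snd.ite (PT.const 1) (PT.const 0)))).min (hN.comp PT.id.fst)) ?_).congr
    fun a => by rw [List.foldl_reverse]; rfl
  obtain ⟨Q, hQ⟩ := hN.sz_le
  refine ⟨Q, fun a l _ => le_trans ?_ (hQ a)⟩
  rw [sz_nat, sz_nat]
  have : l.foldl (fun v b => Min.min (v + v + if b = true then 1 else 0) (N a)) 0 ≤ N a := by
    rcases l.eq_nil_or_concat with rfl | ⟨l, b, rfl⟩
    · exact Nat.zero_le _
    · rw [List.concat_eq_append, List.foldl_append]
      exact min_le_right _ _
  omega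

theorem PT.star {k : α → ℕ} (hk : PT k) : PT (fun a => star (k a)) :=
  (PT.const 0).pair ((PT.map (f := fun _ i => i + 1) hk.range PT.id.snd.succ).pair
    (PT.map (f := fun _ i => (0, i + 1)) hk.range ((PT.const 0).pair PT.id.snd.succ)))

theorem PT.treeKernel {M : α → List (List Bool)} {bits : α → List Bool} {v : α → ℕ} (hM : PT M)
    (hbits : PT bits) (hv : PT v) : PT (fun a => treeKernel (M a) (bits a) (v a)) :=
  have hG := hM.reducedGraph hv
  have hk := hM.length.succ.cappedVal hbits
  PT.ite (hG.fst.length.ble ((PT.const 2000).mul ((hk.mul hk).mul hk)))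
    (hv.pair ((PT.filter (f := fun a u => !(u == v a)) hG.fst
      (PT.id.snd.beq (hv.comp PT.id.fst)).not).pair hG.snd)) hk.star

theorem PT.branchingKernel {M : α → List (List Bool)} {bits : α → List Bool} {v : α → ℕ}
    (hM : PT M) (hbits : PT bits) (hv : PT v) :
    PT (fun a => branchingKernel (M a) (bits a) (v a)) :=
  PT.ite (hM.length.ble (hM.rootReach hv).length) (hM.treeKernel hbits hv) (PT.const _)

end PolyTime

/-! ### Encodings of instances -/

open Classical in
/-- The adjacency matrix. -/
noncomputable def Instance.matrix (I : Instance) : List (List Bool) :=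
  (List.finRange I.n).map fun u => (List.finRange I.n).map fun v => decide (I.graph.Adj u v)

theorem encodeList_map {α β : Type} (e : β → Data) (f : α → β) (l : List α) :
    encodeList e (l.map f) = encodeList (fun a => e (f a)) l := by
  simp only [encodeList, List.foldr_map]

/-- Programs built for lists run on instances unchanged, since the codes coincide. -/
theorem Instance.encode_eq (I : Instance) : I.encode = enc (I.matrix, I.k.bits) := by
  change Data.cons _ _ = Data.cons (encodeList (encodeList encodeBool) I.matrix) _
  rw [Instance.matrix, encodeList_map]
  simp only [encodeList_map]
  rfl

theorem Instance.length_matrix (I : Instance) : I.matrix.length = I.n := by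
  simp [Instance.matrix]

theorem Instance.mem_matrixArcs (I : Instance) (u v : Fin I.n) :
    (↑u, ↑v) ∈ matrixArcs I.matrix ↔ I.graph.Adj u v := by
  rw [LeafKernel.mem_matrixArcs, I.length_matrix]
  simp [entry, Instance.matrix, List.headD_eq_head?_getD]

/-- The adjacency matrix of a rooted graph. -/
def RootedGraph.matrix (g : RootedGraph) : List (List Bool) :=
  (g.1 :: g.2.1).map fun u => (g.1 :: g.2.1).map fun v => hasArc g.2.2 u v

theorem map_get_finRange {α : Type} (l : List α) : (List.finRange l.length).map l.get = l := by
  rw [← List.ofFn_eq_map, List.ofFn_get]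

theorem RootedGraph.matrix_toInstance (g : RootedGraph) (k : ℕ) :
    (g.toInstance k).toInstance.matrix = g.matrix := by
  have h : ∀ {β : Type} (f : ℕ → β), (List.finRange (g.1 :: g.2.1).length).map
      (fun i => f ((g.1 :: g.2.1).get i)) = (g.1 :: g.2.1).map f := by
    intro β f
    conv_rhs => rw [← map_get_finRange (g.1 :: g.2.1), List.map_map]
    rfl
  unfold RootedGraph.matrix
  rw [← h]
  refine List.map_congr_left fun i _ => ?_
  rw [← h]
  refine List.map_congr_left fun j _ => ?_
  exact Bool.eq_iff_iff.2 ((@decide_eq_true_iff _ (_)).trans hasArc_eq_true.symm)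

/-- The root is the vertex `0`, whose binary code is the empty list. So only the matrix has to be
computed, and the digits of `k` are copied. -/
theorem RootedGraph.encode_toInstance (g : RootedGraph) (k : ℕ) :
    (g.toInstance k).encode = enc (([] : List Bool), g.matrix, k.bits) := by
  rw [← g.matrix_toInstance k]
  change Data.cons (encodeNat 0) (g.toInstance k).toInstance.encode = _
  rw [Instance.encode_eq, encodeNat, Nat.zero_bits]
  rfl

theorem PT.matrix {α : Type} [Enc α] {g : α → RootedGraph} (hg : PT g) :
    PT (fun a => (g a).matrix) :=
  have hl : PT (fun a => (g a).1 :: (g a).2.1) := hg.fst.cons hg.snd.fst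
  PT.map (f := fun a u => ((g a).1 :: (g a).2.1).map fun v => LeafKernel.hasArc (g a).2.2 u v) hl
    (PT.map (f := fun (p : α × ℕ) v => LeafKernel.hasArc (g p.1).2.2 p.2 v) (hl.comp PT.id.fst)
      ((hg.snd.snd.comp PT.id.fst.fst).hasArc PT.id.fst.snd PT.id.snd))

/-- The list of instances obtained by applying a kernelization for every root. -/
noncomputable def kernelList (K : List (List Bool) → List Bool → ℕ → RootedGraph) (I : Instance) :
    List RootedInstance :=
  (List.range I.n).map fun v => (K I.matrix I.k.bits v).toInstance I.k

theorem polyTime_kernelList {K : List (List Bool) → List Bool → ℕ → RootedGraph}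
    (hK : PT (fun p : (List (List Bool) × List Bool) × ℕ => K p.1.1 p.1.2 p.2)) :
    PolyTime Instance.encode (encodeList RootedInstance.encode) (kernelList K) := by
  obtain ⟨p, P, h⟩ := PT.map
    (f := fun (a : List (List Bool) × List Bool) v => (([] : List Bool), (K a.1 a.2 v).matrix, a.2))
    PT.id.fst.length.range ((PT.const []).pair (hK.matrix.pair PT.id.fst.snd))
  refine ⟨p, P, fun I => ?_⟩
  have h := h (I.matrix, I.k.bits)
  have henc : encodeList RootedInstance.encode (kernelList K I) =
      enc ((List.range I.matrix.length).map fun v =>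
        (([] : List Bool), (K I.matrix I.k.bits v).matrix, I.k.bits)) := by
    change _ = encodeList enc _
    rw [I.length_matrix, kernelList, encodeList_map, encodeList_map]
    simp only [RootedGraph.encode_toInstance]
  rw [I.encode_eq, henc]
  exact h

theorem getElem_kernelList {K : List (List Bool) → List Bool → ℕ → RootedGraph} {I : Instance}
    {v : ℕ} (hv : v < (kernelList K I).length) :
    (kernelList K I)[v] = (K I.matrix I.k.bits v).toInstance I.k := by
  simp [kernelList]

theorem mem_kernelList {K : List (List Bool) → List Bool → ℕ → RootedGraph} {I : Instance}
    {J : RootedInstance} : J ∈ kernelList K I ↔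
      ∃ v : Fin I.n, (K I.matrix I.k.bits v).toInstance I.k = J := by
  simp only [kernelList, List.mem_map, List.mem_range]
  exact ⟨fun ⟨v, hv, h⟩ => ⟨⟨v, hv⟩, h⟩, fun ⟨v, h⟩ => ⟨v, v.2, h⟩⟩

theorem Instance.reach_iff (I : Instance) {r v : Fin I.n} :
    Reach (arcRel (matrixArcs I.matrix)) ∅ ↑r ↑v ↔ Reach I.graph.Adj ∅ r v :=
  reach_map_iff Fin.val_injective (fun a b => (I.mem_matrixArcs a b).symm) (fun _ w hw =>
    ⟨⟨w, I.length_matrix ▸ (LeafKernel.mem_matrixArcs.1 hw).2.1⟩, rfl⟩) (by simp)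

theorem Instance.hasLeaves_iff (I : Instance) {r : Fin I.n} {k : ℕ} :
    HasLeaves (arcRel (matrixArcs I.matrix)) ↑r k ↔ HasLeaves I.graph.Adj r k :=
  hasLeaves_map_iff Fin.val_injective (fun a b => (I.mem_matrixArcs a b).symm) fun _ w hw =>
    ⟨⟨w, I.length_matrix ▸ (LeafKernel.mem_matrixArcs.1 hw).2.1⟩, rfl⟩

theorem outTree_treeKernel (I : Instance) (hk : 1 ≤ I.k) (v : Fin I.n) :
    ((treeKernel I.matrix I.k.bits v).toInstance I.k).OutTree ↔ (I.rootAt v).OutTree := by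
  obtain ⟨h1, -, h2, -⟩ := treeKernel_spec (v.2.trans_eq I.length_matrix.symm) hk
  rw [RootedInstance.outTree_iff, RootedInstance.outTree_iff]
  exact h1.hasLeaves_iff.trans (h2.trans I.hasLeaves_iff)

theorem outBranching_branchingKernel (I : Instance) (hk : 1 ≤ I.k) (v : Fin I.n) :
    ((branchingKernel I.matrix I.k.bits v).toInstance I.k).OutBranching ↔
      (I.rootAt v).OutBranching := by
  obtain ⟨h1, h2, -⟩ := branchingKernel_spec (v.2.trans_eq I.length_matrix.symm) hk
  rw [RootedInstance.outBranching_iff, RootedInstance.outBranching_iff]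
  refine (and_congr h1.reach_iff h1.hasLeaves_iff).trans (h2.trans (and_congr ?_ I.hasLeaves_iff))
  rw [I.length_matrix]
  exact ⟨fun h u => I.reach_iff.1 (h u u.2), fun h u hu => I.reach_iff (v := ⟨u, hu⟩) |>.2 (h _)⟩

end LeafKernel

/-! ### The kernels for all roots -/

theorem mainTheorem6 :
    (∃ (c : ℕ) (f : LeafKernel.Instance → List LeafKernel.RootedInstance),
      LeafKernel.PolyTime LeafKernel.Instance.encode
        (LeafKernel.encodeList LeafKernel.RootedInstance.encode) f ∧
      ∀ I : LeafKernel.Instance, 1 ≤ I.k →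
        (∃ hlen : (f I).length = I.n, ∀ v : Fin I.n,
          ((f I)[v]).k = I.k ∧
          ((f I)[v]).n ≤ c * I.k ^ 3 ∧
          (((f I)[v]).OutBranching ↔ (I.rootAt v).OutBranching)) ∧
        (I.OutBranching ↔ ∃ J ∈ f I, J.OutBranching) ∧
        (I.OutBranching ↔ ∃ J ∈ f I, J.toInstance.OutBranching)) ∧
    (∃ (c : ℕ) (f : LeafKernel.Instance → List LeafKernel.RootedInstance),
      LeafKernel.PolyTime LeafKernel.Instance.encode
        (LeafKernel.encodeList LeafKernel.RootedInstance.encode) f ∧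
      ∀ I : LeafKernel.Instance, 1 ≤ I.k →
        (∃ hlen : (f I).length = I.n, ∀ v : Fin I.n,
          ((f I)[v]).k = I.k ∧
          ((f I)[v]).n ≤ c * I.k ^ 3 ∧
          (((f I)[v]).OutTree ↔ (I.rootAt v).OutTree)) ∧
        (I.OutTree ↔ ∃ J ∈ f I, J.OutTree)) := by
  open LeafKernel in
  refine ⟨⟨2000, kernelList branchingKernel, polyTime_kernelList
      (PT.id.fst.fst.branchingKernel PT.id.fst.snd PT.id.snd), fun I hk => ?_⟩,
    ⟨2000, kernelList treeKernel, polyTime_kernelList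
      (PT.id.fst.fst.treeKernel PT.id.fst.snd PT.id.snd), fun I hk => ?_⟩⟩
  · have hspec := fun v : Fin I.n => branchingKernel_spec (v.2.trans_eq I.length_matrix.symm) hk
    have hiff : I.OutBranching ↔ ∃ J ∈ kernelList branchingKernel I, J.OutBranching := by
      constructor
      · rintro ⟨T, v, hT⟩
        exact ⟨_, mem_kernelList.2 ⟨v, rfl⟩, (outBranching_branchingKernel I hk v).2 ⟨T, hT⟩⟩
      · rintro ⟨J, hJ, h⟩
        obtain ⟨v, rfl⟩ := mem_kernelList.1 hJ
        obtain ⟨T, hT⟩ := (outBranching_branchingKernel I hk v).1 h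
        exact ⟨T, v, hT⟩
    refine ⟨⟨by simp [kernelList], fun v => ?_⟩, hiff, hiff.trans ?_⟩
    · simp only [Fin.getElem_fin, getElem_kernelList]
      exact ⟨rfl, (hspec v).2.2, outBranching_branchingKernel I hk v⟩
    -- The root of each kernel has in-degree zero, so an out-branching with any root has this root.
    · refine exists_congr fun J => and_congr_right fun hJ => ?_
      obtain ⟨v, rfl⟩ := mem_kernelList.1 hJ
      exact (hspec v).1.outBranching_iff.symm
  · have hspec := fun v : Fin I.n => treeKernel_spec (v.2.trans_eq I.length_matrix.symm) hk
    refine ⟨⟨by simp [kernelList], fun v => ?_⟩, ?_, ?_⟩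
    · simp only [Fin.getElem_fin, getElem_kernelList]
      exact ⟨rfl, (hspec v).2.2.2, outTree_treeKernel I hk v⟩
    · rintro ⟨T, v, hT⟩
      exact ⟨_, mem_kernelList.2 ⟨v, rfl⟩, (outTree_treeKernel I hk v).2 ⟨T, hT⟩⟩
    · rintro ⟨J, hJ, h⟩
      obtain ⟨v, rfl⟩ := mem_kernelList.1 hJ
      obtain ⟨T, hT⟩ := (outTree_treeKernel I hk v).1 h
      exact ⟨T, v, hT⟩
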